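/- Let $(M,g)$ be a smooth Riemannian manifold of dimension $n$ (without boundary), with Riemann curvature tensor $R$, regarded as a double form of bidegree $(2,2)$ and normalised so that $R(x\wedge y,x\wedge y)$ is the sectional curvature for orthonormal $x,y$. Let $c$ be the contraction of double forms, so that $cR$ is the Ricci tensor and $c^2R$ the scalar curvature. For $0\le p\le n-2$ the $p$-curvature $s_p(P)$ of a tangent $p$-plane $P=\mathrm{span}(e_1,\dots,e_p)$ ($e_i$ orthonormal) is the value $\omega(e_1\wedge\dots\wedge e_p,e_1\wedge\dots\wedge e_p)$ of the double form $\omega=\frac1{(n-2-p)!}*(g^{n-2-p}R)$, where products are taken in the algebra of double forms, $(\theta_1\otimes\theta_2)(\theta_3\otimes\theta_4)=(\theta_1\wedge\theta_3)\otimes(\theta_2\wedge\theta_4)$, and $*(\theta_1\otimes\theta_2)=*\theta_1\otimes *\theta_2$. By convention $s_{n-1}=0$. A function of tangent $p$-planes is called constant if it takes one and the same value on all tangent $p$-planes at all points of $M$. The metric is Einstein if $cR=\kappa g$ for a constant $\kappa$; it is conformally flat if every point has an open neighbourhood $U$ with a smooth function $f$ on $U$ such that $e^{2f}g$ is flat on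 $U$. 1. For each $2\le p\le n-2$, the function $s_p$ is constant if and only if $(M,g)$ has constant sectional curvature. 2. Let $n\ge 3$ and $1\le p\le n-1$, and if $n=2p$ let $M$ be connected. Then $(M,g)$ is Einstein if and only if the function $P\mapsto s_p(P)-s_{n-p}(P^\perp)$ on tangent $p$-planes is constant. Whenever this function is constant, equal to $\lambda$, we have $\lambda=\frac{n-2p}{2n}\,c^2R$ at every point. 3. For each $2\le p\le n-2$ with $p\ne n/2$, the function $P\mapsto s_p(P)+s_{n-p}(P^\perp)$ on tangent $p$-planes is constant if and only if $(M,g)$ has constant sectional curvature. Whenever this function is constant, equal to $\lambda$, we have $\lambda=\frac{2p(p-1)+(n-2p)(n-1)}{2n(n-1)}\,c^2R$ at every point. 4. Let $n=2p$ with $p\ge 2$. Then $(M,g)$ is conformally flat with constant scalar curvature if and only if the function $P\mapsto s_p(P)+s_p(P^\perp)$ on tangent $p$-planes is constant. Whenever this function is constant, equal to $\lambda$, we have $\lambda=\frac{n-2}{4(n-1)}\,c^2R$ at every point. -/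

import Mathlib

open scoped Manifold ContDiff TensorProduct
open Module

noncomputable section

/-! ### Double forms on a real vector space -/

/-- Double forms of bidegree `(p, q)` on `V`: multilinear forms in `p + q` arguments that are
alternating in the first `p` and in the last `q` of them. -/
abbrev DoubleForm (V : Type*) [AddCommGroup V] [Module ℝ V] (p q : ℕ) : Type _ :=
  V [⋀^Fin p]→ₗ[ℝ] (V [⋀^Fin q]→ₗ[ℝ] ℝ)

namespace DoubleForm

theorem append_update {V : Type*} {p r : ℕ} (v : Fin p → V) (y : Fin r → V) (i : Fin r) (a : V) :
    Fin.append v (Function.update y i a) =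
      Function.update (Fin.append v y) (Fin.natAdd p i) a := by
  ext k
  refine Fin.addCases (fun k => ?_) (fun k => ?_) k
  · rw [Fin.append_left, Function.update_of_ne, Fin.append_left]
    simp [Fin.ext_iff]; omega
  · rw [Fin.append_right]
    by_cases hk : k = i
    · subst hk; simp
    · rw [Function.update_of_ne hk, Function.update_of_ne, Fin.append_right]
      simpa [Fin.ext_iff] using hk

section Algebra

variable {V : Type*} [AddCommGroup V] [Module ℝ V]

/-- The exterior product of alternating forms (the signed sum over shuffles, without numerical
factor), as a linear map on the tensor product. -/
def wedge (V : Type*) [AddCommGroup V] [Module ℝ V] (q s : ℕ) :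
    (V [⋀^Fin q]→ₗ[ℝ] ℝ) ⊗[ℝ] (V [⋀^Fin s]→ₗ[ℝ] ℝ) →ₗ[ℝ] (V [⋀^Fin (q + s)]→ₗ[ℝ] ℝ) :=
  (AlternatingMap.domDomCongrₗ ℝ finSumFinEquiv).toLinearMap ∘ₗ
    (LinearMap.mul' ℝ ℝ).compAlternatingMapₗ (S := ℝ) ∘ₗ AlternatingMap.domCoprod'

/-- The product of double forms, determined by
`(θ₁ ⊗ θ₂) . (θ₃ ⊗ θ₄) = (θ₁ ∧ θ₃) ⊗ (θ₂ ∧ θ₄)`. -/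
def mul {p q r s : ℕ} (α : DoubleForm V p q) (β : DoubleForm V r s) :
    DoubleForm V (p + r) (q + s) :=
  ((wedge V q s).compAlternatingMap (α.domCoprod β)).domDomCongr finSumFinEquiv

/-- The powers `α ^ k` of a double form `α` of bidegree `(1, 1)`. -/
def pow (α : DoubleForm V 1 1) : (k : ℕ) → DoubleForm V k k
  | 0 => AlternatingMap.constOfIsEmpty ℝ V (Fin 0) (AlternatingMap.constOfIsEmpty ℝ V (Fin 0) 1)
  | k + 1 => (pow α k).mul α

/-- A bilinear form seen as a double form of bidegree `(1, 1)`. -/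
def ofBilin (B : V →ₗ[ℝ] V →ₗ[ℝ] ℝ) : DoubleForm V 1 1 :=
  AlternatingMap.ofSubsingleton ℝ V (V [⋀^Fin 1]→ₗ[ℝ] ℝ) (0 : Fin 1)
    { toFun := fun x => AlternatingMap.ofSubsingleton ℝ V ℝ (0 : Fin 1) (B x)
      map_add' := fun x y => by ext v; simp
      map_smul' := fun a x => by ext v; simp }

/-- A skew-symmetric bilinear map as an alternating map. -/
def altOfSkew {N : Type*} [AddCommGroup N] [Module ℝ N] (F : V → V → N)
    (hadd : ∀ x x' y, F (x + x') y = F x y + F x' y) (hsmul : ∀ (a : ℝ) x y, F (a • x) y = a • F x y)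
    (hskew : ∀ x y, F x y = -F y x) : V [⋀^Fin 2]→ₗ[ℝ] N where
  toFun v := F (v 0) (v 1)
  map_update_add' v i x y := by
    fin_cases i
    · simp [hadd]
    · simp [hskew (v 0), hadd, add_comm]
  map_update_smul' v i a x := by
    fin_cases i
    · simp [hsmul]
    · simp [hskew (v 0), hsmul]
  map_eq_zero_of_eq' v i j h hij := by
    have key : ∀ x, F x x = 0 := fun x => by
      have h2 : (2 : ℝ) • F x x = 0 := by
        rw [two_smul]; nth_rewrite 1 [hskew x x]; simp
      simpa using h2
    have : v 0 = v 1 := by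
      fin_cases i <;> fin_cases j <;> first | exact absurd rfl hij | exact h | exact h.symm
    simp [this, key]

/-- A quadrilinear form that is skew in the first two and in the last two arguments, as a double
form of bidegree `(2, 2)`: `(x, y; z, w) ↦ F x y z w`. -/
def ofSkew (F : V → V → V → V → ℝ)
    (hadd : ∀ x x' y z w, F (x + x') y z w = F x y z w + F x' y z w)
    (hsmul : ∀ (a : ℝ) x y z w, F (a • x) y z w = a * F x y z w)
    (hskew : ∀ x y z w, F x y z w = -F y x z w)
    (hadd' : ∀ x y z z' w, F x y (z + z') w = F x y z w + F x y z' w)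
    (hsmul' : ∀ (a : ℝ) x y z w, F x y (a • z) w = a * F x y z w)
    (hskew' : ∀ x y z w, F x y z w = -F x y w z) : DoubleForm V 2 2 :=
  altOfSkew (fun x y => altOfSkew (F x y) (hadd' x y) (fun a => hsmul' a x y) (hskew' x y))
    (fun x x' y => by ext v; exact hadd x x' y (v 0) (v 1))
    (fun a x y => by ext v; exact hsmul a x y (v 0) (v 1))
    (fun x y => by ext v; exact hskew x y (v 0) (v 1))

end Algebra

section Euclidean

variable {V : Type*} [NormedAddCommGroup V] [InnerProductSpace ℝ V] [FiniteDimensional ℝ V]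

/-- The inner product `g` of `V`, as a double form of bidegree `(1, 1)`. -/
def metric (V : Type*) [NormedAddCommGroup V] [InnerProductSpace ℝ V] : DoubleForm V 1 1 :=
  ofBilin (innerₗ V)

/-- The contraction
`c α (x₁, …, x_p; y₁, …, y_q) = ∑ j, α (e_j, x₁, …, x_p; e_j, y₁, …, y_q)`,
with `e` an orthonormal basis of `V`. -/
def contract {p q : ℕ} (α : DoubleForm V (p + 1) (q + 1)) : DoubleForm V p q :=
  ∑ j, (AlternatingMap.curryLeftLinearMap.flip (stdOrthonormalBasis ℝ V j)).compAlternatingMap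
    (α.curryLeft (stdOrthonormalBasis ℝ V j))

/-- The form `(y₁, …, y_r) ↦ vol (v₁, …, v_p, y₁, …, y_r)` for `p + r = dim V`, where `vol` is the
volume form of the orientation given by an orthonormal basis of `V`. -/
def volContr {p r : ℕ} (h : p + r = finrank ℝ V) (v : Fin p → V) : V [⋀^Fin r]→ₗ[ℝ] ℝ where
  toFun y := ((stdOrthonormalBasis ℝ V).toBasis.det.domDomCongr (finCongr h.symm)) (Fin.append v y)
  map_update_add' y i a b := by
    rename_i dec
    rw [Subsingleton.elim dec (instDecidableEqFin r)]
    simp only [append_update, AlternatingMap.map_update_add]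
  map_update_smul' y i a b := by
    rename_i dec
    rw [Subsingleton.elim dec (instDecidableEqFin r)]
    simp only [append_update, AlternatingMap.map_update_smul]
  map_eq_zero_of_eq' y i j hy hij :=
    AlternatingMap.map_eq_zero_of_eq _ _ (i := Fin.natAdd p i) (j := Fin.natAdd p j)
      (by simpa only [Fin.append_right] using hy) (by simpa [Fin.ext_iff] using hij)

/-- The Hodge star operator on alternating maps with values in a vector space,
`(∗θ) (y₁, …, y_r) = 1 / p! ∑ vol (e_{i₁}, …, e_{i_p}, y₁, …, y_r) θ (e_{i₁}, …, e_{i_p})`,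
where `p + r = dim V` and `e` is an orthonormal basis of `V`. -/
def hodge {N : Type*} [AddCommGroup N] [Module ℝ N] {p r : ℕ} (h : p + r = finrank ℝ V) :
    (V [⋀^Fin p]→ₗ[ℝ] N) →ₗ[ℝ] (V [⋀^Fin r]→ₗ[ℝ] N) :=
  (p.factorial : ℝ)⁻¹ • ∑ i : Fin p → Fin (finrank ℝ V),
    { toFun := fun θ =>
        (LinearMap.toSpanSingleton ℝ N (θ (stdOrthonormalBasis ℝ V ∘ i))).compAlternatingMap
          (volContr h (stdOrthonormalBasis ℝ V ∘ i))
      map_add' := fun θ θ' => by ext y; simp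
      map_smul' := fun a θ => by
        ext y
        simp only [LinearMap.compAlternatingMap_apply,
          LinearMap.toSpanSingleton_apply, RingHom.id_apply]
        exact smul_comm _ _ _ }

/-- The Hodge star operator on double forms, `∗(θ₁ ⊗ θ₂) = ∗θ₁ ⊗ ∗θ₂`. It does not depend on the
orientation, which enters twice. -/
def star {p q r s : ℕ} (h : p + r = finrank ℝ V) (h' : q + s = finrank ℝ V)
    (α : DoubleForm V p q) : DoubleForm V r s :=
  (hodge (N := ℝ) h').compAlternatingMap (hodge h α)

/-- The sectional curvature `α (e₁, …, e_p; e₁, …, e_p)` of a double form `α` on a `p`-dimensional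
subspace `P`, with `e` any orthonormal basis of `P` (the value is `0` if `dim P ≠ p`). -/
def sectional {p : ℕ} (α : DoubleForm V p p) (P : Submodule ℝ V) : ℝ :=
  if h : finrank ℝ P = p then
    let e : Fin p → V := fun i => (stdOrthonormalBasis ℝ P (Fin.cast h.symm i) : V)
    α e e
  else 0

/-- The `p`-curvature of a `p`-dimensional subspace `P` with respect to a curvature tensor `R`: the
sectional curvature of `1 / (n - 2 - p)! ∗ (g ^ (n - 2 - p) R)` for `p ≤ n - 2`, where `n = dim V`,
with the convention that it is `0` for `p > n - 2`. -/
def pCurvature (R : DoubleForm V 2 2) (p : ℕ) (P : Submodule ℝ V) : ℝ :=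
  if h : p + 2 ≤ finrank ℝ V then
    sectional (((finrank ℝ V - 2 - p).factorial : ℝ)⁻¹ •
      star (r := p) (s := p) (by omega) (by omega)
        (((metric V).pow (finrank ℝ V - 2 - p)).mul R)) P
  else 0

end Euclidean

end DoubleForm

/-! ### The curvature tensor of a metric in coordinates -/

namespace CoordMetric

set_option maxSynthPendingDepth 3

variable {E : Type*} [NormedAddCommGroup E] [NormedSpace ℝ E]

/-- The Christoffel symbols of the first kind of a metric `G` on an open set of `E`:
`[u v, w] = (∂_u G (v, w) + ∂_v G (u, w) - ∂_w G (u, v)) / 2`. -/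
def christoffelFirst (G : E → E →L[ℝ] E →L[ℝ] ℝ) (y u v : E) : E →L[ℝ] ℝ :=
  (2⁻¹ : ℝ) • (fderiv ℝ G y u v + fderiv ℝ G y v u - ((fderiv ℝ G y).flip u).flip v)

/-- The Christoffel symbols of the second kind, `G (Γ (u, v), w) = [u v, w]`. -/
def christoffel (G : E → E →L[ℝ] E →L[ℝ] ℝ) (y u v : E) : E :=
  (G y).inverse (christoffelFirst G y u v)

/-- The Riemann curvature tensor of the metric `G`, with all indices lowered, in coordinates:
`R_{xyzw} = (∂_y ∂_z G_{xw} + ∂_x ∂_w G_{yz} - ∂_x ∂_z G_{yw} - ∂_y ∂_w G_{xz}) / 2`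
`  + G (Γ_{yz}, Γ_{xw}) - G (Γ_{xz}, Γ_{yw})`.
The sign is such that `R_{xyxy}` is the sectional curvature for orthonormal `x`, `y`. -/
def riemannFun (G : E → E →L[ℝ] E →L[ℝ] ℝ) (p x y z w : E) : ℝ :=
  (fderiv ℝ (fderiv ℝ G) p y z x w + fderiv ℝ (fderiv ℝ G) p x w y z
    - fderiv ℝ (fderiv ℝ G) p x z y w - fderiv ℝ (fderiv ℝ G) p y w x z) / 2
  + G p (christoffel G p y z) (christoffel G p x w)
  - G p (christoffel G p x z) (christoffel G p y w)

theorem christoffel_add_left (G : E → E →L[ℝ] E →L[ℝ] ℝ) (p u u' v : E) :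
    christoffel G p (u + u') v = christoffel G p u v + christoffel G p u' v := by
  unfold christoffel
  rw [← map_add]
  congr 1
  ext w
  simp [christoffelFirst]
  ring

theorem christoffel_smul_left (G : E → E →L[ℝ] E →L[ℝ] ℝ) (p : E) (a : ℝ) (u v : E) :
    christoffel G p (a • u) v = a • christoffel G p u v := by
  unfold christoffel
  rw [← map_smul]
  congr 1
  ext w
  simp [christoffelFirst]
  ring

theorem christoffel_add_right (G : E → E →L[ℝ] E →L[ℝ] ℝ) (p u v v' : E) :
    christoffel G p u (v + v') = christoffel G p u v + christoffel G p u v' := by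
  unfold christoffel
  rw [← map_add]
  congr 1
  ext w
  simp [christoffelFirst]
  ring

theorem christoffel_smul_right (G : E → E →L[ℝ] E →L[ℝ] ℝ) (p : E) (a : ℝ) (u v : E) :
    christoffel G p u (a • v) = a • christoffel G p u v := by
  unfold christoffel
  rw [← map_smul]
  congr 1
  ext w
  simp [christoffelFirst]
  ring

/-- The Riemann curvature tensor of the metric `G` at `p` as a double form of bidegree `(2, 2)`. -/
def riemann (G : E → E →L[ℝ] E →L[ℝ] ℝ) (hG : ∀ p u v, G p u v = G p v u) (p : E) :
    DoubleForm E 2 2 :=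
  DoubleForm.ofSkew (riemannFun G p)
    (fun x x' y z w => by
      simp only [riemannFun, map_add, christoffel_add_left, add_apply]; ring)
    (fun a x y z w => by
      simp only [riemannFun, map_smul, christoffel_smul_left, smul_apply, smul_eq_mul]; ring)
    (fun x y z w => by simp only [riemannFun]; ring)
    (fun x y z z' w => by
      simp only [riemannFun, map_add, christoffel_add_right, add_apply]; ring)
    (fun a x y z w => by
      simp only [riemannFun, map_smul, christoffel_smul_right, smul_apply, smul_eq_mul]; ring)
    (fun x y z w => by
      simp only [riemannFun]
      rw [hG p (christoffel G p x w), hG p (christoffel G p y w)]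
      ring)

end CoordMetric

/-! ### Riemannian manifolds -/

open Bundle

namespace Riem

/-- Tangent spaces of an `n`-dimensional manifold are finite-dimensional. -/
instance finiteDimensional_tangentSpace {n : ℕ} {M : Type*} [TopologicalSpace M]
    [ChartedSpace (EuclideanSpace ℝ (Fin n)) M] (m : M) :
    FiniteDimensional ℝ (TangentSpace (𝓡 n) m) :=
  inferInstanceAs (FiniteDimensional ℝ (EuclideanSpace ℝ (Fin n)))

section Metric

variable (n : ℕ) {M : Type*} [TopologicalSpace M] [ChartedSpace (EuclideanSpace ℝ (Fin n)) M]

/-- The coordinate expression of a field `h` of bilinear forms on the tangent spaces in the preferred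
chart `φ` at `m`: at the point `y` of the chart it is `(u, v) ↦ h (dφ⁻¹ u, dφ⁻¹ v)`. -/
def inChart (h : (x : M) → LinearMap.BilinForm ℝ (TangentSpace (𝓡 n) x)) (m : M)
    (y : EuclideanSpace ℝ (Fin n)) :
    EuclideanSpace ℝ (Fin n) →L[ℝ] EuclideanSpace ℝ (Fin n) →L[ℝ] ℝ :=
  let A : EuclideanSpace ℝ (Fin n) →L[ℝ] TangentSpace (𝓡 n) ((extChartAt (𝓡 n) m).symm y) :=
    mfderiv 𝓘(ℝ, EuclideanSpace ℝ (Fin n)) (𝓡 n) (extChartAt (𝓡 n) m).symm y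
  LinearMap.toContinuousBilinearMap
    ((h ((extChartAt (𝓡 n) m).symm y)).compl₁₂ A.toLinearMap A.toLinearMap)

/-- The Riemann curvature tensor at `m` of a metric `h` on `M`, computed in the preferred chart `φ` at
`m`. The tangent space at `m` is identified with the model space by the derivative of `φ` at `m`. -/
def riemannOf (h : (x : M) → LinearMap.BilinForm ℝ (TangentSpace (𝓡 n) x))
    (hsymm : ∀ x u v, h x u v = h x v u) (m : M) : DoubleForm (TangentSpace (𝓡 n) m) 2 2 :=
  CoordMetric.riemann (inChart n h m) (fun _ _ _ => hsymm _ _ _) (extChartAt (𝓡 n) m m)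

variable [RiemannianBundle (fun x : M => TangentSpace (𝓡 n) x)]

/-- The Riemann curvature tensor of `(M, g)` at `m`, as a double form. -/
def riemann (m : M) : DoubleForm (TangentSpace (𝓡 n) m) 2 2 :=
  riemannOf n (fun x => innerₗ (TangentSpace (𝓡 n) x)) (fun _ u v => real_inner_comm v u) m

/-- The Riemann curvature tensor at `m` of the conformal metric `exp (2 f) g`. -/
def riemannConf (f : M → ℝ) (m : M) : DoubleForm (TangentSpace (𝓡 n) m) 2 2 :=
  riemannOf n (fun x => Real.exp (2 * f x) • innerₗ (TangentSpace (𝓡 n) x))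
    (fun x u v => congrArg (Real.exp (2 * f x) * ·) (real_inner_comm v u)) m

/-- The Ricci tensor `c R` at `m`. -/
def ricci (m : M) : DoubleForm (TangentSpace (𝓡 n) m) 1 1 := (riemann n m).contract

/-- The scalar curvature `c² R` at `m`. -/
def scal (m : M) : ℝ := (ricci n m).contract ![] ![]

/-- The `p`-curvature `s_p (P)` of a `p`-dimensional subspace `P` of the tangent space at `m`. -/
def pCurv (p : ℕ) (m : M) (P : Submodule ℝ (TangentSpace (𝓡 n) m)) : ℝ :=
  (riemann n m).pCurvature p P

end Metric

section Predicates

variable (n : ℕ) (M : Type*) [TopologicalSpace M] [ChartedSpace (EuclideanSpace ℝ (Fin n)) M]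

/-- The function `F` is constant, equal to `c`, on the tangent `p`-planes of `M`. -/
def IsConstOnPlanes (p : ℕ) (F : (m : M) → Submodule ℝ (TangentSpace (𝓡 n) m) → ℝ) (c : ℝ) : Prop :=
  ∀ (m : M) (P : Submodule ℝ (TangentSpace (𝓡 n) m)), finrank ℝ P = p → F m P = c

variable [RiemannianBundle (fun x : M => TangentSpace (𝓡 n) x)]

/-- `(M, g)` has constant sectional curvature. -/
def HasConstantSectionalCurvature : Prop :=
  ∃ κ : ℝ, IsConstOnPlanes n M 2 (fun m P => (riemann n m).sectional P) κ

/-- `(M, g)` is an Einstein manifold: `Ric = κ g` for a constant `κ`. -/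
def IsEinstein : Prop :=
  ∃ κ : ℝ, ∀ m : M, ricci n m = κ • DoubleForm.metric (TangentSpace (𝓡 n) m)

/-- `(M, g)` is conformally flat: every point has an open neighbourhood `U` with a smooth function `f`
on `U` such that the metric `exp (2 f) g` is flat on `U`. -/
def IsConformallyFlat : Prop :=
  ∀ m : M, ∃ U : Set M, IsOpen U ∧ m ∈ U ∧ ∃ f : M → ℝ,
    ContMDiffOn (𝓡 n) 𝓘(ℝ, ℝ) ∞ f U ∧ ∀ x ∈ U, riemannConf n f x = 0

/-- `(M, g)` has constant scalar curvature. -/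
def HasConstantScalarCurvature : Prop :=
  ∃ c : ℝ, ∀ m : M, scal n m = c

end Predicates

end Riem
end

open Bundle

/-! The proof rests on one formula. Let `P` be spanned by the vectors `e_i`, `i ∈ T`, of an
orthonormal basis, and let `K_ij` be the sectional curvature of the plane of `e_i` and `e_j`. Then
`s_p(P)` is the sum of `K_ij` over the pairs outside `T`, and `s_{n-p}(P^⊥)` is the sum over the
pairs inside `T` (`pCurvature_coordPlane`). Every plane has this form for a suitable basis, so the
pointwise statements concern symmetric matrices `K` with zero diagonal.

Suppose that `x s_{n-p}(P^⊥) + y s_p(P)` is constant. Exchanging one index of `T` compares two rows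
of `K` (`SymmMatrix.row_differences`): if `x + y ≠ 0`, then `K_ik - K_jk` does not depend on `k`,
and it is zero unless `x (p - 1) = y (n - p - 1)`. For the weights of parts 1 and 3 the exception
does not occur, so all `K_ij` agree. Their common value is computed from the constant, hence is the
same at all points, and Schur's lemma is not needed.

In the difference of part 2 the entries joining `T` to its complement cancel, which leaves half the
scalar curvature minus the trace of Ricci on `P` (`difference_eq`). Constancy forces Ricci to be a
multiple of the metric at each point. The constant then fixes the scalar curvature if `n ≠ 2p`; if
`n = 2p` its coefficient vanishes, and Schur's lemma together with connectedness takes over.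

For the sum with `n = 2p` only the independence of `k` survives. It gives `K_ij = A_i + A_j` with
`A` the Schouten form, and since sectional curvatures determine a curvature tensor, `R` is the
Kulkarni-Nomizu product of `g` and `A`. What remains is the Weyl-Schouten theorem in dimension at
least four. In coordinates, the gradient `X` of the conformal factor has to solve `∇X = A + X ⊗ X -
|X|²/2`, indices being raised by `g`. This total differential system is solved by the Frobenius
theorem (`TotalDifferential.exists_solution`); its integrability condition is the vanishing of the
Cotton tensor, which follows from the second Bianchi identity (`cotton_eq_zero`). The converse is
the transformation law of curvature under a conformal change.

The curvature at a point is defined in the preferred chart of that very point, so its naturality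
under changes of coordinates (`riemannFun_change`) is needed to pass between pointwise algebra and
calculus in one fixed chart. -/

noncomputable section

namespace DoubleForm

/-! ### Products of double forms as signed sums over permutations -/

section Products

variable {V : Type*} [AddCommGroup V] [Module ℝ V]

theorem alternatingMap_sum_apply {N : Type*} [AddCommGroup N] [Module ℝ N] {ι κ : Type*}
    (S : Finset κ) (F : κ → V [⋀^ι]→ₗ[ℝ] N) (v : ι → V) : (∑ k ∈ S, F k) v = ∑ k ∈ S, F k v :=
  map_sum ({ toFun := fun G => G v, map_zero' := rfl, map_add' := fun _ _ => rfl } :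
    (V [⋀^ι]→ₗ[ℝ] N) →+ N) F S

/-- The factorials count the permutations in one shuffle class. Multiplying by them replaces a sum
over a quotient by a sum over all permutations. -/
theorem factorial_smul_wedge_apply {q s : ℕ} (a : V [⋀^Fin q]→ₗ[ℝ] ℝ) (b : V [⋀^Fin s]→ₗ[ℝ] ℝ)
    (y : Fin (q + s) → V) :
    ((q.factorial * s.factorial : ℕ) : ℝ) * wedge V q s (a ⊗ₜ b) y =
      ∑ τ : Equiv.Perm (Fin (q + s)), (Equiv.Perm.sign τ : ℝ) *
        (a (y ∘ τ ∘ Fin.castAdd s) * b (y ∘ τ ∘ Fin.natAdd q)) := by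
  have h := MultilinearMap.domCoprod_alternization_eq a b
  simp only [Fintype.card_fin] at h
  have h2 := congrArg (fun F : V [⋀^Fin q ⊕ Fin s]→ₗ[ℝ] (ℝ ⊗[ℝ] ℝ) =>
    LinearMap.mul' ℝ ℝ (F (y ∘ finSumFinEquiv))) h
  rw [AlternatingMap.smul_apply, map_nsmul, nsmul_eq_mul] at h2
  have h3 : wedge V q s (a ⊗ₜ b) y =
      LinearMap.mul' ℝ ℝ ((a.domCoprod b) (y ∘ finSumFinEquiv)) := rfl
  rw [h3, ← h2, MultilinearMap.alternatization_apply, map_sum]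
  refine Fintype.sum_equiv (Equiv.permCongr finSumFinEquiv) _ _ fun σ => ?_
  rw [Equiv.Perm.sign_permCongr, Units.smul_def, map_zsmul, zsmul_eq_mul]
  congr 1
  simp only [MultilinearMap.domDomCongr_apply, MultilinearMap.domCoprod_apply,
    LinearMap.mul'_apply]
  change a _ * b _ = _
  congr 2 <;> ext i <;> simp [Equiv.permCongr_apply]

theorem factorial_smul_mul_apply {p q r s : ℕ} (α : DoubleForm V p q) (β : DoubleForm V r s)
    (x : Fin (p + r) → V) (y : Fin (q + s) → V) :
    ((p.factorial * r.factorial : ℕ) : ℝ) * (((q.factorial * s.factorial : ℕ) : ℝ) *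
      α.mul β x y) =
      ∑ σ : Equiv.Perm (Fin (p + r)), ∑ τ : Equiv.Perm (Fin (q + s)),
        (Equiv.Perm.sign σ : ℝ) * ((Equiv.Perm.sign τ : ℝ) *
        (α (x ∘ σ ∘ Fin.castAdd r) (y ∘ τ ∘ Fin.castAdd s) *
          β (x ∘ σ ∘ Fin.natAdd p) (y ∘ τ ∘ Fin.natAdd q))) := by
  have h := MultilinearMap.domCoprod_alternization_eq α β
  simp only [Fintype.card_fin] at h
  have h2 := congrArg (fun F => wedge V q s (F (x ∘ finSumFinEquiv)) y) h
  simp only [AlternatingMap.smul_apply, map_nsmul, nsmul_eq_mul] at h2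
  have h3 : α.mul β x y = wedge V q s ((α.domCoprod β) (x ∘ finSumFinEquiv)) y := rfl
  rw [h3, mul_left_comm, ← h2, MultilinearMap.alternatization_apply, map_sum]
  rw [alternatingMap_sum_apply, Finset.mul_sum]
  refine Fintype.sum_equiv (Equiv.permCongr finSumFinEquiv) _ _ fun σ => ?_
  rw [Equiv.Perm.sign_permCongr, Units.smul_def, map_zsmul, AlternatingMap.smul_apply, zsmul_eq_mul,
    MultilinearMap.domDomCongr_apply, MultilinearMap.domCoprod_apply, mul_left_comm,
    ← Finset.mul_sum]
  congr 1
  erw [factorial_smul_wedge_apply]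
  refine Finset.sum_congr rfl fun τ _ => ?_
  congr 2
  · change α _ _ = α _ _
    congr 2; ext i; simp [Equiv.permCongr_apply]
  · change β _ _ = β _ _
    congr 2; ext i; simp [Equiv.permCongr_apply]

/-- Absorbing a permutation of the arguments in a signed sum over permutations. -/
theorem sum_sign_mul_right {m : ℕ} (F : Equiv.Perm (Fin m) → ℝ) (ρ : Equiv.Perm (Fin m)) :
    ∑ σ : Equiv.Perm (Fin m), (Equiv.Perm.sign σ : ℝ) * ((Equiv.Perm.sign ρ : ℝ) * F (σ * ρ)) =
      ∑ σ : Equiv.Perm (Fin m), (Equiv.Perm.sign σ : ℝ) * F σ := by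
  refine Fintype.sum_equiv (Equiv.mulRight ρ) _ _ fun σ => ?_
  simp [mul_assoc]

/-- The extension of a permutation of the first `k` indices to `k + r` indices. -/
def extendPerm {k : ℕ} (r : ℕ) (ρ : Equiv.Perm (Fin k)) : Equiv.Perm (Fin (k + r)) :=
  finSumFinEquiv.permCongr (Equiv.sumCongr ρ (Equiv.refl (Fin r)))

theorem extendPerm_castAdd {k r : ℕ} (ρ : Equiv.Perm (Fin k)) (i : Fin k) :
    extendPerm r ρ (Fin.castAdd r i) = Fin.castAdd r (ρ i) := by
  simp [extendPerm, Equiv.permCongr_apply]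

theorem extendPerm_natAdd {k r : ℕ} (ρ : Equiv.Perm (Fin k)) (i : Fin r) :
    extendPerm r ρ (Fin.natAdd k i) = Fin.natAdd k i := by
  simp [extendPerm, Equiv.permCongr_apply]

theorem sign_extendPerm {k r : ℕ} (ρ : Equiv.Perm (Fin k)) :
    Equiv.Perm.sign (extendPerm r ρ) = Equiv.Perm.sign ρ := by
  simp [extendPerm, Equiv.Perm.sign_permCongr]

/-- If `α` is the antisymmetrization of `a` in both sets of arguments, then the antisymmetrization
in the definition of a product with `α` may be carried out on `a`. -/
theorem factorial_mul_mul_apply {k r : ℕ} (α : DoubleForm V k k) (β : DoubleForm V r r)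
    (a : (Fin k → V) → (Fin k → V) → ℝ)
    (h : ∀ x y, α x y = ∑ σ : Equiv.Perm (Fin k), ∑ τ : Equiv.Perm (Fin k),
      (Equiv.Perm.sign σ : ℝ) * ((Equiv.Perm.sign τ : ℝ) * a (x ∘ σ) (y ∘ τ)))
    (x y : Fin (k + r) → V) :
    ((r.factorial : ℝ) * r.factorial) * α.mul β x y =
      ∑ σ : Equiv.Perm (Fin (k + r)), ∑ τ : Equiv.Perm (Fin (k + r)),
        (Equiv.Perm.sign σ : ℝ) * ((Equiv.Perm.sign τ : ℝ) *
        (a (x ∘ σ ∘ Fin.castAdd r) (y ∘ τ ∘ Fin.castAdd r) *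
          β (x ∘ σ ∘ Fin.natAdd k) (y ∘ τ ∘ Fin.natAdd k))) := by
  have hk : (k.factorial : ℝ) ≠ 0 := by exact_mod_cast k.factorial_ne_zero
  refine mul_left_cancel₀ (mul_ne_zero hk hk) ?_
  have key := factorial_smul_mul_apply α β x y
  push_cast at key
  rw [show ((k.factorial : ℝ) * k.factorial) * ((r.factorial : ℝ) * r.factorial * α.mul β x y) =
    k.factorial * r.factorial * (k.factorial * r.factorial * α.mul β x y) by ring, key]
  set A : Equiv.Perm (Fin (k + r)) → Equiv.Perm (Fin (k + r)) → ℝ := fun σ τ =>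
    a (x ∘ σ ∘ Fin.castAdd r) (y ∘ τ ∘ Fin.castAdd r) *
          β (x ∘ σ ∘ Fin.natAdd k) (y ∘ τ ∘ Fin.natAdd k) with hA
  -- Expanding `α` gives `k! * k!` terms. Each inner pair of permutations extends by the identity on
  -- the last `r` indices, so it can be absorbed into `σ` and `τ` without moving the arguments of
  -- `β`.
  have e1 : ∀ σ τ : Equiv.Perm (Fin (k + r)),
      α (x ∘ σ ∘ Fin.castAdd r) (y ∘ τ ∘ Fin.castAdd r) *
          β (x ∘ σ ∘ Fin.natAdd k) (y ∘ τ ∘ Fin.natAdd k) =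
      ∑ ρ : Equiv.Perm (Fin k), ∑ υ : Equiv.Perm (Fin k),
      (Equiv.Perm.sign (extendPerm r ρ) : ℝ) * ((Equiv.Perm.sign (extendPerm r υ) : ℝ) *
        A (σ * extendPerm r ρ) (τ * extendPerm r υ)) := by
    intro σ τ
    rw [h, Finset.sum_mul]
    refine Finset.sum_congr rfl fun ρ _ => ?_
    rw [Finset.sum_mul]
    refine Finset.sum_congr rfl fun υ _ => ?_
    simp only [hA, sign_extendPerm, mul_assoc]
    have c1 : ∀ (z : Fin (k + r) → V) (σ : Equiv.Perm (Fin (k + r))) (ρ : Equiv.Perm (Fin k)),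
        z ∘ ⇑(σ * extendPerm r ρ) ∘ Fin.castAdd r = (z ∘ σ ∘ Fin.castAdd r) ∘ ρ := by
      intro z σ ρ; ext i; simp [extendPerm_castAdd]
    have c2 : ∀ (z : Fin (k + r) → V) (σ : Equiv.Perm (Fin (k + r))) (ρ : Equiv.Perm (Fin k)),
        z ∘ ⇑(σ * extendPerm r ρ) ∘ Fin.natAdd k = z ∘ σ ∘ Fin.natAdd k := by
      intro z σ ρ; ext i; simp [extendPerm_natAdd]
    rw [c1, c1, c2, c2]
  have e2 : ∀ ρ υ : Equiv.Perm (Fin k),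
      ∑ σ : Equiv.Perm (Fin (k + r)), ∑ τ : Equiv.Perm (Fin (k + r)),
        (Equiv.Perm.sign σ : ℝ) * ((Equiv.Perm.sign τ : ℝ) *
        ((Equiv.Perm.sign (extendPerm r ρ) : ℝ) * ((Equiv.Perm.sign (extendPerm r υ) : ℝ) *
        A (σ * extendPerm r ρ) (τ * extendPerm r υ)))) =
      ∑ σ : Equiv.Perm (Fin (k + r)), ∑ τ : Equiv.Perm (Fin (k + r)),
        (Equiv.Perm.sign σ : ℝ) * ((Equiv.Perm.sign τ : ℝ) * A σ τ) := by
    intro ρ υ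
    have : ∀ σ, ∑ τ : Equiv.Perm (Fin (k + r)),
        (Equiv.Perm.sign σ : ℝ) * ((Equiv.Perm.sign τ : ℝ) *
        ((Equiv.Perm.sign (extendPerm r ρ) : ℝ) * ((Equiv.Perm.sign (extendPerm r υ) : ℝ) *
        A (σ * extendPerm r ρ) (τ * extendPerm r υ)))) =
        (Equiv.Perm.sign σ : ℝ) * ((Equiv.Perm.sign (extendPerm r ρ) : ℝ) *
          ∑ τ : Equiv.Perm (Fin (k + r)), (Equiv.Perm.sign τ : ℝ) *
            A (σ * extendPerm r ρ) τ) := by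
      intro σ
      rw [← sum_sign_mul_right (fun τ => A (σ * extendPerm r ρ) τ) (extendPerm r υ),
        Finset.mul_sum, Finset.mul_sum]
      refine Finset.sum_congr rfl fun τ _ => by ring
    simp_rw [this]
    rw [sum_sign_mul_right (fun σ => ∑ τ : Equiv.Perm (Fin (k + r)), (Equiv.Perm.sign τ : ℝ) *
            A σ τ) (extendPerm r ρ)]
    simp_rw [Finset.mul_sum]
  simp_rw [e1, Finset.mul_sum]
  have e3 : ∀ G : Equiv.Perm (Fin (k + r)) → Equiv.Perm (Fin (k + r)) → Equiv.Perm (Fin k) →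
      Equiv.Perm (Fin k) → ℝ, ∑ σ, ∑ τ, ∑ ρ, ∑ υ, G σ τ ρ υ = ∑ ρ, ∑ υ, ∑ σ, ∑ τ, G σ τ ρ υ := by
    intro G
    calc ∑ σ, ∑ τ, ∑ ρ, ∑ υ, G σ τ ρ υ = ∑ σ, ∑ ρ, ∑ τ, ∑ υ, G σ τ ρ υ :=
          Finset.sum_congr rfl fun σ _ => Finset.sum_comm
      _ = ∑ ρ, ∑ σ, ∑ τ, ∑ υ, G σ τ ρ υ := Finset.sum_comm
      _ = ∑ ρ, ∑ σ, ∑ υ, ∑ τ, G σ τ ρ υ :=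
          Finset.sum_congr rfl fun ρ _ => Finset.sum_congr rfl fun σ _ => Finset.sum_comm
      _ = ∑ ρ, ∑ υ, ∑ σ, ∑ τ, G σ τ ρ υ :=
          Finset.sum_congr rfl fun ρ _ => Finset.sum_comm
  rw [e3]
  simp_rw [e2]
  simp [Fintype.card_perm, Finset.mul_sum, mul_assoc, hA]

end Products

/-! ### Powers of the metric and the values of `g ^ k R` -/

section PowersOfMetric

variable {V : Type*} [NormedAddCommGroup V] [InnerProductSpace ℝ V]

theorem metric_apply (x y : Fin 1 → V) : metric V x y = inner ℝ (x 0) (y 0) := rfl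

/-- The induction goes through `factorial_mul_mul_apply` with `r = 1`, where the factor `r! * r!` is
`1`; hence no factorials accumulate. -/
theorem pow_metric_apply (k : ℕ) (x y : Fin k → V) :
    (metric V).pow k x y = ∑ σ : Equiv.Perm (Fin k), ∑ τ : Equiv.Perm (Fin k),
      (Equiv.Perm.sign σ : ℝ) * ((Equiv.Perm.sign τ : ℝ) *
        ∏ i, inner ℝ ((x ∘ σ) i) ((y ∘ τ) i)) := by
  induction k with
  | zero => simp [pow]
  | succ k ih =>
    have := factorial_mul_mul_apply ((metric V).pow k) (metric V)
      (fun x y => ∏ i, inner ℝ (x i) (y i)) ih x y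
    simp only [Nat.factorial_one, Nat.cast_one, one_mul] at this
    rw [pow]
    refine this.trans ?_
    simp only [Fin.prod_univ_castSucc, metric_apply]
    rfl

theorem perm_fixing_castAdd {k : ℕ} (ρ : Equiv.Perm (Fin (k + 2)))
    (h : ∀ i : Fin k, ρ (Fin.castAdd 2 i) = Fin.castAdd 2 i) :
    ρ = 1 ∨ ρ = Equiv.swap (Fin.natAdd k 0) (Fin.natAdd k 1) := by
  have hr : ∀ j : Fin 2, ρ (Fin.natAdd k j) = Fin.natAdd k 0 ∨ ρ (Fin.natAdd k j) = Fin.natAdd k 1 := by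
    intro j
    obtain ⟨l, hl⟩ : ∃ l, ρ (Fin.natAdd k j) = l := ⟨_, rfl⟩
    rw [hl]
    revert hl
    refine Fin.addCases (fun i hi => ?_) (fun i _ => ?_) l
    · have h1 := ρ.injective (hi.trans (h i).symm)
      have := congrArg Fin.val h1
      simp at this; omega
    · fin_cases i <;> simp
  have hne : ρ (Fin.natAdd k 0) ≠ ρ (Fin.natAdd k 1) := fun h => by
    simpa using ρ.injective h
  have h01 : (Fin.natAdd k 0 : Fin (k + 2)) ≠ Fin.natAdd k 1 := by simp
  rcases hr 0 with h0 | h0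
  · left
    rcases hr 1 with h1 | h1
    · exact absurd (h0.trans h1.symm) hne
    · ext l
      refine congrArg Fin.val (?_ : ρ l = l)
      refine Fin.addCases (fun i => h i) (fun i => ?_) l
      fin_cases i
      · exact h0
      · exact h1
  · right
    rcases hr 1 with h1 | h1
    · ext l
      refine congrArg Fin.val (?_ : ρ l = _)
      refine Fin.addCases (fun i => ?_) (fun i => ?_) l
      · rw [h i, Equiv.swap_apply_of_ne_of_ne]
        · intro h; have := congrArg Fin.val h; simp at this; omega
        · intro h; have := congrArg Fin.val h; simp at this; omega
      · fin_cases i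
        · simpa using h0
        · simpa using h1
    · exact absurd (h0.trans h1.symm) hne

/-- The sum over `σ` is the same for every ordered pair of distinct indices, because some
permutation carries one pair to another. Averaging over all `N (N - 1)` pairs gives the formula. -/
theorem sum_perm_apply_two {N : ℕ} (F : Fin N → Fin N → ℝ) (a b : Fin N) (hab : a ≠ b) :
    ((N : ℝ) * (N - 1)) * ∑ σ : Equiv.Perm (Fin N), F (σ a) (σ b) =
      N.factorial * ∑ i, ∑ j, if i = j then 0 else F i j := by
  have h1 : ∀ c d : Fin N, c ≠ d → ∑ σ : Equiv.Perm (Fin N), F (σ c) (σ d) =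
      ∑ σ : Equiv.Perm (Fin N), F (σ a) (σ b) := by
    intro c d hcd
    obtain ⟨ρ, hρ1, hρ2⟩ : ∃ ρ : Equiv.Perm (Fin N), ρ a = c ∧ ρ b = d := by
      refine ⟨Equiv.swap (Equiv.swap a c b) d * Equiv.swap a c, ?_, ?_⟩
      · rw [Equiv.Perm.mul_apply, Equiv.swap_apply_left, Equiv.swap_apply_of_ne_of_ne _ hcd]
        intro h
        have := congrArg (Equiv.swap a c) h
        simp at this; exact hab this
      · simp
    exact Fintype.sum_equiv (Equiv.mulRight ρ) _ _ fun σ => by simp [hρ1, hρ2]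
  have h2 : ∀ σ : Equiv.Perm (Fin N), (∑ c, ∑ d, if c = d then 0 else F (σ c) (σ d)) =
      ∑ i, ∑ j, if i = j then 0 else F i j := by
    intro σ
    refine Fintype.sum_equiv σ _ _ fun c => Fintype.sum_equiv σ _ _ fun d => by simp
  have h3 : (∑ c : Fin N, ∑ d : Fin N, if c = d then 0 else
      ∑ σ : Equiv.Perm (Fin N), F (σ c) (σ d)) =
      N.factorial * ∑ i, ∑ j, if i = j then 0 else F i j := by
    calc _ = ∑ σ : Equiv.Perm (Fin N), ∑ c, ∑ d, if c = d then 0 else F (σ c) (σ d) := by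
          rw [Finset.sum_comm]
          rw [Finset.sum_comm]
          simp_rw [Finset.sum_comm (s := (Finset.univ : Finset (Equiv.Perm (Fin N))))]
          refine Finset.sum_congr rfl fun c _ => Finset.sum_congr rfl fun d _ => ?_
          split_ifs <;> simp
      _ = _ := by simp_rw [h2]; simp [Fintype.card_perm]
  rw [← h3]
  have h4 : ∀ c d : Fin N, (if c = d then 0 else ∑ σ : Equiv.Perm (Fin N), F (σ c) (σ d)) =
      (∑ σ : Equiv.Perm (Fin N), F (σ a) (σ b)) -
        if c = d then ∑ σ : Equiv.Perm (Fin N), F (σ a) (σ b) else 0 := by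
    intro c d
    split_ifs with h
    · simp
    · rw [h1 c d h, sub_zero]
  simp_rw [h4]
  simp [Finset.sum_sub_distrib]
  ring

theorem skew_left (R : DoubleForm V 2 2) (x y : V) (w : Fin 2 → V) :
    R ![x, y] w = -R ![y, x] w := by
  have h := R.map_swap ![y, x] (i := 0) (j := 1) (by decide)
  rw [show (![y, x] ∘ Equiv.swap (0 : Fin 2) 1 : Fin 2 → V) = ![x, y] by
    ext i; fin_cases i <;> rfl] at h
  rw [h]; rfl

theorem skew_right (R : DoubleForm V 2 2) (w : Fin 2 → V) (x y : V) :
    R w ![x, y] = -R w ![y, x] := by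
  have h := (R w).map_swap ![y, x] (i := 0) (j := 1) (by decide)
  rwa [show (![y, x] ∘ Equiv.swap (0 : Fin 2) 1 : Fin 2 → V) = ![x, y] by
    ext i; fin_cases i <;> rfl] at h

/-- Once `σ` is chosen, orthonormality leaves two choices of `τ`, equal to `σ` up to swapping the
last two indices, and both contribute alike because `R` is skew. The half reflects that the double
sum counts each 2-plane twice. -/
theorem pow_metric_mul_apply_orthonormal (R : DoubleForm V 2 2) (k : ℕ) (f : Fin (k + 2) → V)
    (hf : Orthonormal ℝ f) :
    (((metric V).pow k).mul R) f f =
      k.factorial / 2 * ∑ i, ∑ j, R ![f i, f j] ![f i, f j] := by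
  have key := factorial_mul_mul_apply ((metric V).pow k) R
    (fun x y => ∏ i, inner ℝ (x i) (y i)) (pow_metric_apply k) f f
  set a : Fin (k + 2) := Fin.natAdd k 0
  set b : Fin (k + 2) := Fin.natAdd k 1
  have hab : a ≠ b := by simp [a, b]
  have hnat : ∀ σ : Equiv.Perm (Fin (k + 2)), f ∘ σ ∘ Fin.natAdd k = ![f (σ a), f (σ b)] := by
    intro σ; ext i; fin_cases i <;> rfl
  have e1 : ∀ σ : Equiv.Perm (Fin (k + 2)), ∑ τ : Equiv.Perm (Fin (k + 2)),
      (Equiv.Perm.sign σ : ℝ) * ((Equiv.Perm.sign τ : ℝ) *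
        ((∏ i, inner ℝ ((f ∘ σ ∘ Fin.castAdd 2) i) ((f ∘ τ ∘ Fin.castAdd 2) i)) *
          R (f ∘ σ ∘ Fin.natAdd k) (f ∘ τ ∘ Fin.natAdd k))) =
      2 * R ![f (σ a), f (σ b)] ![f (σ a), f (σ b)] := by
    intro σ
    rw [← Equiv.sum_comp (Equiv.mulLeft σ)]
    -- With `τ = σ ρ`, a nonzero product of inner products forces `ρ` to fix the first `k` indices.
    have hz : ∀ ρ : Equiv.Perm (Fin (k + 2)), ρ ∉ ({1, Equiv.swap a b} : Finset _) →
        (Equiv.Perm.sign σ : ℝ) * ((Equiv.Perm.sign (Equiv.mulLeft σ ρ) : ℝ) *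
        ((∏ i, inner ℝ ((f ∘ σ ∘ Fin.castAdd 2) i) ((f ∘ (Equiv.mulLeft σ ρ) ∘ Fin.castAdd 2) i)) *
          R (f ∘ σ ∘ Fin.natAdd k) (f ∘ (Equiv.mulLeft σ ρ) ∘ Fin.natAdd k))) = 0 := by
      intro ρ hρ
      obtain ⟨i, hi⟩ : ∃ i : Fin k, ρ (Fin.castAdd 2 i) ≠ Fin.castAdd 2 i := by
        by_contra! hcon
        rcases perm_fixing_castAdd ρ hcon with h | h <;> simp [h, a, b] at hρ
      rw [Finset.prod_eq_zero (Finset.mem_univ i)]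
      · simp
      · refine hf.2 ?_
        simpa using hi.symm
    rw [← Finset.sum_subset (Finset.subset_univ {1, Equiv.swap a b}) fun ρ _ hρ => hz ρ hρ]
    have h1s : (1 : Equiv.Perm (Fin (k + 2))) ≠ Equiv.swap a b := by
      intro h
      exact hab (by simpa using congrArg (fun p => p a) h)
    have hfix : ∀ i : Fin k, Equiv.swap a b (Fin.castAdd 2 i) = Fin.castAdd 2 i := by
      intro i
      refine Equiv.swap_apply_of_ne_of_ne ?_ ?_ <;>
      · intro h; have := congrArg Fin.val h; simp [a, b] at this; omega
    have hone : ∀ i, inner ℝ (f i) (f i) = (1 : ℝ) := fun i => by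
      rw [real_inner_self_eq_norm_sq, hf.1 i]; norm_num
    have hs : (Equiv.Perm.sign σ : ℝ) * (Equiv.Perm.sign σ : ℝ) = 1 := by
      rcases Int.units_eq_one_or (Equiv.Perm.sign σ) with h | h <;> simp [h]
    rw [Finset.sum_pair h1s]
    simp only [hnat, Equiv.coe_mulLeft, mul_one, Equiv.Perm.mul_apply, Equiv.swap_apply_left,
      Equiv.swap_apply_right, Function.comp_apply, hfix, hone, Finset.prod_const_one,
      Equiv.Perm.sign_mul, Equiv.Perm.sign_swap hab]
    rw [skew_right R _ (f (σ b))]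
    push_cast
    linear_combination (2 * R ![f (σ a), f (σ b)] ![f (σ a), f (σ b)]) * hs
  simp_rw [e1, ← Finset.mul_sum] at key
  have e2 := sum_perm_apply_two (fun i j => R ![f i, f j] ![f i, f j]) a b hab
  have e3 : ∀ i j : Fin (k + 2), (if i = j then 0 else R ![f i, f j] ![f i, f j]) =
      R ![f i, f j] ![f i, f j] := by
    intro i j
    split_ifs with h
    · subst h
      have := skew_right R ![f i, f i] (f i) (f i)
      linarith
    · rfl
  simp_rw [e3] at e2
  have hfac : ((k + 2).factorial : ℝ) = (k + 2) * (k + 1) * k.factorial := by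
    rw [Nat.factorial_succ, Nat.factorial_succ]; push_cast; ring
  rw [hfac] at e2
  push_cast at e2
  have hpos : ((k : ℝ) + 2) * (k + 1) ≠ 0 := by positivity
  have e4 : ∑ σ : Equiv.Perm (Fin (k + 2)), R ![f (σ a), f (σ b)] ![f (σ a), f (σ b)] =
      k.factorial * ∑ i, ∑ j, R ![f i, f j] ![f i, f j] := by
    refine mul_left_cancel₀ hpos ?_
    linear_combination e2
  rw [e4] at key
  norm_num at key
  linarith

end PowersOfMetric

end DoubleForm

/-! ### The Hodge star on orthonormal bases -/

namespace DoubleForm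

theorem append_update_left {V : Type*} {p r : ℕ} (v : Fin p → V) (y : Fin r → V) (i : Fin p) (a : V) :
    Fin.append (Function.update v i a) y =
      Function.update (Fin.append v y) (Fin.castAdd r i) a := by
  ext k
  refine Fin.addCases (fun k => ?_) (fun k => ?_) k
  · rw [Fin.append_left]
    by_cases hk : k = i
    · subst hk; simp
    · rw [Function.update_of_ne hk, Function.update_of_ne, Fin.append_left]
      simpa [Fin.ext_iff] using hk
  · rw [Fin.append_right, Function.update_of_ne, Fin.append_right]
    simp [Fin.ext_iff]; omega

section HodgeStar

variable {V : Type*} [NormedAddCommGroup V] [InnerProductSpace ℝ V]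

/-- The contraction of two multilinear maps over an orthonormal basis does not depend on the
basis. -/
theorem sum_smul_orthonormalBasis_eq {N : Type*} [AddCommGroup N] [Module ℝ N] {p : ℕ}
    {ι κ : Type*} [Fintype ι] [Fintype κ] (B : OrthonormalBasis ι ℝ V) (b : OrthonormalBasis κ ℝ V)
    (F : MultilinearMap ℝ (fun _ : Fin p => V) ℝ) (θ : MultilinearMap ℝ (fun _ : Fin p => V) N) :
    ∑ i : Fin p → ι, F (B ∘ i) • θ (B ∘ i) = ∑ a : Fin p → κ, F (b ∘ a) • θ (b ∘ a) := by
  classical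
  have h1 : ∀ i : Fin p → ι, θ (B ∘ i) =
      ∑ a : Fin p → κ, (∏ l, inner ℝ (b (a l)) (B (i l))) • θ (b ∘ a) := by
    intro i
    have : (B ∘ i) = fun l => ∑ c, inner ℝ (b c) (B (i l)) • b c := by
      ext l; exact (b.sum_repr' (B (i l))).symm
    rw [this, MultilinearMap.map_sum]
    exact Finset.sum_congr rfl fun a _ => θ.map_smul_univ _ _
  have h2 : ∀ a : Fin p → κ, F (b ∘ a) =
      ∑ i : Fin p → ι, (∏ l, inner ℝ (b (a l)) (B (i l))) • F (B ∘ i) := by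
    intro a
    have : (b ∘ a) = fun l => ∑ c, inner ℝ (b (a l)) (B c) • B c := by
      ext l
      refine (B.sum_repr' (b (a l))).symm.trans ?_
      exact Finset.sum_congr rfl fun c _ => by rw [real_inner_comm]
    rw [this, MultilinearMap.map_sum]
    exact Finset.sum_congr rfl fun a _ => F.map_smul_univ _ _
  simp_rw [h1, h2, Finset.smul_sum, Finset.sum_smul]
  rw [Finset.sum_comm]
  refine Finset.sum_congr rfl fun a _ => Finset.sum_congr rfl fun i _ => ?_
  rw [smul_smul, smul_eq_mul, mul_comm]

variable [FiniteDimensional ℝ V]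

/-- The form `volContr` as a function of its parameters. -/
def volContrLeft {p r : ℕ} (h : p + r = finrank ℝ V) (y : Fin r → V) : V [⋀^Fin p]→ₗ[ℝ] ℝ where
  toFun v := volContr h v y
  map_update_add' v i a b := by
    rename_i dec
    rw [Subsingleton.elim dec (instDecidableEqFin p)]
    simp only [volContr, AlternatingMap.coe_mk, MultilinearMap.coe_mk, append_update_left,
      AlternatingMap.map_update_add]
  map_update_smul' v i a b := by
    rename_i dec
    rw [Subsingleton.elim dec (instDecidableEqFin p)]
    simp only [volContr, AlternatingMap.coe_mk, MultilinearMap.coe_mk, append_update_left,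
      AlternatingMap.map_update_smul]
  map_eq_zero_of_eq' v i j hv hij :=
    AlternatingMap.map_eq_zero_of_eq
      ((stdOrthonormalBasis ℝ V).toBasis.det.domDomCongr (finCongr h.symm)) _
      (i := Fin.castAdd r i) (j := Fin.castAdd r j)
      (by simpa only [Fin.append_left] using hv) (by simpa [Fin.ext_iff] using hij)

theorem hodge_apply {N : Type*} [AddCommGroup N] [Module ℝ N] {p r : ℕ}
    (h : p + r = finrank ℝ V) (θ : V [⋀^Fin p]→ₗ[ℝ] N) (e : Fin r → V) :
    hodge h θ e = (p.factorial : ℝ)⁻¹ • ∑ i : Fin p → Fin (finrank ℝ V),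
      volContrLeft h e (stdOrthonormalBasis ℝ V ∘ i) • θ (stdOrthonormalBasis ℝ V ∘ i) := by
  simp only [hodge, LinearMap.smul_apply, LinearMap.sum_apply, AlternatingMap.smul_apply,
    alternatingMap_sum_apply]
  rfl

/-- After passing to the basis `b`, a multi-index with a repetition is killed by `θ`, and one that
meets the second block is killed by the volume form. The other `p!` are permutations of the first
block; their signs occur twice, so they give equal terms and cancel the factor `1 / p!`. -/
theorem hodge_apply_orthonormal {N : Type*} [AddCommGroup N] [Module ℝ N] {p r : ℕ}
    (h : p + r = finrank ℝ V) (θ : V [⋀^Fin p]→ₗ[ℝ] N)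
    (b : OrthonormalBasis (Fin p ⊕ Fin r) ℝ V) :
    hodge h θ (b ∘ Sum.inr) = volContrLeft h (b ∘ Sum.inr) (b ∘ Sum.inl) • θ (b ∘ Sum.inl) := by
  classical
  rw [hodge_apply]
  have key := sum_smul_orthonormalBasis_eq (stdOrthonormalBasis ℝ V) b
    (volContrLeft h (b ∘ Sum.inr)).toMultilinearMap θ.toMultilinearMap
  simp only [AlternatingMap.coe_multilinearMap] at key
  rw [key]
  let J : Equiv.Perm (Fin p) ↪ (Fin p → Fin p ⊕ Fin r) :=
    ⟨fun σ => Sum.inl ∘ σ, fun σ τ hst => by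
      ext i
      have := congrFun hst i
      exact congrArg Fin.val (Sum.inl_injective this)⟩
  rw [← Finset.sum_subset (Finset.subset_univ (Finset.univ.map J))]
  · rw [Finset.sum_map]
    have : ∀ σ : Equiv.Perm (Fin p), volContrLeft h (b ∘ Sum.inr) (b ∘ J σ) • θ (b ∘ J σ) =
        volContrLeft h (b ∘ Sum.inr) (b ∘ Sum.inl) • θ (b ∘ Sum.inl) := by
      intro σ
      change volContrLeft h (b ∘ Sum.inr) ((b ∘ Sum.inl) ∘ σ) • θ ((b ∘ Sum.inl) ∘ σ) = _
      rw [AlternatingMap.map_perm, AlternatingMap.map_perm]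
      rcases Int.units_eq_one_or (Equiv.Perm.sign σ) with hs | hs <;> simp [hs]
    simp_rw [this]
    rw [Finset.sum_const, Finset.card_univ, Fintype.card_perm, Fintype.card_fin,
      ← Nat.cast_smul_eq_nsmul ℝ, smul_smul, inv_mul_cancel₀, one_smul]
    exact_mod_cast p.factorial_ne_zero
  · intro a _ ha
    by_cases hinj : Function.Injective a
    · have : ∃ l j, a l = Sum.inr j := by
        by_contra! hcon
        have hl : ∀ l, ∃ c, a l = Sum.inl c := by
          intro l
          rcases hal : a l with c | j
          · exact ⟨c, rfl⟩
          · exact absurd hal (hcon l j)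
        choose c hc using hl
        have hci : Function.Injective c := fun x y hxy => hinj (by rw [hc, hc, hxy])
        refine ha (Finset.mem_map.2 ⟨Equiv.ofBijective c (Finite.injective_iff_bijective.1 hci),
          Finset.mem_univ _, ?_⟩)
        ext l
        exact (hc l).symm
      obtain ⟨l, j, hlj⟩ := this
      have : volContrLeft h (b ∘ Sum.inr) (b ∘ a) = 0 := by
        refine AlternatingMap.map_eq_zero_of_eq
          ((stdOrthonormalBasis ℝ V).toBasis.det.domDomCongr (finCongr h.symm)) _ (i := Fin.castAdd r l) (j := Fin.natAdd p j)
          ?_ ?_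
        · simp [hlj]
        · intro hh; have := congrArg Fin.val hh; simp at this; omega
      rw [this, zero_smul]
    · have : θ (b ∘ a) = 0 := by
        simp only [Function.Injective, not_forall] at hinj
        obtain ⟨x, y, hxy, hne⟩ := hinj
        exact θ.map_eq_zero_of_eq _ (congrArg b hxy) hne
      rw [this, smul_zero]

theorem volContrLeft_orthonormal_mul_self {p r : ℕ} (h : p + r = finrank ℝ V)
    (b : OrthonormalBasis (Fin p ⊕ Fin r) ℝ V) :
    volContrLeft h (b ∘ Sum.inr) (b ∘ Sum.inl) * volContrLeft h (b ∘ Sum.inr) (b ∘ Sum.inl) = 1 := by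
  have e := OrthonormalBasis.det_to_matrix_orthonormalBasis_real (stdOrthonormalBasis ℝ V)
    (b.reindex (finSumFinEquiv.trans (finCongr h)))
  have e2 : volContrLeft h (b ∘ Sum.inr) (b ∘ Sum.inl) = (stdOrthonormalBasis ℝ V).toBasis.det
      (b.reindex (finSumFinEquiv.trans (finCongr h))) := by
    change (stdOrthonormalBasis ℝ V).toBasis.det _ = _
    congr 1
    ext i
    obtain ⟨i, rfl⟩ := (finCongr h).surjective i
    have : (finCongr h.symm) ((finCongr h) i) = i := rfl
    refine Fin.addCases (fun k => ?_) (fun k => ?_) i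
    · simp
    · simp
  rw [e2]
  rcases e with e | e
  · erw [e]; norm_num
  · erw [e]; norm_num

/-- The volume of an orthonormal basis is `±1` and enters once for each set of arguments, so the
orientation drops out: the star moves a value from a plane to its orthogonal complement. -/
theorem star_apply_orthonormal {p r : ℕ} (h h' : p + r = finrank ℝ V) (α : DoubleForm V p p)
    (b : OrthonormalBasis (Fin p ⊕ Fin r) ℝ V) :
    star h h' α (b ∘ Sum.inr) (b ∘ Sum.inr) = α (b ∘ Sum.inl) (b ∘ Sum.inl) := by
  change hodge h' (hodge h α (b ∘ Sum.inr)) (b ∘ Sum.inr) = _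
  rw [hodge_apply_orthonormal, hodge_apply_orthonormal, AlternatingMap.smul_apply,
    smul_smul, volContrLeft_orthonormal_mul_self, one_smul]

end HodgeStar

end DoubleForm

/-! ### Coordinate planes and the `p`-curvature as a sum of sectional curvatures -/

namespace DoubleForm

section Planes

variable {V : Type*} [NormedAddCommGroup V] [InnerProductSpace ℝ V] {ι : Type*} [Fintype ι]

/-- The plane spanned by some of the vectors of an orthonormal basis. -/
def coordPlane (b : OrthonormalBasis ι ℝ V) (T : Finset ι) : Submodule ℝ V :=
  Submodule.span ℝ (Set.range fun i : T => b i)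

/-- The sectional curvatures of the coordinate 2-planes of an orthonormal basis. -/
def secMatrix (R : DoubleForm V 2 2) (b : OrthonormalBasis ι ℝ V) (i j : ι) : ℝ :=
  R ![b i, b j] ![b i, b j]

theorem secMatrix_self (R : DoubleForm V 2 2) (b : OrthonormalBasis ι ℝ V) (i : ι) :
    secMatrix R b i i = 0 := by
  have := skew_right R ![b i, b i] (b i) (b i)
  unfold secMatrix
  linarith

theorem secMatrix_symm (R : DoubleForm V 2 2) (b : OrthonormalBasis ι ℝ V) (i j : ι) :
    secMatrix R b i j = secMatrix R b j i := by
  unfold secMatrix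
  rw [skew_left, skew_right, neg_neg]

theorem orthonormal_subtype (b : OrthonormalBasis ι ℝ V) (T : Finset ι) :
    Orthonormal ℝ (fun i : T => b i) :=
  b.orthonormal.comp _ Subtype.val_injective

theorem finrank_coordPlane (b : OrthonormalBasis ι ℝ V) (T : Finset ι) :
    finrank ℝ (coordPlane b T) = T.card := by
  rw [coordPlane, finrank_span_eq_card (orthonormal_subtype b T).linearIndependent]
  simp

variable [DecidableEq ι] [FiniteDimensional ℝ V]

theorem orthogonal_coordPlane (b : OrthonormalBasis ι ℝ V) (T : Finset ι) :
    (coordPlane b T)ᗮ = coordPlane b Tᶜ := by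
  refine (Submodule.eq_of_le_of_finrank_eq ?_ ?_).symm
  · refine Submodule.span_le.2 ?_
    rintro _ ⟨⟨i, hi⟩, rfl⟩
    rw [SetLike.mem_coe, coordPlane, Submodule.mem_orthogonal]
    intro u hu
    induction hu using Submodule.span_induction with
    | mem x hx =>
      obtain ⟨⟨j, hj⟩, rfl⟩ := hx
      refine b.orthonormal.2 ?_
      rintro rfl
      exact (Finset.mem_compl.1 hi) hj
    | zero => simp
    | add x y _ _ hx hy => rw [inner_add_left, hx, hy, add_zero]
    | smul a x _ hx => rw [real_inner_smul_left, hx, mul_zero]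
  · have h1 := Submodule.finrank_add_finrank_orthogonal (coordPlane b T)
    rw [finrank_coordPlane, finrank_eq_card_basis b.toBasis] at h1
    rw [finrank_coordPlane, Finset.card_compl]
    omega

/-- This reduces statements about all planes to statements about subsets of an index set, for all
orthonormal bases at once. -/
theorem exists_eq_coordPlane (hι : finrank ℝ V = Fintype.card ι) (P : Submodule ℝ V) :
    ∃ (b : OrthonormalBasis ι ℝ V) (T : Finset ι), P = coordPlane b T := by
  have hle : finrank ℝ P ≤ Fintype.card ι := hι ▸ P.finrank_le
  obtain ⟨T, -, hT⟩ := Finset.exists_subset_card_eq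
    (show finrank ℝ P ≤ (Finset.univ : Finset ι).card by simpa using hle)
  let g : T ≃ Fin (finrank ℝ P) := T.equivFinOfCardEq hT
  let v : ι → V := fun i => if hi : i ∈ T then (stdOrthonormalBasis ℝ P (g ⟨i, hi⟩) : V) else 0
  have hv : ∀ i : T, v i = (stdOrthonormalBasis ℝ P (g i) : V) := fun i => by simp [v]
  have ho : Orthonormal ℝ ((T : Set ι).domRestrict v) := by
    have : (T : Set ι).domRestrict v =
        fun i : (T : Set ι) => (P.subtypeₗᵢ (stdOrthonormalBasis ℝ P (g i))) := by
      ext i; exact hv i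
    rw [this]
    exact ((stdOrthonormalBasis ℝ P).orthonormal.comp_linearIsometry P.subtypeₗᵢ).comp _ g.injective
  obtain ⟨b, hb⟩ := ho.exists_orthonormalBasis_extension_of_card_eq hι
  refine ⟨b, T, (Submodule.eq_of_le_of_finrank_eq ?_ ?_).symm⟩
  · refine Submodule.span_le.2 ?_
    rintro _ ⟨i, rfl⟩
    change b i ∈ P
    rw [hb i i.2, hv]
    exact Submodule.coe_mem _
  · rw [finrank_coordPlane, hT]

/-- An orthonormal basis of a coordinate plane, followed by the vectors spanning the complementary
coordinate plane. -/
theorem exists_orthonormalBasis_sum {r k : ℕ} (b : OrthonormalBasis ι ℝ V) (T : Finset ι)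
    (g : Fin k ≃ (Tᶜ : Finset ι)) (e : Fin r → V) (he : Orthonormal ℝ e)
    (heT : ∀ i, e i ∈ coordPlane b T) (hT : T.card = r) :
    ∃ c : OrthonormalBasis (Fin k ⊕ Fin r) ℝ V, c ∘ Sum.inr = e ∧ c ∘ Sum.inl = fun i => b (g i) := by
  have hk : k = Fintype.card ι - r := by
    have := Fintype.card_congr g
    rw [Fintype.card_fin, Fintype.card_coe, Finset.card_compl, hT] at this
    exact this
  have hr : r ≤ Fintype.card ι := hT ▸ T.card_le_univ
  have hcard : finrank ℝ V = Fintype.card (Fin k ⊕ Fin r) := by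
    rw [finrank_eq_card_basis b.toBasis]; simp; omega
  have horth : ∀ (i : Fin k) (j : Fin r), inner ℝ (b (g i)) (e j) = 0 := by
    intro i j
    have h1 : b (g i) ∈ (coordPlane b T)ᗮ := by
      rw [orthogonal_coordPlane]
      exact Submodule.subset_span ⟨g i, rfl⟩
    rw [real_inner_comm]
    exact (Submodule.mem_orthogonal _ _).1 h1 _ (heT j)
  have ho : Orthonormal ℝ (Sum.elim (fun i => b (g i)) e) := by
    refine ⟨?_, ?_⟩
    · rintro (i | j)
      · exact b.orthonormal.1 _
      · exact he.1 j
    · rintro (i | i) (j | j) hij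
      · refine b.orthonormal.2 fun h => hij ?_
        rw [g.injective (Subtype.ext h)]
      · exact horth i j
      · exact (real_inner_comm _ _).trans (horth j i)
      · exact he.2 fun h => hij (by rw [h])
  obtain ⟨c, hc⟩ := Orthonormal.exists_orthonormalBasis_extension_of_card_eq (s := Set.univ) hcard
    (v := Sum.elim (fun i => b (g i)) e) (ho.comp _ Subtype.val_injective)
  refine ⟨c, ?_, ?_⟩
  · ext i; exact hc (Sum.inr i) trivial
  · ext i; exact hc (Sum.inl i) trivial

theorem orthonormal_stdBasis {r : ℕ} (P : Submodule ℝ V) (h : finrank ℝ P = r) :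
    Orthonormal ℝ (fun i : Fin r => (stdOrthonormalBasis ℝ P (Fin.cast h.symm i) : V)) :=
  ((stdOrthonormalBasis ℝ P).orthonormal.comp_linearIsometry P.subtypeₗᵢ).comp _
    (Fin.cast_injective h.symm)

/-- Independence of the orthonormal basis of the plane comes from the Hodge star: the value of `star
α` on one fixed basis of the complement equals the value of `α` on every orthonormal basis of the
plane. -/
theorem sectional_coordPlane {r : ℕ} (α : DoubleForm V r r) (b : OrthonormalBasis ι ℝ V)
    (T : Finset ι) (e : Fin r → V) (he : Orthonormal ℝ e)
    (heT : ∀ i, e i ∈ coordPlane b T) (hT : T.card = r) :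
    sectional α (coordPlane b T) = α e e := by
  have hr : finrank ℝ (coordPlane b T) = r := by rw [finrank_coordPlane, hT]
  rw [sectional, dif_pos hr]
  let k := (Tᶜ : Finset ι).card
  let g : Fin k ≃ (Tᶜ : Finset ι) := (Finset.equivFin _).symm
  obtain ⟨c, hc1, hc2⟩ := exists_orthonormalBasis_sum b T g e he heT hT
  obtain ⟨c', hc1', hc2'⟩ := exists_orthonormalBasis_sum b T g _
    (orthonormal_stdBasis (coordPlane b T) hr) (fun i => Submodule.coe_mem _) hT
  have hdim : r + k = finrank ℝ V := by
    rw [finrank_eq_card_basis c.toBasis]; simp [add_comm]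
  have e1 := star_apply_orthonormal hdim hdim α (c.reindex (Equiv.sumComm _ _))
  have e2 := star_apply_orthonormal hdim hdim α (c'.reindex (Equiv.sumComm _ _))
  have s1 : ∀ c : OrthonormalBasis (Fin k ⊕ Fin r) ℝ V,
    (c.reindex (Equiv.sumComm _ _)) ∘ Sum.inr = c ∘ Sum.inl := fun c => by ext; simp
  have s2 : ∀ c : OrthonormalBasis (Fin k ⊕ Fin r) ℝ V,
    (c.reindex (Equiv.sumComm _ _)) ∘ Sum.inl = c ∘ Sum.inr := fun c => by ext; simp
  rw [s1, s2] at e1 e2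
  rw [hc2, hc1] at e1
  rw [hc2', hc1'] at e2
  exact e2.symm.trans e1

/-- The sum of the sectional curvatures of the coordinate 2-planes in a coordinate plane. -/
def planeSum (R : DoubleForm V 2 2) (b : OrthonormalBasis ι ℝ V) (T : Finset ι) : ℝ :=
  2⁻¹ * ∑ i ∈ T, ∑ j ∈ T, secMatrix R b i j

/-- The star moves the evaluation to the complementary vectors, where `g ^ k R` is `k!` times the
sum of the sectional curvatures over pairs; the normalisation removes `k!`. -/
theorem pCurvature_coordPlane (R : DoubleForm V 2 2) (p : ℕ) (b : OrthonormalBasis ι ℝ V)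
    (T : Finset ι) (hT : T.card = p) :
    R.pCurvature p (coordPlane b T) = planeSum R b Tᶜ := by
  have hV := finrank_eq_card_basis b.toBasis
  by_cases h : p + 2 ≤ finrank ℝ V
  · rw [pCurvature, dif_pos h]
    have hr : finrank ℝ (coordPlane b T) = p := by rw [finrank_coordPlane, hT]
    set k := finrank ℝ V - 2 - p with hk
    have hcard : (Tᶜ : Finset ι).card = k + 2 := by rw [Finset.card_compl, hT]; omega
    let g : Fin (k + 2) ≃ (Tᶜ : Finset ι) := (Finset.equivFinOfCardEq hcard).symm
    obtain ⟨c, hc1, hc2⟩ := exists_orthonormalBasis_sum b T g _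
      (orthonormal_stdBasis (coordPlane b T) hr) (fun i => Submodule.coe_mem _) hT
    rw [sectional, dif_pos hr]
    have hdim : (k + 2) + p = finrank ℝ V := by omega
    have e1 := star_apply_orthonormal hdim hdim (((metric V).pow k).mul R) c
    have e2 := pow_metric_mul_apply_orthonormal R k (fun i => b (g i))
      (b.orthonormal.comp _ (Subtype.val_injective.comp g.injective))
    rw [hc1, hc2, e2] at e1
    refine (congrArg (fun t => (k.factorial : ℝ)⁻¹ * t) e1).trans ?_
    have hf : (k.factorial : ℝ) ≠ 0 := by exact_mod_cast k.factorial_ne_zero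
    have e3 : ∀ F : ι → ℝ, ∑ i, F (g i) = ∑ i ∈ Tᶜ, F i := fun F =>
      (Equiv.sum_comp g fun i : (Tᶜ : Finset ι) => F i).trans (Finset.sum_coe_sort _ _)
    have e4 : ∑ i, ∑ j, R ![b (g i), b (g j)] ![b (g i), b (g j)] =
        ∑ i ∈ Tᶜ, ∑ j ∈ Tᶜ, secMatrix R b i j := by
      rw [← e3]
      exact Finset.sum_congr rfl fun i _ => e3 (fun j => secMatrix R b (g i) j)
    rw [e4, planeSum]
    field_simp
  -- For `p > n - 2` the complement has at most one index, so the sum over pairs is empty and agrees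
  -- with the convention `s_p = 0`.
  · rw [pCurvature, dif_neg h]
    have hcard : (Tᶜ : Finset ι).card ≤ 1 := by rw [Finset.card_compl, hT]; omega
    rw [Finset.card_le_one] at hcard
    rw [planeSum, Finset.sum_eq_zero, mul_zero]
    intro i hi
    refine Finset.sum_eq_zero fun j hj => ?_
    rw [hcard i hi j hj, secMatrix_self]

theorem sectional_coordPlane_pair (R : DoubleForm V 2 2) (b : OrthonormalBasis ι ℝ V) {i j : ι}
    (hij : i ≠ j) : sectional R (coordPlane b {i, j}) = secMatrix R b i j := by
  refine sectional_coordPlane R b {i, j} ![b i, b j] ?_ ?_ (Finset.card_pair hij)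
  · have : ![b i, b j] = b ∘ ![i, j] := by ext k; fin_cases k <;> rfl
    rw [this]
    refine b.orthonormal.comp _ ?_
    intro k l
    fin_cases k <;> fin_cases l <;> simp [hij, hij.symm]
  · intro k
    fin_cases k
    · exact Submodule.subset_span ⟨⟨i, by simp⟩, rfl⟩
    · exact Submodule.subset_span ⟨⟨j, by simp⟩, rfl⟩

theorem exists_pair_eq_coordPlane (hι : finrank ℝ V = Fintype.card ι) (P : Submodule ℝ V)
    (hP : finrank ℝ P = 2) : ∃ (b : OrthonormalBasis ι ℝ V) (i j : ι), i ≠ j ∧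
      P = coordPlane b {i, j} := by
  obtain ⟨b, T, rfl⟩ := exists_eq_coordPlane hι P
  rw [finrank_coordPlane] at hP
  obtain ⟨i, j, hij, rfl⟩ := Finset.card_eq_two.1 hP
  exact ⟨b, i, j, hij, rfl⟩

end Planes

end DoubleForm

/-! ### Combinatorics of the matrix of sectional curvatures -/

namespace SymmMatrix

variable {ι : Type*} {h : ι → ι → ℝ}

/-- The sum of the entries of `h` over the pairs in `T`. -/
def pairSum (h : ι → ι → ℝ) (T : Finset ι) : ℝ := 2⁻¹ * ∑ i ∈ T, ∑ j ∈ T, h i j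

theorem pairSum_insert [DecidableEq ι] (hs : ∀ i j, h i j = h j i) (h0 : ∀ i, h i i = 0) {a : ι} {A : Finset ι}
    (ha : a ∉ A) : pairSum h (insert a A) = pairSum h A + ∑ j ∈ A, h a j := by
  unfold pairSum
  rw [Finset.sum_insert ha, Finset.sum_insert ha, h0]
  simp_rw [Finset.sum_insert ha, Finset.sum_add_distrib]
  simp_rw [fun i => hs i a]
  ring

/-- The row differences of `h`, if a combination of the sums of `h` over `T` and over the complement
of `T` does not depend on `T`. -/
theorem row_differences [Fintype ι] [DecidableEq ι] {p : ℕ} (hp : 2 ≤ p) (hp' : p + 2 ≤ Fintype.card ι)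
    (hs : ∀ i j, h i j = h j i) (h0 : ∀ i, h i i = 0) (x y c : ℝ) (hxy : x + y ≠ 0)
    (H : ∀ T : Finset ι, T.card = p → x * pairSum h T + y * pairSum h Tᶜ = c)
    {i j : ι} (hij : i ≠ j) :
    (∀ k l, k ≠ i → k ≠ j → l ≠ i → l ≠ j → h i k - h j k = h i l - h j l) ∧
    (x * (p - 1) ≠ y * (Fintype.card ι - p - 1) → ∀ k, k ≠ i → k ≠ j → h i k = h j k) := by
  set d : ι → ℝ := fun k => h i k - h j k with hd
  set U : Finset ι := {i, j}ᶜ with hU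
  have hUc : U.card + 2 = Fintype.card ι := by
    rw [hU, Finset.card_compl, Finset.card_pair hij]; omega
  have memU : ∀ k, k ∈ U ↔ k ≠ i ∧ k ≠ j := fun k => by simp [hU]
  -- Compare the hypothesis for `A ∪ {i}` and `A ∪ {j}`. Their complements are `U \ A` together with
  -- the other index, so only the entries of rows `i` and `j` survive in the difference.
  have hswap : ∀ A ⊆ U, A.card + 1 = p → x * ∑ k ∈ A, d k = y * ∑ k ∈ U \ A, d k := by
    intro A hA hAc
    have hiA : i ∉ A := fun hh => ((memU i).1 (hA hh)).1 rfl
    have hjA : j ∉ A := fun hh => ((memU j).1 (hA hh)).2 rfl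
    have hiB : i ∉ U \ A := fun hh => ((memU i).1 (Finset.mem_sdiff.1 hh).1).1 rfl
    have hjB : j ∉ U \ A := fun hh => ((memU j).1 (Finset.mem_sdiff.1 hh).1).2 rfl
    have c1 : (insert i A)ᶜ = insert j (U \ A) := by
      ext k
      simp only [Finset.mem_compl, Finset.mem_insert, Finset.mem_sdiff, memU]
      by_cases hkj : k = j
      · subst hkj; simp [hij.symm, hjA]
      · simp [hkj]
    have c2 : (insert j A)ᶜ = insert i (U \ A) := by
      ext k
      simp only [Finset.mem_compl, Finset.mem_insert, Finset.mem_sdiff, memU]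
      by_cases hki : k = i
      · subst hki; simp [hij, hiA]
      · simp [hki]
    have e1 := H (insert i A) (by rw [Finset.card_insert_of_notMem hiA, hAc])
    have e2 := H (insert j A) (by rw [Finset.card_insert_of_notMem hjA, hAc])
    rw [c1, pairSum_insert hs h0 hiA, pairSum_insert hs h0 hjB] at e1
    rw [c2, pairSum_insert hs h0 hjA, pairSum_insert hs h0 hiB] at e2
    simp only [hd, Finset.sum_sub_distrib]
    linear_combination e1 - e2
  -- Apply `hswap` to two sets that differ only by having `k` or `l`; the difference is `(x + y) (d
  -- k - d l) = 0`. The bound `p + 2 ≤ n` leaves room for the `p - 2` common elements.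
  have hconst : ∀ k ∈ U, ∀ l ∈ U, d k = d l := by
    intro k hk l hl
    by_cases hkl : k = l
    · rw [hkl]
    obtain ⟨A0, hA0, hA0c⟩ := Finset.exists_subset_card_eq
      (show p - 2 ≤ (U \ {k, l}).card by
        rw [Finset.card_sdiff_of_subset (by
          intro z hz; simp at hz; rcases hz with rfl | rfl <;> assumption),
          Finset.card_pair hkl]
        omega)
    have hA0U : A0 ⊆ U := hA0.trans Finset.sdiff_subset
    have hkA : k ∉ A0 := fun hh => by simpa using (Finset.mem_sdiff.1 (hA0 hh)).2
    have hlA : l ∉ A0 := fun hh => by simpa using (Finset.mem_sdiff.1 (hA0 hh)).2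
    have e1 := hswap (insert k A0) (Finset.insert_subset hk hA0U)
      (by rw [Finset.card_insert_of_notMem hkA, hA0c]; omega)
    have e2 := hswap (insert l A0) (Finset.insert_subset hl hA0U)
      (by rw [Finset.card_insert_of_notMem hlA, hA0c]; omega)
    have s1 := Finset.sum_sdiff (f := d) (Finset.insert_subset hk hA0U)
    have s2 := Finset.sum_sdiff (f := d) (Finset.insert_subset hl hA0U)
    rw [Finset.sum_insert hkA] at e1 s1
    rw [Finset.sum_insert hlA] at e2 s2
    have : (x + y) * (d k - d l) = 0 := by
      linear_combination e1 - e2 + y * s1 - y * s2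
    have := (mul_eq_zero.1 this).resolve_left hxy
    linarith
  refine ⟨fun k l hki hkj hli hlj => hconst k ((memU k).2 ⟨hki, hkj⟩) l ((memU l).2 ⟨hli, hlj⟩),
    fun hne k hki hkj => ?_⟩
  have hkU := (memU k).2 ⟨hki, hkj⟩
  obtain ⟨A, hA, hAc⟩ := Finset.exists_subset_card_eq (show p - 1 ≤ U.card by omega)
  -- With `d` constant, `hswap` only counts elements: `x (p - 1) d = y (n - p - 1) d`.
  have e := hswap A hA (by omega)
  have hAcR : (A.card : ℝ) = p - 1 := by
    rw [hAc, Nat.cast_sub (by omega)]; simp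
  have hBcR : ((U \ A).card : ℝ) = Fintype.card ι - p - 1 := by
    rw [Finset.card_sdiff_of_subset hA, Nat.cast_sub (Finset.card_le_card hA), hAcR, ← hUc]
    push_cast; ring
  rw [Finset.sum_congr rfl fun l hl => hconst l (hA hl) k hkU,
    Finset.sum_congr rfl fun l hl => hconst l (Finset.mem_sdiff.1 hl).1 k hkU,
    Finset.sum_const, Finset.sum_const, nsmul_eq_mul, nsmul_eq_mul, hAcR, hBcR] at e
  have : (x * (p - 1) - y * (Fintype.card ι - p - 1)) * d k = 0 := by linear_combination e
  have := (mul_eq_zero.1 this).resolve_left (sub_ne_zero.2 hne)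
  simp only [hd] at this
  linarith

theorem eq_of_row_differences_zero (hs : ∀ i j, h i j = h j i)
    (H : ∀ i j k, i ≠ j → k ≠ i → k ≠ j → h i k = h j k) {i j k l : ι} (hij : i ≠ j) (hkl : k ≠ l) :
    h i j = h k l := by
  have A : ∀ {i j k : ι}, i ≠ j → k ≠ j → h i j = h k j := by
    intro i j k hij hkj
    by_cases hik : i = k
    · rw [hik]
    · exact H i k j hik hij.symm hkj.symm
  by_cases hkj : k = j
  · subst hkj
    exact (A hij hkl.symm).trans (hs l k)
  · rw [A hij hkj, hs k j, hs k l]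
    by_cases hjl : j = l
    · rw [hjl]
    · exact A (Ne.symm hkj) (hkl.symm)

theorem pairSum_of_const [DecidableEq ι] {κ : ℝ} (h0 : ∀ i, h i i = 0) (H : ∀ i j, i ≠ j → h i j = κ)
    (T : Finset ι) : pairSum h T = κ * (T.card * (T.card - 1) / 2) := by
  unfold pairSum
  have : ∀ i ∈ T, ∑ j ∈ T, h i j = κ * (T.card - 1) := by
    intro i hi
    rw [← Finset.add_sum_erase _ _ hi, h0, zero_add,
      Finset.sum_congr rfl fun j hj => H i j (Finset.ne_of_mem_erase hj).symm,
      Finset.sum_const, nsmul_eq_mul, Finset.card_erase_of_mem hi,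
      Nat.cast_sub (Finset.card_pos.2 ⟨i, hi⟩)]
    push_cast; ring
  rw [Finset.sum_congr rfl this, Finset.sum_const, nsmul_eq_mul]
  ring

/-- The Schouten form of the matrix `h` of sectional curvatures. -/
def schouten [Fintype ι] (h : ι → ι → ℝ) (i : ι) : ℝ :=
  ((Fintype.card ι : ℝ) - 2)⁻¹ * (∑ k, h i k -
    (∑ l, ∑ k, h l k) / (2 * ((Fintype.card ι : ℝ) - 1)))

/-- Summing a row difference over all columns identifies it with `B i - B j`, where `B` is the
Schouten form. Hence `h i j - B i - B j` takes one value off the diagonal, and the scalar term in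
the Schouten form is the one for which the row sum makes this value zero. -/
theorem eq_schouten_add [Fintype ι] [DecidableEq ι] (hn : 4 ≤ Fintype.card ι) (hs : ∀ i j, h i j = h j i) (h0 : ∀ i, h i i = 0)
    (H : ∀ i j k l, i ≠ j → k ≠ i → k ≠ j → l ≠ i → l ≠ j → h i k - h j k = h i l - h j l)
    {i j : ι} (hij : i ≠ j) : h i j = schouten h i + schouten h j := by
  have hn' : (4 : ℝ) ≤ Fintype.card ι := by exact_mod_cast hn
  set n : ℝ := (Fintype.card ι : ℝ) with hnd
  have hn2 : n - 2 ≠ 0 := by linarith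
  have hn1 : n - 1 ≠ 0 := by linarith
  set B := schouten h with hB
  have hBdef : ∀ i, (n - 2) * B i = ∑ k, h i k - (∑ l, ∑ k, h l k) / (2 * (n - 1)) := by
    intro i
    rw [hB, schouten, ← hnd, mul_inv_cancel_left₀ hn2]
  have hrow : ∀ i j k, i ≠ j → k ≠ i → k ≠ j → h i k - h j k = B i - B j := by
    intro i j k hij hki hkj
    refine mul_left_cancel₀ hn2 ?_
    -- The columns `i` and `j` cancel each other by symmetry and the zero diagonal, which leaves `n
    -- - 2` equal terms.
    have e : ∑ l, (h i l - h j l) = (n - 2) * (h i k - h j k) := by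
      rw [← Finset.sum_add_sum_compl {i, j}, Finset.sum_pair hij, h0, h0, hs j i]
      rw [Finset.sum_congr rfl (g := fun _ => h i k - h j k), Finset.sum_const, nsmul_eq_mul,
        Finset.card_compl, Finset.card_pair hij, Nat.cast_sub (by omega)]
      · push_cast; ring
      · intro l hl
        simp only [Finset.mem_compl, Finset.mem_insert, Finset.mem_singleton, not_or] at hl
        exact H i j l k hij hl.1 hl.2 hki hkj
    rw [← e, mul_sub, hBdef, hBdef, Finset.sum_sub_distrib]
    ring
  set t : ι → ι → ℝ := fun i j => h i j - B i - B j with ht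
  have htconst : ∀ k l, k ≠ l → t k l = t i j := fun k l hkl =>
    eq_of_row_differences_zero (h := t) (fun i j => by simp only [ht]; rw [hs]; ring)
      (fun i j k hij hki hkj => by simp only [ht]; linarith [hrow i j k hij hki hkj]) hkl hij
  have hsumB : ∑ k, B k = (∑ l, ∑ k, h l k) / (2 * (n - 1)) := by
    refine mul_left_cancel₀ hn2 ?_
    rw [Finset.mul_sum]
    simp_rw [hBdef]
    rw [Finset.sum_sub_distrib, Finset.sum_const, nsmul_eq_mul, Finset.card_univ, ← hnd]
    field_simp
    ring
  have e2 : ∑ k ∈ Finset.univ.erase i, t i k = (n - 1) * t i j := by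
    rw [Finset.sum_congr rfl fun k hk => htconst i k (Finset.ne_of_mem_erase hk).symm,
      Finset.sum_const, nsmul_eq_mul, Finset.card_erase_of_mem (Finset.mem_univ _),
      Finset.card_univ, Nat.cast_sub (by omega)]
    push_cast; rfl
  have e3 : ∑ k ∈ Finset.univ.erase i, t i k = ∑ k, t i k - t i i := by
    rw [← Finset.add_sum_erase _ _ (Finset.mem_univ i)]; ring
  have e4 : ∑ k, t i k = ∑ k, h i k - n * B i - ∑ k, B k := by
    simp only [ht, Finset.sum_sub_distrib, Finset.sum_const, nsmul_eq_mul, Finset.card_univ]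
    rfl
  have e5 : (n - 1) * t i j = 0 := by
    rw [← e2, e3, e4, hsumB]
    simp only [ht, h0]
    linear_combination -(hBdef i)
  have := (mul_eq_zero.1 e5).resolve_left hn1
  simp only [ht] at this
  linarith

theorem pairSum_of_add [DecidableEq ι] (h0 : ∀ i, h i i = 0) (B : ι → ℝ) (H : ∀ i j, i ≠ j → h i j = B i + B j)
    (T : Finset ι) : pairSum h T = (T.card - 1) * ∑ i ∈ T, B i := by
  unfold pairSum
  have : ∀ i ∈ T, ∑ j ∈ T, h i j = (T.card - 2) * B i + ∑ j ∈ T, B j := by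
    intro i hi
    rw [← Finset.add_sum_erase _ _ hi, h0, zero_add,
      Finset.sum_congr rfl fun j hj => H i j (Finset.ne_of_mem_erase hj).symm,
      Finset.sum_add_distrib,
      Finset.sum_const, nsmul_eq_mul, Finset.card_erase_of_mem hi,
      Nat.cast_sub (Finset.card_pos.2 ⟨i, hi⟩), ← Finset.add_sum_erase T B hi]
    push_cast; ring
  rw [Finset.sum_congr rfl this, Finset.sum_add_distrib, ← Finset.mul_sum, Finset.sum_const,
    nsmul_eq_mul]
  ring

/-- The difference of the sums of `h` over a set and over its complement. -/
theorem pairSum_compl_sub [Fintype ι] [DecidableEq ι] (hs : ∀ i j, h i j = h j i) (T : Finset ι) :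
    pairSum h Tᶜ - pairSum h T = 2⁻¹ * ∑ i, ∑ k, h i k - ∑ i ∈ T, ∑ k, h i k := by
  unfold pairSum
  have e1 : ∀ i, ∑ k, h i k = ∑ k ∈ T, h i k + ∑ k ∈ Tᶜ, h i k :=
    fun i => (Finset.sum_add_sum_compl T _).symm
  have e2 : ∑ i ∈ Tᶜ, ∑ k ∈ T, h i k = ∑ i ∈ T, ∑ k ∈ Tᶜ, h i k := by
    rw [Finset.sum_comm]
    exact Finset.sum_congr rfl fun i _ => Finset.sum_congr rfl fun k _ => hs _ _
  rw [← Finset.sum_add_sum_compl T (fun i => ∑ k, h i k)]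
  simp_rw [e1, Finset.sum_add_distrib]
  rw [e2]
  ring

/-- Exchange one element of `T`; the bounds `1 ≤ p ≤ n - 1` make the exchange possible for any two
indices. -/
theorem eq_of_sum_const [Fintype ι] [DecidableEq ι] {p : ℕ} (hp : 1 ≤ p)
    (hp' : p + 1 ≤ Fintype.card ι) (r : ι → ℝ) (c : ℝ)
    (H : ∀ T : Finset ι, T.card = p → ∑ i ∈ T, r i = c) (i j : ι) : r i = r j := by
  by_cases hij : i = j
  · rw [hij]
  obtain ⟨A, hA, hAc⟩ := Finset.exists_subset_card_eq
    (show p - 1 ≤ ({i, j}ᶜ : Finset ι).card by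
      rw [Finset.card_compl, Finset.card_pair hij]; omega)
  have hi : i ∉ A := fun hh => by simpa using hA hh
  have hj : j ∉ A := fun hh => by simpa using hA hh
  have e1 := H (insert i A) (by rw [Finset.card_insert_of_notMem hi]; omega)
  have e2 := H (insert j A) (by rw [Finset.card_insert_of_notMem hj]; omega)
  rw [Finset.sum_insert hi] at e1
  rw [Finset.sum_insert hj] at e2
  linarith

end SymmMatrix

/-- Quadrilinear forms with the symmetries of a curvature tensor. -/
structure IsCurvatureLike {V : Type*} [AddCommGroup V] [Module ℝ V] (F : V → V → V → V → ℝ) :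
    Prop where
  add : ∀ x x' y z w, F (x + x') y z w = F x y z w + F x' y z w
  smul : ∀ (a : ℝ) x y z w, F (a • x) y z w = a * F x y z w
  skew : ∀ x y z w, F x y z w = -F y x z w
  pair : ∀ x y z w, F x y z w = F z w x y
  bianchi : ∀ x y z w, F x y z w + F y z x w + F z x y w = 0

/-! ### Algebraic curvature tensors -/

namespace IsCurvatureLike

section

variable {V : Type*} [AddCommGroup V] [Module ℝ V] {F : V → V → V → V → ℝ}

theorem add₂ (h : IsCurvatureLike F) (x y y' z w : V) :
    F x (y + y') z w = F x y z w + F x y' z w := by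
  rw [h.skew, h.add, h.skew y, h.skew y']; ring

theorem add₃ (h : IsCurvatureLike F) (x y z z' w : V) :
    F x y (z + z') w = F x y z w + F x y z' w := by
  rw [h.pair, h.add, h.pair z, h.pair z']

theorem add₄ (h : IsCurvatureLike F) (x y z w w' : V) :
    F x y z (w + w') = F x y z w + F x y z w' := by
  rw [h.pair, h.add₂, h.pair z, h.pair z]

theorem smul₂ (h : IsCurvatureLike F) (a : ℝ) (x y z w : V) : F x (a • y) z w = a * F x y z w := by
  rw [h.skew, h.smul, h.skew y]; ring

theorem smul₃ (h : IsCurvatureLike F) (a : ℝ) (x y z w : V) : F x y (a • z) w = a * F x y z w := by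
  rw [h.pair, h.smul, h.pair z]

theorem smul₄ (h : IsCurvatureLike F) (a : ℝ) (x y z w : V) : F x y z (a • w) = a * F x y z w := by
  rw [h.pair, h.smul₂, h.pair z]

theorem skew' (h : IsCurvatureLike F) (x y z w : V) : F x y z w = -F x y w z := by
  rw [h.pair, h.skew, h.pair w]

theorem self_left (h : IsCurvatureLike F) (x z w : V) : F x x z w = 0 := by
  linarith [h.skew x x z w]

theorem sub {F' : V → V → V → V → ℝ} (h : IsCurvatureLike F) (h' : IsCurvatureLike F') :
    IsCurvatureLike fun x y z w => F x y z w - F' x y z w where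
  add x x' y z w := by rw [h.add, h'.add]; ring
  smul a x y z w := by rw [h.smul, h'.smul]; ring
  skew x y z w := by rw [h.skew, h'.skew]; ring
  pair x y z w := by rw [h.pair, h'.pair]
  bianchi x y z w := by linarith [h.bianchi x y z w, h'.bianchi x y z w]

/-- A curvature tensor is determined by its sectional curvatures. -/
theorem eq_zero (h : IsCurvatureLike F) (H : ∀ x y, F x y x y = 0) (x y z w : V) :
    F x y z w = 0 := by
  -- Polarisation in `x` and then in `y` makes `F` skew in its second and fourth arguments. With the
  -- skewness within each pair, `F` is alternating, and the Bianchi identity becomes `3 F = 0`.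
  have h1 : ∀ x y z, F x y z y = 0 := by
    intro x y z
    have e := H (x + z) y
    rw [h.add, h.add₃, h.add₃, H, H, h.pair z y x y] at e
    linarith
  have h2 : ∀ x y z w, F x y z w = -F x w z y := by
    intro x y z w
    have e := h1 x (y + w) z
    rw [h.add₂, h.add₄, h.add₄, h1, h1] at e
    linarith
  have a1 := h2 x y z w
  have a2 := h2 y z x w
  have a3 := h2 z x y w
  have b1 := h.bianchi x y z w
  have c1 := h.skew' x w y z
  have c2 := h.skew' y w x z
  have c3 := h.skew' z w y x
  have d1 := h2 x z y w
  have d2 := h2 y x z w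
  have d3 := h2 z y x w
  have k1 := h.skew x y z w
  have k2 := h.skew y z x w
  have k3 := h.skew z x y w
  have k4 := h.skew' x w z y
  have k5 := h.skew' y w z x
  have k6 := h.skew' z w x y
  linarith

end

variable {V : Type*} [NormedAddCommGroup V] [InnerProductSpace ℝ V] {F : V → V → V → V → ℝ}

/-- Subtracting from `y` its component along `x` does not change `F x y x y`; the rest is scaling to
unit length. -/
theorem eq_zero_of_orthonormal (h : IsCurvatureLike F)
    (H : ∀ u v : V, ‖u‖ = 1 → ‖v‖ = 1 → inner ℝ u v = (0 : ℝ) → F u v u v = 0) (x y z w : V) :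
    F x y z w = 0 := by
  refine h.eq_zero (fun x y => ?_) x y z w
  have hz : ∀ a b c : V, F 0 a b c = 0 := fun a b c => by
    have := h.smul 0 0 a b c; simpa using this
  by_cases hx : x = 0
  · rw [hx, hz]
  have hx' : ‖x‖ ≠ 0 := norm_ne_zero_iff.2 hx
  set t : ℝ := inner ℝ x y / ‖x‖ ^ 2 with ht
  set y' := y - t • x with hy'
  have hxy' : inner ℝ x y' = (0 : ℝ) := by
    rw [hy', inner_sub_right, real_inner_smul_right, real_inner_self_eq_norm_sq, ht]
    field_simp; ring
  have e1 : F x y x y = F x y' x y' := by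
    have hyy : y = y' + t • x := by rw [hy']; abel
    rw [hyy, h.add₂, h.add₄, h.add₄, h.smul₂, h.smul₂, h.smul₄, h.self_left, h.self_left,
      h.pair x y' x x, h.self_left]
    ring
  rw [e1]
  by_cases hy0 : y' = 0
  · rw [hy0, h.skew, hz]; simp
  have hyn : ‖y'‖ ≠ 0 := norm_ne_zero_iff.2 hy0
  have := H (‖x‖⁻¹ • x) (‖y'‖⁻¹ • y') (by rw [norm_smul]; simp [hx'])
    (by rw [norm_smul]; simp [hyn])
    (by rw [real_inner_smul_left, real_inner_smul_right, hxy']; simp)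
  rw [h.smul, h.smul₂, h.smul₃, h.smul₄] at this
  simpa [hx', hyn, hx, hy0] using this

/-- The Kulkarni-Nomizu product of the inner product and a symmetric bilinear form. -/
theorem kulkarniNomizu (B : V → V → ℝ) (hadd : ∀ x x' y, B (x + x') y = B x y + B x' y)
    (hsmul : ∀ (a : ℝ) x y, B (a • x) y = a * B x y) (hs : ∀ x y, B x y = B y x) :
    IsCurvatureLike fun x y z w => inner ℝ x z * B y w + inner ℝ y w * B x z
      - inner ℝ x w * B y z - inner ℝ y z * B x w where
  add x x' y z w := by simp only [inner_add_left, hadd]; ring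
  smul a x y z w := by simp only [real_inner_smul_left, hsmul]; ring
  skew x y z w := by ring
  pair x y z w := by
    simp only [hs z, hs w, real_inner_comm x z, real_inner_comm y z, real_inner_comm x w,
      real_inner_comm y w]; ring
  bianchi x y z w := by
    simp only [hs y x, hs z x, hs z y, real_inner_comm x z, real_inner_comm y z,
      real_inner_comm x y]; ring

end IsCurvatureLike

/-! ### Ricci and scalar curvature as traces in any orthonormal basis -/

namespace DoubleForm

section Traces

variable {V : Type*} [NormedAddCommGroup V] [InnerProductSpace ℝ V]

/-- The contraction is defined with one chosen basis; this frees it, so that traces can be taken in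
the basis adapted to a plane. -/
theorem sum_orthonormalBasis_eq {ι κ : Type*} [Fintype ι] [Fintype κ] (b : OrthonormalBasis ι ℝ V)
    (c : OrthonormalBasis κ ℝ V) (B : V → V → ℝ) (hadd : ∀ x x' y, B (x + x') y = B x y + B x' y)
    (hsmul : ∀ (a : ℝ) x y, B (a • x) y = a * B x y)
    (hadd' : ∀ x y y', B x (y + y') = B x y + B x y')
    (hsmul' : ∀ (a : ℝ) x y, B x (a • y) = a * B x y) : ∑ i, B (b i) (b i) = ∑ i, B (c i) (c i) := by
  let L : V →ₗ[ℝ] V →ₗ[ℝ] ℝ := LinearMap.mk₂ ℝ B hadd hsmul hadd' hsmul'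
  have hL : ∀ x y, B x y = L x y := fun _ _ => rfl
  have h1 : ∀ i, L (b i) (b i) = ∑ j, inner ℝ (c j) (b i) * L (c j) (b i) := by
    intro i
    have := congrArg (fun u => L u (b i)) (c.sum_repr' (b i))
    simpa [map_sum] using this.symm
  have h2 : ∀ j, L (c j) (c j) = ∑ i, inner ℝ (c j) (b i) * L (c j) (b i) := by
    intro j
    have := congrArg (fun u => L (c j) u) (b.sum_repr' (c j))
    simpa [map_sum, real_inner_comm (c j)] using this.symm
  simp_rw [hL, h1, h2]
  exact Finset.sum_comm

variable [FiniteDimensional ℝ V]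

/-- The Ricci form of a curvature tensor. -/
def ricForm (R : DoubleForm V 2 2) (x y : V) : ℝ := R.contract ![x] ![y]

/-- The scalar curvature of a curvature tensor. -/
def scalForm (R : DoubleForm V 2 2) : ℝ := R.contract.contract ![] ![]

theorem contract_apply {p q : ℕ} (α : DoubleForm V (p + 1) (q + 1)) (v : Fin p → V)
    (w : Fin q → V) : α.contract v w = ∑ j, α (Matrix.vecCons (stdOrthonormalBasis ℝ V j) v)
      (Matrix.vecCons (stdOrthonormalBasis ℝ V j) w) := by
  unfold contract
  rw [alternatingMap_sum_apply, alternatingMap_sum_apply]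
  rfl

variable {ι : Type*} [Fintype ι] {R : DoubleForm V 2 2}

theorem ricForm_eq_sum_of_add (b : OrthonormalBasis ι ℝ V)
    (hR : IsCurvatureLike fun x y z w => R ![x, y] ![z, w]) (x y : V) :
    ricForm R x y = ∑ j, R ![b j, x] ![b j, y] := by
  unfold ricForm
  rw [contract_apply]
  exact sum_orthonormalBasis_eq (stdOrthonormalBasis ℝ V) b (fun u v => R ![u, x] ![v, y])
    (fun u u' v => hR.add u u' x v y) (fun a u v => hR.smul a u x v y)
    (fun u v v' => hR.add₃ u x v v' y) (fun a u v => hR.smul₃ a u x v y)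

theorem ricForm_add (hR : IsCurvatureLike fun x y z w => R ![x, y] ![z, w]) (x x' y : V) :
    ricForm R (x + x') y = ricForm R x y + ricForm R x' y := by
  simp_rw [ricForm_eq_sum_of_add (stdOrthonormalBasis ℝ V) hR, hR.add₂, Finset.sum_add_distrib]

theorem ricForm_smul (hR : IsCurvatureLike fun x y z w => R ![x, y] ![z, w]) (a : ℝ) (x y : V) :
    ricForm R (a • x) y = a * ricForm R x y := by
  simp_rw [ricForm_eq_sum_of_add (stdOrthonormalBasis ℝ V) hR, hR.smul₂, Finset.mul_sum]

theorem ricForm_symm (hR : IsCurvatureLike fun x y z w => R ![x, y] ![z, w]) (x y : V) :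
    ricForm R x y = ricForm R y x := by
  simp_rw [ricForm_eq_sum_of_add (stdOrthonormalBasis ℝ V) hR]
  exact Finset.sum_congr rfl fun j _ => hR.pair _ _ _ _

theorem ricForm_basis (b : OrthonormalBasis ι ℝ V)
    (hR : IsCurvatureLike fun x y z w => R ![x, y] ![z, w]) (i : ι) :
    ricForm R (b i) (b i) = ∑ k, secMatrix R b i k := by
  rw [ricForm_eq_sum_of_add b hR]
  exact Finset.sum_congr rfl fun k _ => secMatrix_symm R b k i

theorem scalForm_eq_sum (b : OrthonormalBasis ι ℝ V)
    (hR : IsCurvatureLike fun x y z w => R ![x, y] ![z, w]) :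
    scalForm R = ∑ i, ∑ k, secMatrix R b i k := by
  unfold scalForm
  rw [contract_apply]
  simp_rw [← ricForm_basis b hR]
  refine sum_orthonormalBasis_eq (stdOrthonormalBasis ℝ V) b (fun x y => ricForm R x y)
    (ricForm_add hR) (ricForm_smul hR) (fun x y y' => ?_) (fun a x y => ?_)
  · rw [ricForm_symm hR, ricForm_add hR, ricForm_symm hR y, ricForm_symm hR y']
  · rw [ricForm_symm hR, ricForm_smul hR, ricForm_symm hR y]

end Traces

end DoubleForm

/-! ### The four statements at one point -/

namespace DoubleForm

theorem planeSum_eq {V : Type*} [NormedAddCommGroup V] [InnerProductSpace ℝ V]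
    {R : DoubleForm V 2 2} {ι : Type*} [Fintype ι] (b : OrthonormalBasis ι ℝ V) (T : Finset ι) :
    planeSum R b T = SymmMatrix.pairSum (secMatrix R b) T := rfl

section Pointwise

variable {V : Type*} [NormedAddCommGroup V] [InnerProductSpace ℝ V] [FiniteDimensional ℝ V]
  {n : ℕ} {R : DoubleForm V 2 2}

theorem pCurvature_coordPlane_compl (p : ℕ) (b : OrthonormalBasis (Fin n) ℝ V)
    (T : Finset (Fin n)) (hT : T.card = p) :
    R.pCurvature (n - p) (coordPlane b T)ᗮ = planeSum R b T := by
  rw [orthogonal_coordPlane, pCurvature_coordPlane, compl_compl]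
  rw [Finset.card_compl, hT, Fintype.card_fin]

theorem exists_orthonormalBasis_pair (hV : finrank ℝ V = n) {u v : V} (hu : ‖u‖ = 1) (hv : ‖v‖ = 1)
    (huv : inner ℝ u v = (0 : ℝ)) :
    ∃ (b : OrthonormalBasis (Fin n) ℝ V) (i j : Fin n), i ≠ j ∧ b i = u ∧ b j = v := by
  have ho : Orthonormal ℝ ![u, v] := by
    refine ⟨fun i => by fin_cases i <;> simp [hu, hv], fun i j hij => ?_⟩
    fin_cases i <;> fin_cases j <;> simp_all [real_inner_comm]
  have h2 : 2 ≤ n := by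
    have := ho.linearIndependent.fintype_card_le_finrank
    simpa [hV] using this
  obtain ⟨i, j, hij⟩ : ∃ i j : Fin n, i ≠ j := ⟨⟨0, by omega⟩, ⟨1, by omega⟩, by simp⟩
  have hi : (if i = i then u else v) = u := if_pos rfl
  have hj : (if j = i then u else v) = v := if_neg hij.symm
  obtain ⟨b, hb⟩ := Orthonormal.exists_orthonormalBasis_extension_of_card_eq (ι := Fin n)
    (by simpa using hV) (v := fun k => if k = i then u else v) (s := {i, j}) (by
      refine ⟨fun k => ?_, fun k l hkl => ?_⟩
      · simp only [Set.domRestrict_apply]; split_ifs <;> assumption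
      · obtain ⟨k, rfl | rfl⟩ := k <;> obtain ⟨l, rfl | rfl⟩ := l
        · exact absurd rfl hkl
        · simpa [hij.symm] using huv
        · simpa [hij.symm, real_inner_comm u v] using huv
        · exact absurd rfl hkl)
  exact ⟨b, i, j, hij, (hb i (by simp)).trans hi, (hb j (by simp)).trans hj⟩

theorem exists_orthonormalBasis_mem (hV : finrank ℝ V = n) {u : V} (hu : ‖u‖ = 1) :
    ∃ (b : OrthonormalBasis (Fin n) ℝ V) (i : Fin n), b i = u := by
  have hn : 0 < n := by
    rw [← hV, Module.finrank_pos_iff]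
    exact ⟨u, 0, fun h => by simp [h] at hu⟩
  obtain ⟨b, hb⟩ := Orthonormal.exists_orthonormalBasis_extension_of_card_eq (ι := Fin n)
    (by simpa using hV) (v := fun _ => u) (s := {⟨0, hn⟩}) (by
      refine ⟨fun i => hu, fun i j hij => ?_⟩
      exact absurd (Subsingleton.elim i j) hij)
  exact ⟨b, ⟨0, hn⟩, hb _ (by simp)⟩

/-- A combination of the `p`-curvatures of a plane and of its complement in terms of a basis. -/
theorem combination_eq_pairSum {p : ℕ} (x y : ℝ) (b : OrthonormalBasis (Fin n) ℝ V)
    (T : Finset (Fin n)) (hT : T.card = p) :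
    x * R.pCurvature (n - p) (coordPlane b T)ᗮ + y * R.pCurvature p (coordPlane b T) =
      x * SymmMatrix.pairSum (secMatrix R b) T + y * SymmMatrix.pairSum (secMatrix R b) Tᶜ := by
  rw [pCurvature_coordPlane_compl p b T hT, pCurvature_coordPlane R p b T hT, planeSum_eq,
    planeSum_eq]

theorem combination_const_of_sectional_const (hV : finrank ℝ V = n) {p : ℕ} (x y κ : ℝ)
    (H : ∀ P : Submodule ℝ V, finrank ℝ P = 2 → R.sectional P = κ) (P : Submodule ℝ V)
    (hP : finrank ℝ P = p) :
    x * R.pCurvature (n - p) Pᗮ + y * R.pCurvature p P =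
      κ * (x * (p * (p - 1) / 2) + y * ((n - p) * (n - p - 1) / 2)) := by
  obtain ⟨b, T, rfl⟩ := exists_eq_coordPlane (ι := Fin n) (by simpa using hV) P
  have hT : T.card = p := by rwa [finrank_coordPlane] at hP
  have hpn : p ≤ n := by simpa [hT] using T.card_le_univ
  have hc : ∀ i j, i ≠ j → secMatrix R b i j = κ := fun i j hij => by
    rw [← sectional_coordPlane_pair R b hij]
    exact H _ (by rw [finrank_coordPlane, Finset.card_pair hij])
  rw [combination_eq_pairSum x y b T hT, SymmMatrix.pairSum_of_const (secMatrix_self R b) hc,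
    SymmMatrix.pairSum_of_const (secMatrix_self R b) hc, Finset.card_compl, hT, Fintype.card_fin,
    Nat.cast_sub hpn]
  ring

/-- By the second half of `row_differences`, all coordinate sectional curvatures of a basis adapted
to `P` agree. Evaluating the combination on one subset then expresses their common value through
`c`, a formula that does not involve the point of the manifold. -/
theorem sectional_const_of_combination_const (hV : finrank ℝ V = n) {p : ℕ} (hp : 2 ≤ p)
    (hp' : p + 2 ≤ n) (x y c : ℝ) (hxy : x + y ≠ 0) (hne : x * (p - 1) ≠ y * (n - p - 1))
    (H : ∀ P : Submodule ℝ V, finrank ℝ P = p →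
      x * R.pCurvature (n - p) Pᗮ + y * R.pCurvature p P = c)
    (P : Submodule ℝ V) (hP : finrank ℝ P = 2) :
    R.sectional P * (x * (p * (p - 1) / 2) + y * ((n - p) * (n - p - 1) / 2)) = c := by
  obtain ⟨b, i, j, hij, rfl⟩ := exists_pair_eq_coordPlane (ι := Fin n) (by simpa using hV) P hP
  rw [sectional_coordPlane_pair R b hij]
  have H' : ∀ T : Finset (Fin n), T.card = p → x * SymmMatrix.pairSum (secMatrix R b) T +
      y * SymmMatrix.pairSum (secMatrix R b) Tᶜ = c := fun T hT => by
    rw [← combination_eq_pairSum x y b T hT]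
    exact H _ (by rw [finrank_coordPlane, hT])
  have hc : ∀ k l, k ≠ l → secMatrix R b k l = secMatrix R b i j := fun k l hkl =>
    SymmMatrix.eq_of_row_differences_zero (secMatrix_symm R b) (fun i j k hij hki hkj =>
      (SymmMatrix.row_differences hp (by simpa using hp') (secMatrix_symm R b) (secMatrix_self R b)
        x y c hxy H' hij).2 (by simpa using hne) k hki hkj) hkl hij
  obtain ⟨T, -, hT⟩ := Finset.exists_subset_card_eq
    (show p ≤ (Finset.univ : Finset (Fin n)).card by simp; omega)
  rw [← H' T hT, SymmMatrix.pairSum_of_const (secMatrix_self R b) hc,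
    SymmMatrix.pairSum_of_const (secMatrix_self R b) hc, Finset.card_compl, hT, Fintype.card_fin,
    Nat.cast_sub (by omega)]
  ring

theorem scalForm_of_sectional_const
    (hR : IsCurvatureLike fun x y z w => R ![x, y] ![z, w]) (hV : finrank ℝ V = n) (κ : ℝ)
    (H : ∀ P : Submodule ℝ V, finrank ℝ P = 2 → R.sectional P = κ) :
    scalForm R = κ * (n * (n - 1)) := by
  obtain ⟨b, -, -⟩ := exists_eq_coordPlane (ι := Fin n) (by simpa using hV) (⊤ : Submodule ℝ V)
  have hc : ∀ i j, i ≠ j → secMatrix R b i j = κ := fun i j hij => by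
    rw [← sectional_coordPlane_pair R b hij]
    exact H _ (by rw [finrank_coordPlane, Finset.card_pair hij])
  have := SymmMatrix.pairSum_of_const (secMatrix_self R b) hc Finset.univ
  rw [SymmMatrix.pairSum, ← scalForm_eq_sum b hR] at this
  simp only [Finset.card_univ, Fintype.card_fin] at this
  linarith

/-- The entries joining `T` to its complement cancel in the difference, so only row sums, that is
Ricci curvatures, remain. -/
theorem difference_eq
    (hR : IsCurvatureLike fun x y z w => R ![x, y] ![z, w]) {p : ℕ} (b : OrthonormalBasis (Fin n) ℝ V)
    (T : Finset (Fin n)) (hT : T.card = p) :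
    R.pCurvature p (coordPlane b T) - R.pCurvature (n - p) (coordPlane b T)ᗮ =
      scalForm R / 2 - ∑ i ∈ T, ricForm R (b i) (b i) := by
  rw [pCurvature_coordPlane_compl p b T hT, pCurvature_coordPlane R p b T hT, planeSum_eq,
    planeSum_eq, SymmMatrix.pairSum_compl_sub (secMatrix_symm R b), ← scalForm_eq_sum b hR]
  simp_rw [ricForm_basis b hR]
  ring

theorem difference_of_einstein
    (hR : IsCurvatureLike fun x y z w => R ![x, y] ![z, w]) (hV : finrank ℝ V = n) {p : ℕ} (κ : ℝ)
    (H : ∀ x y, ricForm R x y = κ * inner ℝ x y) (P : Submodule ℝ V) (hP : finrank ℝ P = p) :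
    R.pCurvature p P - R.pCurvature (n - p) Pᗮ = (n - 2 * p) / 2 * κ := by
  obtain ⟨b, T, rfl⟩ := exists_eq_coordPlane (ι := Fin n) (by simpa using hV) P
  have hT : T.card = p := by rwa [finrank_coordPlane] at hP
  rw [difference_eq hR b T hT, scalForm_eq_sum b hR]
  simp_rw [← ricForm_basis b hR, H, real_inner_self_eq_norm_sq, b.norm_eq_one]
  simp [hT]
  ring

/-- The trace of Ricci on coordinate `p`-planes is constant, so an exchange of indices makes all
diagonal Ricci entries equal, hence equal to the scalar curvature over `n`. Every unit vector
belongs to some orthonormal basis, and polarisation gives the whole bilinear form. -/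
theorem einstein_of_difference
    (hR : IsCurvatureLike fun x y z w => R ![x, y] ![z, w]) (hV : finrank ℝ V = n) {p : ℕ} (hp : 1 ≤ p) (hp' : p + 1 ≤ n)
    (c : ℝ) (H : ∀ P : Submodule ℝ V, finrank ℝ P = p →
      R.pCurvature p P - R.pCurvature (n - p) Pᗮ = c) :
    (∀ x y, ricForm R x y = scalForm R / n * inner ℝ x y) ∧
      c = (n - 2 * p) / (2 * n) * scalForm R := by
  have hn : (n : ℝ) ≠ 0 := by exact_mod_cast (by omega : n ≠ 0)
  have hb : ∀ (b : OrthonormalBasis (Fin n) ℝ V) (i : Fin n),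
      ricForm R (b i) (b i) = scalForm R / n := by
    intro b i
    have h1 : ∀ j, ricForm R (b j) (b j) = ricForm R (b i) (b i) := fun j =>
      SymmMatrix.eq_of_sum_const (p := p) hp (by simpa using hp') (fun i => ricForm R (b i) (b i))
        (scalForm R / 2 - c) (fun T hT => by
          have := H (coordPlane b T) (by rw [finrank_coordPlane, hT])
          rw [difference_eq hR b T hT] at this
          linarith) j i
    rw [scalForm_eq_sum b hR]
    simp_rw [← ricForm_basis b hR, h1]
    simp [hn]
  have hu : ∀ u : V, ‖u‖ = 1 → ricForm R u u = scalForm R / n := fun u hu => by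
    obtain ⟨b, i, rfl⟩ := exists_orthonormalBasis_mem hV hu
    exact hb b i
  have hdiag : ∀ x, ricForm R x x = scalForm R / n * inner ℝ x x := by
    intro x
    by_cases hx : x = 0
    · have := ricForm_smul hR 0 0 (0 : V)
      simp only [zero_smul, zero_mul] at this
      simp [hx, this]
    have hx' : ‖x‖ ≠ 0 := norm_ne_zero_iff.2 hx
    have := hu (‖x‖⁻¹ • x) (by rw [norm_smul]; simp [hx'])
    rw [ricForm_smul hR, ricForm_symm hR, ricForm_smul hR] at this
    rw [real_inner_self_eq_norm_sq, ← this]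
    field_simp
  refine ⟨fun x y => ?_, ?_⟩
  · have e := hdiag (x + y)
    rw [ricForm_add hR, ricForm_symm hR x, ricForm_symm hR y, ricForm_add hR, ricForm_add hR,
      hdiag, hdiag, ricForm_symm hR y x, inner_add_left, inner_add_right, inner_add_right,
      real_inner_comm x y] at e
    linarith
  · obtain ⟨b, -, -⟩ := exists_eq_coordPlane (ι := Fin n) (by simpa using hV) (⊤ : Submodule ℝ V)
    obtain ⟨T, -, hT⟩ := Finset.exists_subset_card_eq
      (show p ≤ (Finset.univ : Finset (Fin n)).card by simp; omega)
    rw [← H (coordPlane b T) (by rw [finrank_coordPlane, hT]), difference_eq hR b T hT]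
    simp_rw [hb]
    simp [hT]
    field_simp

theorem schouten_basis
    (hR : IsCurvatureLike fun x y z w => R ![x, y] ![z, w]) (b : OrthonormalBasis (Fin n) ℝ V) (i : Fin n) :
    SymmMatrix.schouten (secMatrix R b) i =
      ((n : ℝ) - 2)⁻¹ * (ricForm R (b i) (b i) - scalForm R / (2 * (n - 1))) := by
  rw [SymmMatrix.schouten, ricForm_basis b hR, scalForm_eq_sum b hR, Fintype.card_fin]

/-- The Schouten form of a curvature tensor. -/
def schoutenForm (R : DoubleForm V 2 2) (x y : V) : ℝ :=
  ((finrank ℝ V : ℝ) - 2)⁻¹ *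
    (ricForm R x y - scalForm R / (2 * ((finrank ℝ V : ℝ) - 1)) * inner ℝ x y)

/-- For `n = 2p` and equal weights, the first half of `row_differences` is the part that applies. By
`eq_schouten_add` it still gives `K_ij = A_i + A_j`, which is the sectional curvature of the
Kulkarni-Nomizu product on orthonormal pairs; two curvature tensors agreeing there are equal. -/
theorem eq_kulkarniNomizu_of_combination
    (hR : IsCurvatureLike fun x y z w => R ![x, y] ![z, w]) (hV : finrank ℝ V = n) {p : ℕ}
    (hp : 2 ≤ p) (hn : n = 2 * p) (c : ℝ) (H : ∀ P : Submodule ℝ V, finrank ℝ P = p →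
      R.pCurvature p P + R.pCurvature p Pᗮ = c) (x y z w : V) :
    R ![x, y] ![z, w] =
      inner ℝ x z * schoutenForm R y w + inner ℝ y w * schoutenForm R x z
      - inner ℝ x w * schoutenForm R y z - inner ℝ y z * schoutenForm R x w := by
  have hK := IsCurvatureLike.kulkarniNomizu (V := V) (schoutenForm R)
    (fun x x' y => by simp only [schoutenForm, ricForm_add hR, inner_add_left]; ring)
    (fun t x y => by simp only [schoutenForm, ricForm_smul hR, real_inner_smul_left]; ring)
    (fun x y => by simp only [schoutenForm, ricForm_symm hR x, real_inner_comm])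
  refine sub_eq_zero.1 ((hR.sub hK).eq_zero_of_orthonormal (fun u v hu hv huv => ?_) x y z w)
  obtain ⟨b, i, j, hij, rfl, rfl⟩ := exists_orthonormalBasis_pair hV hu hv huv
  have H' : ∀ T : Finset (Fin n), T.card = p → 1 * SymmMatrix.pairSum (secMatrix R b) T +
      1 * SymmMatrix.pairSum (secMatrix R b) Tᶜ = c := fun T hT => by
    rw [← combination_eq_pairSum 1 1 b T hT, ← H (coordPlane b T) (by rw [finrank_coordPlane, hT]),
      show n - p = p by omega]
    ring
  have e := SymmMatrix.eq_schouten_add (ι := Fin n) (h := secMatrix R b) (by rw [Fintype.card_fin]; omega)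
    (secMatrix_symm R b) (secMatrix_self R b) (fun i j k l hij hki hkj hli hlj =>
      (SymmMatrix.row_differences (ι := Fin n) hp (by rw [Fintype.card_fin]; omega) (secMatrix_symm R b)
        (secMatrix_self R b) 1 1 c (by norm_num) H' hij).1 k l hki hkj hli hlj) hij
  rw [schouten_basis hR, schouten_basis hR] at e
  have e' : R ![b i, b j] ![b i, b j] = _ := e
  simp only [e', huv, real_inner_comm (b i) (b j), real_inner_self_eq_norm_sq, hu, hv,
    schoutenForm, hV]
  ring

/-- With `K_ij = B_i + B_j`, the sum over the pairs in a `p`-element set is `p - 1` times the trace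
of `B` there. The two halves add up to `(p - 1) tr B`, while the scalar curvature is `2 (n - 1) tr
B`. -/
theorem combination_of_conformallyFlat
    (hR : IsCurvatureLike fun x y z w => R ![x, y] ![z, w]) (hV : finrank ℝ V = n) {p : ℕ} (hp : 2 ≤ p)
    (hn : n = 2 * p) (B : V → V → ℝ) (hB : ∀ x y z w, R ![x, y] ![z, w] =
      inner ℝ x z * B y w + inner ℝ y w * B x z - inner ℝ x w * B y z - inner ℝ y z * B x w)
    (P : Submodule ℝ V) (hP : finrank ℝ P = p) :
    R.pCurvature p P + R.pCurvature p Pᗮ = ((n : ℝ) - 2) / (4 * (n - 1)) * scalForm R := by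
  obtain ⟨b, T, rfl⟩ := exists_eq_coordPlane (ι := Fin n) (by simpa using hV) P
  have hT : T.card = p := by rwa [finrank_coordPlane] at hP
  have hc : ∀ i j, i ≠ j → secMatrix R b i j = B (b i) (b i) + B (b j) (b j) := by
    intro i j hij
    rw [secMatrix, hB, b.orthonormal.2 hij, b.orthonormal.2 hij.symm,
      real_inner_self_eq_norm_sq, real_inner_self_eq_norm_sq, b.norm_eq_one, b.norm_eq_one]
    ring
  have e1 := combination_eq_pairSum (R := R) 1 1 b T hT
  have e2 := SymmMatrix.pairSum_of_add (secMatrix_self R b) (fun i => B (b i) (b i)) hc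
  have e3 := e2 Finset.univ
  rw [SymmMatrix.pairSum, ← scalForm_eq_sum b hR] at e3
  rw [e2, e2, show n - p = p by omega, Finset.card_compl, hT, Fintype.card_fin,
    show n - p = p by omega] at e1
  rw [← Finset.sum_add_sum_compl T] at e3
  simp only [Finset.card_univ, Fintype.card_fin] at e3
  have hn' : (n : ℝ) = 2 * p := by rw [hn]; push_cast; ring
  have hp2 : (2 : ℝ) ≤ p := by exact_mod_cast hp
  have hs : scalForm R = 2 * ((n - 1) * (∑ i ∈ T, B (b i) (b i) + ∑ i ∈ Tᶜ, B (b i) (b i))) := by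
    linarith
  rw [hs, hn']
  have : (2 * (p : ℝ) - 1) ≠ 0 := by linarith
  field_simp
  linarith

end Pointwise

end DoubleForm

/-! ### The Levi-Civita connection in coordinates -/

namespace CoordMetric

set_option maxSynthPendingDepth 3

open Filter Topology

variable {E : Type*} [NormedAddCommGroup E] [NormedSpace ℝ E]

section Calculus

variable {F : Type*} [NormedAddCommGroup F] [NormedSpace ℝ F]

theorem hasFDerivAt_apply₂ {H : E → E →L[ℝ] E →L[ℝ] F} {p : E} {a b : E → E} {a' b' : E →L[ℝ] E}
    (hH : DifferentiableAt ℝ H p) (ha : HasFDerivAt a a' p) (hb : HasFDerivAt b b' p) :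
    ∃ L : E →L[ℝ] F, HasFDerivAt (fun q => H q (a q) (b q)) L p ∧
      ∀ s, L s = fderiv ℝ H p s (a p) (b p) + H p (a' s) (b p) + H p (a p) (b' s) := by
  refine ⟨_, (hH.hasFDerivAt.clm_apply ha).clm_apply hb, fun s => ?_⟩
  simp
  abel

theorem fderiv_apply₂ {H : E → E →L[ℝ] E →L[ℝ] F} {p : E} (hH : DifferentiableAt ℝ H p)
    (u v : E) (s : E) : fderiv ℝ (fun q => H q u v) p s = fderiv ℝ H p s u v := by
  obtain ⟨L, hL, hL'⟩ := hasFDerivAt_apply₂ hH (hasFDerivAt_const u p) (hasFDerivAt_const v p)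
  rw [hL.fderiv, hL']
  simp

end Calculus

/-- `G` is a smooth family of positive definite symmetric bilinear forms on the open set `U`. -/
structure IsMetricOn (G : E → E →L[ℝ] E →L[ℝ] ℝ) (U : Set E) : Prop where
  isOpen : IsOpen U
  contDiffOn : ContDiffOn ℝ ∞ G U
  symm : ∀ p u v, G p u v = G p v u
  pos : ∀ p ∈ U, ∀ v, v ≠ 0 → 0 < G p v v

namespace IsMetricOn

variable {G : E → E →L[ℝ] E →L[ℝ] ℝ} {U : Set E} (h : IsMetricOn G U) {p : E}

theorem contDiffAt (h : IsMetricOn G U) (hp : p ∈ U) : ContDiffAt ℝ ∞ G p :=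
  h.contDiffOn.contDiffAt (h.isOpen.mem_nhds hp)

theorem differentiableAt (h : IsMetricOn G U) (hp : p ∈ U) : DifferentiableAt ℝ G p :=
  (h.contDiffAt hp).differentiableAt (by simp)

theorem contDiffOn_fderiv (h : IsMetricOn G U) : ContDiffOn ℝ ∞ (fderiv ℝ G) U :=
  h.contDiffOn.fderiv_of_isOpen h.isOpen (by simp)

theorem ext_left (h : IsMetricOn G U) (hp : p ∈ U) {a b : E} (hab : ∀ w, G p a w = G p b w) :
    a = b := by
  by_contra hne
  have := h.pos p hp (a - b) (sub_ne_zero.2 hne)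
  rw [map_sub] at this
  simp [hab] at this

theorem fderiv_symm (h : IsMetricOn G U) (hp : p ∈ U) (s u v : E) :
    fderiv ℝ G p s u v = fderiv ℝ G p s v u := by
  rw [← fderiv_apply₂ (h.differentiableAt hp), ← fderiv_apply₂ (h.differentiableAt hp)]
  simp_rw [fun q => h.symm q u v]

theorem fderiv_fderiv_swap (h : IsMetricOn G U) (hp : p ∈ U) (a b u v : E) :
    fderiv ℝ (fderiv ℝ G) p a b u v = fderiv ℝ (fderiv ℝ G) p a b v u := by
  have hD : DifferentiableAt ℝ (fderiv ℝ G) p :=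
    (h.contDiffOn_fderiv.contDiffAt (h.isOpen.mem_nhds hp)).differentiableAt (by simp)
  have hd : ∀ b u v : E, HasFDerivAt (fun q => fderiv ℝ G q b u v)
      (((((fderiv ℝ (fderiv ℝ G) p).flip b).flip u)).flip v) p := by
    intro a b c
    have := ((hD.hasFDerivAt.clm_apply (hasFDerivAt_const a p)).clm_apply
      (hasFDerivAt_const b p)).clm_apply (hasFDerivAt_const c p)
    refine this.congr_fderiv ?_
    ext s; simp
  have heq : (fun q => fderiv ℝ G q b u v) =ᶠ[𝓝 p] fun q => fderiv ℝ G q b v u := by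
    filter_upwards [h.isOpen.mem_nhds hp] with q hq
    exact h.fderiv_symm hq b u v
  exact congrArg (fun l : E →L[ℝ] ℝ => l a) (((hd b u v).congr_of_eventuallyEq heq.symm).unique
    (hd b v u))

variable [FiniteDimensional ℝ E]

theorem isInvertible (h : IsMetricOn G U) (hp : p ∈ U) : (G p).IsInvertible := by
  have hinj : Function.Injective (G p).toLinearMap := fun a b hab =>
    h.ext_left hp fun w => congrArg (fun l : E →L[ℝ] ℝ => l w) hab
  have hdim : finrank ℝ E = finrank ℝ (E →L[ℝ] ℝ) := by
    rw [← (LinearMap.toContinuousLinearMap (𝕜 := ℝ) (E := E) (F' := ℝ)).finrank_eq]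
    exact (Subspace.dual_finrank_eq (K := ℝ) (V := E)).symm
  exact ⟨(LinearEquiv.ofInjectiveOfFinrankEq (G p).toLinearMap hinj hdim).toContinuousLinearEquiv,
    by ext; rfl⟩

theorem apply_inverse (h : IsMetricOn G U) (hp : p ∈ U) (l : E →L[ℝ] ℝ) :
    G p ((G p).inverse l) = l := by
  obtain ⟨e, he⟩ := h.isInvertible hp
  rw [← he, ContinuousLinearMap.inverse_equiv]
  exact e.apply_symm_apply l

theorem christoffel_spec (h : IsMetricOn G U) (hp : p ∈ U) (u v w : E) :
    G p (christoffel G p u v) w =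
      2⁻¹ * (fderiv ℝ G p u v w + fderiv ℝ G p v u w - fderiv ℝ G p w u v) := by
  rw [christoffel, h.apply_inverse hp, christoffelFirst]
  simp

theorem eq_christoffel (h : IsMetricOn G U) (hp : p ∈ U) {u v c : E}
    (hc : ∀ w, G p c w = 2⁻¹ * (fderiv ℝ G p u v w + fderiv ℝ G p v u w - fderiv ℝ G p w u v)) :
    christoffel G p u v = c :=
  h.ext_left hp fun w => by rw [h.christoffel_spec hp, hc]

theorem christoffel_symm (h : IsMetricOn G U) (hp : p ∈ U) (u v : E) :
    christoffel G p u v = christoffel G p v u :=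
  h.eq_christoffel hp fun w => by
    rw [h.christoffel_spec hp, h.fderiv_symm hp w u v]; ring

/-- The covariant derivative of the metric vanishes: in the sum of the two Koszul formulas only the
derivative in direction `s` survives. -/
theorem fderiv_eq (h : IsMetricOn G U) (hp : p ∈ U) (s u v : E) : fderiv ℝ G p s u v =
    G p (christoffel G p s u) v + G p u (christoffel G p s v) := by
  rw [h.symm p u, h.christoffel_spec hp, h.christoffel_spec hp, h.fderiv_symm hp v s u,
    h.fderiv_symm hp s v u, h.fderiv_symm hp u s v]
  ring

end IsMetricOn

variable [FiniteDimensional ℝ E]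

/-- The Christoffel symbols of the second kind as a family of bilinear maps. -/
def chr (G : E → E →L[ℝ] E →L[ℝ] ℝ) (p : E) : E →L[ℝ] E →L[ℝ] E :=
  LinearMap.toContinuousBilinearMap (LinearMap.mk₂ ℝ (christoffel G p)
    (christoffel_add_left G p) (christoffel_smul_left G p) (christoffel_add_right G p)
    (christoffel_smul_right G p))

theorem chr_apply (G : E → E →L[ℝ] E →L[ℝ] ℝ) (p u v : E) : chr G p u v = christoffel G p u v := rfl

/-- The curvature of the connection with Christoffel symbols `Γ`. -/
def curv (Γ : E → E →L[ℝ] E →L[ℝ] E) (p x y z : E) : E :=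
  fderiv ℝ Γ p x y z - fderiv ℝ Γ p y x z + Γ p x (Γ p y z) - Γ p y (Γ p x z)

namespace IsMetricOn

variable {G : E → E →L[ℝ] E →L[ℝ] ℝ} {U : Set E} {p : E}

theorem contDiffOn_inverse (h : IsMetricOn G U) : ContDiffOn ℝ ∞ (fun q => (G q).inverse) U := by
  intro q hq
  obtain ⟨e, he⟩ := h.isInvertible hq
  have h1 : ContDiffAt ℝ ∞ ContinuousLinearMap.inverse (e : E →L[ℝ] E →L[ℝ] ℝ) :=
    contDiffAt_map_inverse e
  rw [he] at h1
  exact (h1.comp q (h.contDiffAt hq)).contDiffWithinAt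

theorem contDiffOn_chr (h : IsMetricOn G U) : ContDiffOn ℝ ∞ (chr G) U := by
  refine contDiffOn_clm_apply.2 fun u => contDiffOn_clm_apply.2 fun v => ?_
  simp only [chr_apply]
  refine h.contDiffOn_inverse.clm_apply ?_
  have hD := h.contDiffOn_fderiv
  have hfl : ContDiffOn ℝ ∞ (fun q => (fderiv ℝ G q).flip) U :=
    (ContinuousLinearMap.flipₗᵢ ℝ E E (E →L[ℝ] ℝ)).contDiff.comp_contDiffOn hD
  have hfl2 : ContDiffOn ℝ ∞ (fun q => ((fderiv ℝ G q).flip u).flip) U :=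
    (ContinuousLinearMap.flipₗᵢ ℝ E E ℝ).contDiff.comp_contDiffOn
      (hfl.clm_apply contDiffOn_const)
  unfold christoffelFirst
  refine ContDiffOn.smul (𝕜' := ℝ) (f := fun _ => (2⁻¹ : ℝ)) contDiffOn_const ((((hD.clm_apply contDiffOn_const).clm_apply contDiffOn_const).add
    ((hD.clm_apply contDiffOn_const).clm_apply contDiffOn_const)).sub
    (hfl2.clm_apply contDiffOn_const))

theorem differentiableAt_chr (h : IsMetricOn G U) (hp : p ∈ U) : DifferentiableAt ℝ (chr G) p :=
  (h.contDiffOn_chr.contDiffAt (h.isOpen.mem_nhds hp)).differentiableAt (by simp)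

theorem chr_symm (h : IsMetricOn G U) (hp : p ∈ U) (u v : E) : chr G p u v = chr G p v u :=
  h.christoffel_symm hp u v

theorem compat (h : IsMetricOn G U) (hp : p ∈ U) (s u v : E) : fderiv ℝ G p s u v =
    G p (chr G p s u) v + G p u (chr G p s v) := h.fderiv_eq hp s u v

/-- The Koszul formula holds on an open set and may be differentiated. This trades derivatives of
the Christoffel symbols for second derivatives of the metric. -/
theorem fderiv_chr_spec (h : IsMetricOn G U) (hp : p ∈ U) (s u v w : E) :
    fderiv ℝ G p s (chr G p u v) w + G p (fderiv ℝ (chr G) p s u v) w =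
      2⁻¹ * (fderiv ℝ (fderiv ℝ G) p s u v w + fderiv ℝ (fderiv ℝ G) p s v u w
        - fderiv ℝ (fderiv ℝ G) p s w u v) := by
  have hD : DifferentiableAt ℝ (fderiv ℝ G) p :=
    (h.contDiffOn_fderiv.contDiffAt (h.isOpen.mem_nhds hp)).differentiableAt (by simp)
  obtain ⟨L1, hL1, hL1'⟩ := hasFDerivAt_apply₂ (h.differentiableAt_chr hp) (hasFDerivAt_const u p)
    (hasFDerivAt_const v p)
  obtain ⟨L, hL, hL'⟩ := hasFDerivAt_apply₂ (h.differentiableAt hp) hL1 (hasFDerivAt_const w p)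
  have hd : ∀ a b c : E, HasFDerivAt (fun q => fderiv ℝ G q a b c)
      (((((fderiv ℝ (fderiv ℝ G) p).flip a).flip b)).flip c) p := by
    intro a b c
    have := ((hD.hasFDerivAt.clm_apply (hasFDerivAt_const a p)).clm_apply
      (hasFDerivAt_const b p)).clm_apply (hasFDerivAt_const c p)
    refine this.congr_fderiv ?_
    ext s; simp
  have h2 := (((hd u v w).add (hd v u w)).sub (hd w u v)).const_mul (2⁻¹ : ℝ)
  have heq : (fun q => G q (chr G q u v) w) =ᶠ[𝓝 p] fun q =>
      2⁻¹ * (fderiv ℝ G q u v w + fderiv ℝ G q v u w - fderiv ℝ G q w u v) := by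
    filter_upwards [h.isOpen.mem_nhds hp] with q hq
    exact h.christoffel_spec hq u v w
  have := (hL.congr_of_eventuallyEq heq.symm).unique h2
  have e := congrArg (fun l : E →L[ℝ] ℝ => l s) this
  simp only [hL'] at e
  simp [hL1'] at e
  simpa using e

/-- The coordinate formula for the curvature tensor in terms of the curvature of the connection. -/
theorem riemannFun_eq (h : IsMetricOn G U) (hp : p ∈ U) (x y z w : E) :
    riemannFun G p x y z w = -G p (curv (chr G) p x y z) w := by
  have e1 := h.fderiv_chr_spec hp x y z w
  have e2 := h.fderiv_chr_spec hp y x z w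
  have hsymm : ∀ a b, fderiv ℝ (fderiv ℝ G) p a b = fderiv ℝ (fderiv ℝ G) p b a := fun a b =>
    ((h.contDiffAt hp).isSymmSndFDerivAt (by simpa using (mod_cast le_top : ((2 : ℕ∞) : WithTop ℕ∞) ≤ ∞))) a b
  have hs2 := fun a b u v => h.fderiv_fderiv_swap hp a b u v
  -- Compatibility splits the derivative of `G` into the term `G (Γ Γ, w)` of the curvature of the
  -- connection and the quadratic term `G (Γ, Γ)` of the coordinate formula.
  rw [h.compat hp] at e1 e2
  rw [riemannFun, curv, map_sub, map_add, map_sub]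
  simp only [← chr_apply, sub_apply, add_apply]
  have a1 := hsymm x y
  rw [a1] at e1
  have a2 := hsymm x w
  have a3 := h.symm p (chr G p x w) (chr G p y z)
  have a4 := hs2 y z x w
  have a5 := hs2 x w y z
  have a6 := hs2 x z y w
  have a7 := hs2 y w x z
  linarith

end IsMetricOn

end CoordMetric

/-! ### The second Bianchi identity and changes of coordinates -/

namespace CoordMetric

set_option maxSynthPendingDepth 3

open Filter Topology

variable {E : Type*} [NormedAddCommGroup E] [NormedSpace ℝ E]

theorem two_le_infty : (2 : WithTop ℕ∞) ≤ ∞ :=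
  (mod_cast le_top : ((2 : ℕ∞) : WithTop ℕ∞) ≤ ∞)

theorem contDiffAt_fderiv {F : Type*} [NormedAddCommGroup F] [NormedSpace ℝ F] {f : E → F}
    {p : E} (hf : ContDiffAt ℝ ∞ f p) : ContDiffAt ℝ ∞ (fderiv ℝ f) p :=
  hf.fderiv_right (by simp)

theorem fderiv_fderiv_symm {F : Type*} [NormedAddCommGroup F] [NormedSpace ℝ F] {f : E → F}
    {p : E} (hf : ContDiffAt ℝ ∞ f p) (a b : E) :
    fderiv ℝ (fderiv ℝ f) p a b = fderiv ℝ (fderiv ℝ f) p b a :=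
  (hf.isSymmSndFDerivAt (by simpa using two_le_infty)) a b

section Bianchi

variable {Γ : E → E →L[ℝ] E →L[ℝ] E} {p : E}

theorem hasFDerivAt_curv (hΓ : ContDiffAt ℝ ∞ Γ p) (x y z : E) :
    ∃ L : E →L[ℝ] E, HasFDerivAt (fun q => curv Γ q x y z) L p ∧ ∀ a, L a =
      fderiv ℝ (fderiv ℝ Γ) p a x y z - fderiv ℝ (fderiv ℝ Γ) p a y x z
      + (fderiv ℝ Γ p a x (Γ p y z) + Γ p x (fderiv ℝ Γ p a y z))
      - (fderiv ℝ Γ p a y (Γ p x z) + Γ p y (fderiv ℝ Γ p a x z)) := by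
  have hd := hΓ.differentiableAt (by simp)
  have hD := (contDiffAt_fderiv hΓ).differentiableAt (by simp)
  have h1 : ∀ u v, HasFDerivAt (fun q => fderiv ℝ Γ q u v z) _ p := fun u v =>
    ((hD.hasFDerivAt.clm_apply (hasFDerivAt_const u p)).clm_apply
      (hasFDerivAt_const v p)).clm_apply (hasFDerivAt_const z p)
  have h2 : ∀ u v, HasFDerivAt (fun q => Γ q u (Γ q v z)) _ p := fun u v =>
    (hd.hasFDerivAt.clm_apply (hasFDerivAt_const u p)).clm_apply
      ((hd.hasFDerivAt.clm_apply (hasFDerivAt_const v p)).clm_apply (hasFDerivAt_const z p))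
  refine ⟨_, (((h1 x y).sub (h1 y x)).add (h2 x y)).sub (h2 y x), fun a => ?_⟩
  simp
  abel

/-- The second Bianchi identity for the curvature of a connection. -/
theorem second_bianchi (hΓ : ContDiffAt ℝ ∞ Γ p) (a x y z : E) :
    (fderiv ℝ (fun q => curv Γ q x y z) p a + Γ p a (curv Γ p x y z) - curv Γ p x y (Γ p a z)) +
    (fderiv ℝ (fun q => curv Γ q y a z) p x + Γ p x (curv Γ p y a z) - curv Γ p y a (Γ p x z)) +
    (fderiv ℝ (fun q => curv Γ q a x z) p y + Γ p y (curv Γ p a x z) - curv Γ p a x (Γ p y z))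
      = 0 := by
  have key : ∀ x y a, fderiv ℝ (fun q => curv Γ q x y z) p a = _ := fun x y a => by
    obtain ⟨L, hL, hL'⟩ := hasFDerivAt_curv hΓ x y z
    rw [hL.fderiv, hL']
  rw [key, key, key]
  simp only [curv, map_add, map_sub]
  -- The second derivatives cancel in pairs, as do the quadratic and cubic terms. Symmetry of `Γ` is
  -- not needed, since corrections in the two-form arguments have been left out.
  rw [fderiv_fderiv_symm hΓ x a, fderiv_fderiv_symm hΓ y a, fderiv_fderiv_symm hΓ y x]
  abel

end Bianchi

section ChangeOfCoordinates

variable [FiniteDimensional ℝ E] {G G' : E → E →L[ℝ] E →L[ℝ] ℝ} {U W : Set E} {ψ : E → E} {p : E}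

/-- The inhomogeneous transformation law. Since `G'` is positive definite, the derivative of `ψ` is
injective and hence surjective, so it suffices to pair with vectors in its image and to compare the
two Koszul formulas. -/
theorem christoffel_change (h : IsMetricOn G U) (h' : IsMetricOn G' W) (hψ : ContDiffOn ℝ ∞ ψ W)
    (hmaps : ∀ q ∈ W, ψ q ∈ U)
    (hG : ∀ q ∈ W, ∀ u v, G' q u v = G (ψ q) (fderiv ℝ ψ q u) (fderiv ℝ ψ q v))
    (hp : p ∈ W) (u v : E) : fderiv ℝ ψ p (chr G' p u v) =
      chr G (ψ p) (fderiv ℝ ψ p u) (fderiv ℝ ψ p v) + fderiv ℝ (fderiv ℝ ψ) p u v := by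
  have hψp : ContDiffAt ℝ ∞ ψ p := hψ.contDiffAt (h'.isOpen.mem_nhds hp)
  have hψd := hψp.differentiableAt (by simp)
  have hDψ := (contDiffAt_fderiv hψp).differentiableAt (by simp)
  have hder : ∀ s u v, fderiv ℝ G' p s u v =
      fderiv ℝ G (ψ p) (fderiv ℝ ψ p s) (fderiv ℝ ψ p u) (fderiv ℝ ψ p v)
      + G (ψ p) (fderiv ℝ (fderiv ℝ ψ) p s u) (fderiv ℝ ψ p v)
      + G (ψ p) (fderiv ℝ ψ p u) (fderiv ℝ (fderiv ℝ ψ) p s v) := by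
    intro s u v
    have e1 : (fun q => G' q u v) =ᶠ[𝓝 p] fun q => G (ψ q) (fderiv ℝ ψ q u) (fderiv ℝ ψ q v) := by
      filter_upwards [h'.isOpen.mem_nhds hp] with q hq using hG q hq u v
    have hGψ : HasFDerivAt (fun q => G (ψ q)) _ p :=
      (h.differentiableAt (hmaps p hp)).hasFDerivAt.comp p hψd.hasFDerivAt
    have h3 := (hGψ.clm_apply (hDψ.hasFDerivAt.clm_apply (hasFDerivAt_const u p))).clm_apply
      (hDψ.hasFDerivAt.clm_apply (hasFDerivAt_const v p))
    rw [← fderiv_apply₂ (h'.differentiableAt hp), e1.fderiv_eq, h3.fderiv]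
    simp
    ring
  have hinj : Function.Injective (fderiv ℝ ψ p).toLinearMap := by
    rw [injective_iff_map_eq_zero]
    intro a ha
    by_contra hne
    have := h'.pos p hp a hne
    rw [hG p hp] at this
    change fderiv ℝ ψ p a = 0 at ha
    simp [ha] at this
  have hsurj := LinearMap.surjective_of_injective hinj
  refine h.ext_left (hmaps p hp) fun w => ?_
  obtain ⟨w, rfl⟩ := hsurj w
  change G (ψ p) _ (fderiv ℝ ψ p w) = G (ψ p) _ (fderiv ℝ ψ p w)
  rw [← hG p hp, chr_apply, h'.christoffel_spec hp, hder, hder, hder, map_add, add_apply, chr_apply,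
    h.christoffel_spec (hmaps p hp)]
  rw [fderiv_fderiv_symm hψp w u, fderiv_fderiv_symm hψp w v, fderiv_fderiv_symm hψp v u,
    h.symm (ψ p) (fderiv ℝ ψ p v), h.symm (ψ p) (fderiv ℝ ψ p u)
      (fderiv ℝ (fderiv ℝ ψ) p v w)]
  ring

/-- Differentiate the law for the Christoffel symbols and skew-symmetrise. The third derivatives of
`ψ` cancel by symmetry, and the second derivatives cancel against those produced by the quadratic
terms of the curvature. -/
theorem curv_change (h : IsMetricOn G U) (h' : IsMetricOn G' W) (hψ : ContDiffOn ℝ ∞ ψ W)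
    (hmaps : ∀ q ∈ W, ψ q ∈ U)
    (hG : ∀ q ∈ W, ∀ u v, G' q u v = G (ψ q) (fderiv ℝ ψ q u) (fderiv ℝ ψ q v))
    (hp : p ∈ W) (x y z : E) : fderiv ℝ ψ p (curv (chr G') p x y z) =
      curv (chr G) (ψ p) (fderiv ℝ ψ p x) (fderiv ℝ ψ p y) (fderiv ℝ ψ p z) := by
  have hψp : ContDiffAt ℝ ∞ ψ p := hψ.contDiffAt (h'.isOpen.mem_nhds hp)
  have hψd := hψp.differentiableAt (by simp)
  have hDψ := (contDiffAt_fderiv hψp).differentiableAt (by simp)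
  have hDDψ := (contDiffAt_fderiv (contDiffAt_fderiv hψp)).differentiableAt (by simp)
  have hc := fun {q : E} (hq : q ∈ W) => christoffel_change h h' hψ hmaps hG hq
  have hder : ∀ s u v, fderiv ℝ (fderiv ℝ ψ) p s (chr G' p u v) +
      fderiv ℝ ψ p (fderiv ℝ (chr G') p s u v) =
      fderiv ℝ (chr G) (ψ p) (fderiv ℝ ψ p s) (fderiv ℝ ψ p u) (fderiv ℝ ψ p v) +
      chr G (ψ p) (fderiv ℝ (fderiv ℝ ψ) p s u) (fderiv ℝ ψ p v) +
      chr G (ψ p) (fderiv ℝ ψ p u) (fderiv ℝ (fderiv ℝ ψ) p s v) +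
      fderiv ℝ (fderiv ℝ (fderiv ℝ ψ)) p s u v := by
    intro s u v
    have e1 : (fun q => fderiv ℝ ψ q (chr G' q u v)) =ᶠ[𝓝 p] fun q =>
        chr G (ψ q) (fderiv ℝ ψ q u) (fderiv ℝ ψ q v) + fderiv ℝ (fderiv ℝ ψ) q u v := by
      filter_upwards [h'.isOpen.mem_nhds hp] with q hq using hc hq u v
    have h1 := hDψ.hasFDerivAt.clm_apply (((h'.differentiableAt_chr hp).hasFDerivAt.clm_apply
      (hasFDerivAt_const u p)).clm_apply (hasFDerivAt_const v p))
    have hΓψ : HasFDerivAt (fun q => chr G (ψ q)) _ p :=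
      (h.differentiableAt_chr (hmaps p hp)).hasFDerivAt.comp p hψd.hasFDerivAt
    have h2 := ((hΓψ.clm_apply (hDψ.hasFDerivAt.clm_apply (hasFDerivAt_const u p))).clm_apply
      (hDψ.hasFDerivAt.clm_apply (hasFDerivAt_const v p))).add
      ((hDDψ.hasFDerivAt.clm_apply (hasFDerivAt_const u p)).clm_apply (hasFDerivAt_const v p))
    have := congrArg (fun l : E →L[ℝ] E => l s)
      ((h1.congr_of_eventuallyEq e1.symm).unique h2)
    simp at this
    rw [add_comm, this]
    abel
  have d1 := hder x y z
  have d2 := hder y x z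
  have c1 := hc hp x (chr G' p y z)
  have c2 := hc hp y (chr G' p x z)
  rw [hc hp y z, map_add] at c1
  rw [hc hp x z, map_add] at c2
  have hT : fderiv ℝ (fderiv ℝ (fderiv ℝ ψ)) p x y = fderiv ℝ (fderiv ℝ (fderiv ℝ ψ)) p y x :=
    fderiv_fderiv_symm (contDiffAt_fderiv hψp) x y
  rw [hT] at d1
  rw [fderiv_fderiv_symm hψp y x] at d2
  simp only [curv, map_sub, map_add]
  rw [c1, c2]
  linear_combination (norm := module) d1 - d2

theorem riemannFun_change (h : IsMetricOn G U) (h' : IsMetricOn G' W) (hψ : ContDiffOn ℝ ∞ ψ W)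
    (hmaps : ∀ q ∈ W, ψ q ∈ U)
    (hG : ∀ q ∈ W, ∀ u v, G' q u v = G (ψ q) (fderiv ℝ ψ q u) (fderiv ℝ ψ q v))
    (hp : p ∈ W) (x y z w : E) : riemannFun G' p x y z w =
      riemannFun G (ψ p) (fderiv ℝ ψ p x) (fderiv ℝ ψ p y) (fderiv ℝ ψ p z) (fderiv ℝ ψ p w) := by
  rw [h'.riemannFun_eq hp, h.riemannFun_eq (hmaps p hp), hG p hp,
    curv_change h h' hψ hmaps hG hp]

end ChangeOfCoordinates

end CoordMetric

/-! ### Curvature under a conformal change -/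

namespace CoordMetric

set_option maxSynthPendingDepth 3

open Filter Topology

variable {E : Type*} [NormedAddCommGroup E] [NormedSpace ℝ E] [FiniteDimensional ℝ E]

/-- The Kulkarni-Nomizu product of the metric `g` and of the bilinear form `g (S ·, ·)`, as an
operator. -/
def knOp (g : E →L[ℝ] E →L[ℝ] ℝ) (S : E → E) (x y z : E) : E :=
  g (S y) z • x + g y z • S x - g (S x) z • y - g x z • S y

section Conformal

variable {G : E → E →L[ℝ] E →L[ℝ] ℝ} {U : Set E} {p : E} {f : E → ℝ} {X : E → E}

/-- Here `X` is the gradient of `f`. The right-hand side satisfies the Koszul formula of `exp (2 f)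
G`, which has only one solution. -/
theorem christoffel_conformal (h : IsMetricOn G U) {G' : E → E →L[ℝ] E →L[ℝ] ℝ}
    (h' : IsMetricOn G' U) (hG' : ∀ q ∈ U, G' q = Real.exp (2 * f q) • G q) (hp : p ∈ U)
    (hf : HasFDerivAt f (G p (X p)) p) (u v : E) :
    chr G' p u v = chr G p u v + G p (X p) u • v + G p (X p) v • u - G p u v • X p := by
  have hder : ∀ s u v, fderiv ℝ G' p s u v = Real.exp (2 * f p) *
      (fderiv ℝ G p s u v + 2 * G p (X p) s * G p u v) := by
    intro s u v
    have e1 : G' =ᶠ[𝓝 p] fun q => Real.exp (2 * f q) • G q := by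
      filter_upwards [h.isOpen.mem_nhds hp] with q hq using hG' q hq
    have h1 : HasFDerivAt (fun q => Real.exp (2 * f q) • G q) _ p :=
      ((hf.const_mul 2).exp).smul (h.differentiableAt hp).hasFDerivAt
    rw [e1.fderiv_eq, h1.fderiv]
    simp
    ring
  refine h'.eq_christoffel hp fun w => ?_
  rw [hder, hder, hder, hG' p hp]
  simp only [map_add, map_sub, map_smul, add_apply, sub_apply, smul_apply, smul_eq_mul, chr_apply,
    h.christoffel_spec hp]
  ring

theorem fderiv_gradient (h : IsMetricOn G U) (hp : p ∈ U) (hX : DifferentiableAt ℝ X p) (y x : E) :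
    fderiv ℝ (fun q => G q (X q) y) p x =
      G p (X p) (chr G p x y) + G p (fderiv ℝ X p x + chr G p x (X p)) y := by
  obtain ⟨L, hL, hL'⟩ := hasFDerivAt_apply₂ (h.differentiableAt hp) hX.hasFDerivAt
    (hasFDerivAt_const y p)
  rw [hL.fderiv, hL', h.compat hp]
  simp
  ring

/-- The tensor `S` is `∇X - X ⊗ X + |X|²/2`, an index being raised by `G`. The conformal metric is
therefore flat where the old curvature is the Kulkarni-Nomizu product with `S`: flattening is a
first-order equation for `X`. -/
theorem curv_conformal (h : IsMetricOn G U) {Γ' : E → E →L[ℝ] E →L[ℝ] E} (hp : p ∈ U)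
    (hΓ' : ∀ q ∈ U, ∀ u v, Γ' q u v =
      chr G q u v + G q (X q) u • v + G q (X q) v • u - G q u v • X q)
    (hΓ'd : DifferentiableAt ℝ Γ' p) (hX : DifferentiableAt ℝ X p)
    (S : E → E) (hS : ∀ x, fderiv ℝ X p x + chr G p x (X p) =
      S x + G p (X p) x • X p - ((2⁻¹ : ℝ) * G p (X p) (X p)) • x)
    (hsymm : ∀ x y, G p (S x) y = G p (S y) x) (x y z : E) :
    curv Γ' p x y z = curv (chr G) p x y z - knOp (G p) S x y z := by
  have hder : ∀ x y z, fderiv ℝ Γ' p x y z = fderiv ℝ (chr G) p x y z +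
      fderiv ℝ (fun q => G q (X q) y) p x • z + fderiv ℝ (fun q => G q (X q) z) p x • y
      - (fderiv ℝ G p x y z • X p + G p y z • fderiv ℝ X p x) := by
    intro x y z
    have e1 : (fun q => Γ' q y z) =ᶠ[𝓝 p] fun q =>
        chr G q y z + G q (X q) y • z + G q (X q) z • y - G q y z • X q := by
      filter_upwards [h.isOpen.mem_nhds hp] with q hq using hΓ' q hq y z
    have hGX : ∀ y, DifferentiableAt ℝ (fun q => G q (X q) y) p := fun y =>
      ((h.differentiableAt hp).clm_apply hX).clm_apply (differentiableAt_const y)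
    have h1 := (((((h.differentiableAt_chr hp).hasFDerivAt.clm_apply
      (hasFDerivAt_const y p)).clm_apply (hasFDerivAt_const z p)).add
      ((hGX y).hasFDerivAt.smul_const z)).add ((hGX z).hasFDerivAt.smul_const y)).sub
      ((((h.differentiableAt hp).hasFDerivAt.clm_apply (hasFDerivAt_const y p)).clm_apply
      (hasFDerivAt_const z p)).smul hX.hasFDerivAt)
    rw [← fderiv_apply₂ hΓ'd, e1.fderiv_eq]
    refine (congrArg (fun l : E →L[ℝ] E => l x) h1.fderiv).trans ?_
    simp
    abel
  have hX1 : ∀ x, fderiv ℝ X p x = S x + G p (X p) x • X p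
      - ((2⁻¹ : ℝ) * G p (X p) (X p)) • x - chr G p x (X p) := fun x => by
    rw [← hS]; abel
  rw [curv, hder, hder, curv, knOp]
  simp only [fderiv_gradient h hp hX, h.compat hp, hX1]
  simp only [hΓ' p hp]
  rw [h.chr_symm hp y x]
  simp only [map_add, map_sub, map_smul, add_apply, sub_apply, smul_apply, smul_eq_mul]
  have s1 := hsymm y x
  have s2 := h.symm p y x
  have s3 := h.symm p x (X p)
  have s4 := h.symm p y (X p)
  have s5 := h.symm p (chr G p x y) z
  have s6 := h.symm p x (chr G p y z)
  have s7 := h.symm p y (chr G p x z)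
  rw [h.chr_symm hp y x]
  linear_combination (norm := module) (-s1 + ((2⁻¹ : ℝ) * G p (X p) (X p)) * s2) • z +
    (G p y z * s3 - G p x z * s4 + G p (X p) z * s2) • X p

end Conformal

end CoordMetric

/-! ### The Cotton tensor and integrability -/

namespace CoordMetric

set_option maxSynthPendingDepth 3

open Filter Topology

variable {E : Type*} [NormedAddCommGroup E] [NormedSpace ℝ E] [FiniteDimensional ℝ E]

section Cotton

/-- A positive definite symmetric bilinear form has an orthonormal basis. -/
theorem exists_orthonormal_basis (g : E →L[ℝ] E →L[ℝ] ℝ) (hs : ∀ u v, g u v = g v u)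
    (hpos : ∀ v, v ≠ 0 → 0 < g v v) : ∃ e : Basis (Fin (finrank ℝ E)) ℝ E,
      (∀ i, g (e i) (e i) = 1) ∧ ∀ i j, i ≠ j → g (e i) (e j) = 0 := by
  let B : LinearMap.BilinForm ℝ E := LinearMap.mk₂ ℝ (fun u v => g u v) (fun _ _ _ => by simp)
    (fun _ _ _ => by simp) (fun _ _ _ => by simp) (fun _ _ _ => by simp)
  obtain ⟨v, hv⟩ := LinearMap.BilinForm.exists_orthogonal_basis (B := B) ⟨fun u v => hs u v⟩
  have hp : ∀ i, 0 < g (v i) (v i) := fun i => hpos _ (v.ne_zero i)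
  have hsq : ∀ i, Real.sqrt (g (v i) (v i)) ≠ 0 := fun i => (Real.sqrt_pos.2 (hp i)).ne'
  refine ⟨v.unitsSMul fun i => Units.mk0 _ (inv_ne_zero (hsq i)), fun i => ?_, fun i j hij => ?_⟩
  · rw [Basis.unitsSMul_apply, Units.smul_mk0, map_smul, map_smul, smul_apply, smul_eq_mul,
      smul_eq_mul, ← mul_assoc, ← mul_inv, Real.mul_self_sqrt (hp i).le, inv_mul_cancel₀ (hp i).ne']
  · have : g (v i) (v j) = 0 := hv hij
    rw [Basis.unitsSMul_apply, Basis.unitsSMul_apply, Units.smul_mk0, Units.smul_mk0, map_smul,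
      map_smul, smul_apply, this]
    simp

theorem repr_orthonormal {E : Type*} [NormedAddCommGroup E] [NormedSpace ℝ E] {g : E →L[ℝ] E →L[ℝ] ℝ} {n : ℕ} {e : Basis (Fin n) ℝ E}
    (h1 : ∀ i, g (e i) (e i) = 1) (h0 : ∀ i j, i ≠ j → g (e i) (e j) = 0) (u : E) (j : Fin n) :
    g u (e j) = e.repr u j := by
  conv_lhs => rw [← e.sum_repr u]
  rw [map_sum, sum_apply, Finset.sum_eq_single j]
  · simp [h1]
  · intro i _ hij; simp [h0 i j hij]
  · simp

/-- Put `y = z = e_k` with `k` different from `i`, `j`. Pairing with a further `e_l` kills the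
components with three distinct indices. Pairing with `e_i` shows that `g (C (e_i, e_j), e_i)`
changes sign when `i` is replaced by `k`; three indices besides `j` then force it to vanish. Both
arguments use dimension four. -/
theorem eq_zero_of_cyclic_identity (hE : 4 ≤ finrank ℝ E) (g : E →L[ℝ] E →L[ℝ] ℝ)
    (hs : ∀ u v, g u v = g v u) (hpos : ∀ v, v ≠ 0 → 0 < g v v) (C : E →ₗ[ℝ] E →ₗ[ℝ] E)
    (hC : ∀ a x, C a x = -C x a)
    (H : ∀ a x y z, g (C a y) z • x + g (C x a) z • y + g (C y x) z • a + g y z • C a x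
      + g a z • C x y + g x z • C y a = 0) : C = 0 := by
  obtain ⟨e, h1, h0⟩ := exists_orthonormal_basis g hs hpos
  have hex : ∀ T : Finset (Fin (finrank ℝ E)), T.card ≤ 3 → ∃ k, k ∉ T := by
    intro T hT
    by_contra! hcon
    have := Finset.card_le_card (fun k _ => hcon k : Finset.univ ⊆ T)
    simp at this
    omega
  have hA : ∀ i j l, i ≠ j → l ≠ i → l ≠ j → g (C (e i) (e j)) (e l) = 0 := by
    intro i j l hij hli hlj
    obtain ⟨k, hk⟩ := hex {i, j, l} Finset.card_le_three
    simp only [Finset.mem_insert, Finset.mem_singleton, not_or] at hk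
    have := congrArg (fun u => g u (e l)) (H (e i) (e j) (e k) (e k))
    simpa [h1, h0 j l hlj.symm, h0 k l hk.2.2, h0 i l hli.symm, h0 i k (Ne.symm hk.1),
      h0 j k (Ne.symm hk.2.1)] using this
  have hT : ∀ i j k, i ≠ j → k ≠ i → k ≠ j →
      g (C (e k) (e j)) (e k) + g (C (e i) (e j)) (e i) = 0 := by
    intro i j k hij hki hkj
    have := congrArg (fun u => g u (e i)) (H (e i) (e j) (e k) (e k))
    simpa [h1, h0 j i hij.symm, h0 k i hki, h0 i k hki.symm, h0 j k hkj.symm] using this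
  have hD : ∀ i j, i ≠ j → g (C (e i) (e j)) (e i) = 0 := by
    intro i j hij
    obtain ⟨k, hk⟩ := hex {i, j} (Finset.card_le_two.trans (by norm_num))
    simp only [Finset.mem_insert, Finset.mem_singleton, not_or] at hk
    obtain ⟨l, hl⟩ := hex {i, j, k} Finset.card_le_three
    simp only [Finset.mem_insert, Finset.mem_singleton, not_or] at hl
    have e1 := hT i j k hij hk.1 hk.2
    have e2 := hT i j l hij hl.1 hl.2.1
    have e3 := hT k j l hk.2 hl.2.2 hl.2.1
    linarith
  refine e.ext fun i => e.ext fun j => ?_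
  rw [LinearMap.zero_apply, LinearMap.zero_apply]
  by_cases hij : i = j
  · subst hij
    have := hC (e i) (e i)
    rw [eq_neg_iff_add_eq_zero, ← two_smul ℝ] at this
    simpa using this
  · refine e.ext_elem fun l => ?_
    rw [← repr_orthonormal h1 h0, map_zero, Finsupp.coe_zero, Pi.zero_apply]
    by_cases hli : l = i
    · rw [hli]; exact hD i j hij
    by_cases hlj : l = j
    · rw [hlj, hC, map_neg, neg_apply, hD j i (Ne.symm hij), neg_zero]
    exact hA i j l hij hli hlj

variable {G : E → E →L[ℝ] E →L[ℝ] ℝ} {U : Set E} {p : E} {S : E → E →L[ℝ] E}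

/-- The Cotton tensor of a metric of dimension at least four vanishes, if its Weyl tensor does. -/
theorem cotton_eq_zero (h : IsMetricOn G U) (hE : 4 ≤ finrank ℝ E) (hS : ContDiffOn ℝ ∞ S U)
    (hcurv : ∀ q ∈ U, ∀ x y z, curv (chr G) q x y z = knOp (G q) (S q) x y z)
    (hp : p ∈ U) (a x : E) :
    fderiv ℝ S p a x + chr G p a (S p x) = fderiv ℝ S p x a + chr G p x (S p a) := by
  have hSd : DifferentiableAt ℝ S p :=
    (hS.contDiffAt (h.isOpen.mem_nhds hp)).differentiableAt (by simp)
  have hΓ : ContDiffAt ℝ ∞ (chr G) p := h.contDiffOn_chr.contDiffAt (h.isOpen.mem_nhds hp)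
  have hder : ∀ a x y z, fderiv ℝ (fun q => curv (chr G) q x y z) p a =
      (fderiv ℝ G p a (S p y) z + G p (fderiv ℝ S p a y) z) • x
      + fderiv ℝ G p a y z • S p x + G p y z • fderiv ℝ S p a x
      - (fderiv ℝ G p a (S p x) z + G p (fderiv ℝ S p a x) z) • y
      - fderiv ℝ G p a x z • S p y - G p x z • fderiv ℝ S p a y := by
    intro a x y z
    have e1 : (fun q => curv (chr G) q x y z) =ᶠ[𝓝 p] fun q =>
        G q (S q y) z • x + G q y z • S q x - G q (S q x) z • y - G q x z • S q y := by
      filter_upwards [h.isOpen.mem_nhds hp] with q hq using hcurv q hq x y z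
    have hG := (h.differentiableAt hp).hasFDerivAt
    have hSa : ∀ x, HasFDerivAt (fun q => S q x) _ p := fun x =>
      hSd.hasFDerivAt.clm_apply (hasFDerivAt_const x p)
    have h1 : ∀ x, HasFDerivAt (fun q => G q (S q x) z) _ p := fun x =>
      (hG.clm_apply (hSa x)).clm_apply (hasFDerivAt_const z p)
    have h2 : ∀ x, HasFDerivAt (fun q => G q x z) _ p := fun x =>
      (hG.clm_apply (hasFDerivAt_const x p)).clm_apply (hasFDerivAt_const z p)
    have h3 := ((((h1 y).smul_const x).add ((h2 y).smul (hSa x))).sub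
      ((h1 x).smul_const y)).sub ((h2 x).smul (hSa y))
    rw [e1.fderiv_eq]
    refine (congrArg (fun l : E →L[ℝ] E => l a) h3.fderiv).trans ?_
    simp
    module
  -- The skew-symmetrised covariant derivative of `S`; the terms `S (Γ (a, x))` are absent because
  -- `Γ` is symmetric.
  let C : E →ₗ[ℝ] E →ₗ[ℝ] E := LinearMap.mk₂ ℝ (fun a x => fderiv ℝ S p a x + chr G p a (S p x)
      - (fderiv ℝ S p x a + chr G p x (S p a)))
    (fun _ _ _ => by simp only [map_add, add_apply]; abel)
    (fun _ _ _ => by simp only [map_smul, smul_apply, smul_add, smul_sub])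
    (fun _ _ _ => by simp only [map_add, add_apply]; abel)
    (fun _ _ _ => by simp only [map_smul, smul_apply, smul_add, smul_sub])
  have hC : ∀ a x, C a x = fderiv ℝ S p a x + chr G p a (S p x)
      - (fderiv ℝ S p x a + chr G p x (S p a)) := fun _ _ => rfl
  have key := eq_zero_of_cyclic_identity hE (G p) (h.symm p) (h.pos p hp) C
    (fun a x => by rw [hC, hC]; abel) (fun a x y z => by
      have b := second_bianchi hΓ a x y z
      rw [hder, hder, hder] at b
      simp only [hcurv p hp, knOp, h.compat hp, map_add, map_sub, map_smul] at b
      rw [h.chr_symm hp y a, h.chr_symm hp x a, h.chr_symm hp y x] at b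
      rw [← b]
      simp only [hC, map_add, map_sub, add_apply, sub_apply]
      module)
  have := LinearMap.congr_fun₂ key a x
  rw [hC] at this
  exact sub_eq_zero.1 this

/-- The integrability condition of the equation for the gradient of the conformal factor. -/
theorem integrability (h : IsMetricOn G U)
    (hcurv : ∀ q ∈ U, ∀ x y z, curv (chr G) q x y z = knOp (G q) (S q) x y z)
    (hp : p ∈ U) (hSs : ∀ x y, G p (S p x) y = G p (S p y) x)
    (hcotton : ∀ a x, fderiv ℝ S p a x + chr G p a (S p x) =
      fderiv ℝ S p x a + chr G p x (S p a)) (X : E) (Φ : E → E)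
    (hΦ : ∀ u, Φ u = -chr G p u X + S p u + G p X u • X - ((2⁻¹ : ℝ) * G p X X) • u) (a u : E) :
    (-fderiv ℝ (chr G) p a u X + fderiv ℝ S p a u + fderiv ℝ G p a X u • X
        - ((2⁻¹ : ℝ) * fderiv ℝ G p a X X) • u)
      + (-chr G p u (Φ a) + G p (Φ a) u • X + G p X u • Φ a - G p X (Φ a) • u) =
    (-fderiv ℝ (chr G) p u a X + fderiv ℝ S p u a + fderiv ℝ G p u X a • X
        - ((2⁻¹ : ℝ) * fderiv ℝ G p u X X) • a)
      + (-chr G p a (Φ u) + G p (Φ u) a • X + G p X a • Φ u - G p X (Φ u) • a) := by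
  have c := hcurv p hp a u X
  rw [curv, knOp] at c
  have d := hcotton a u
  have s1 := hSs a u
  have s2 := h.symm p a u
  have s3 := congrArg (G p X) (h.chr_symm hp a u)
  have s4 : ∀ a, G p (chr G p a X) X = G p X (chr G p a X) := fun a => h.symm p _ _
  have s5 : ∀ a, G p (S p a) X = G p X (S p a) := fun a => h.symm p _ _
  simp only [hΦ, h.compat hp, map_add, map_sub, map_neg, map_smul, add_apply, sub_apply, neg_apply,
    smul_apply, smul_eq_mul]
  -- The difference of the two sides is the Cotton tensor (`d`) minus the defect of the curvature
  -- equation applied to `X` (`c`). The rest cancels by the symmetries of `G`, `S` and `Γ`.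
  linear_combination (norm := module) d - c +
    (s1 + s3 - ((2⁻¹ : ℝ) * G p X X) * s2) • X + (s5 a - (2⁻¹ : ℝ) * s4 a) • u
    - (s5 u - (2⁻¹ : ℝ) * s4 u) • a - ((2⁻¹ : ℝ) * G p X X) • h.chr_symm hp a u
    + h.symm p X u • S p a - h.symm p X a • S p u

end Cotton

end CoordMetric

/-! ### The covariant derivative of curvature and Schur's lemma -/

namespace CoordMetric

set_option maxSynthPendingDepth 3

open Filter Topology

variable {E : Type*} [NormedAddCommGroup E] [NormedSpace ℝ E]

theorem trace_eq_sum {g : E →L[ℝ] E →L[ℝ] ℝ} {n : ℕ} {e : Basis (Fin n) ℝ E}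
    (h1 : ∀ i, g (e i) (e i) = 1) (h0 : ∀ i j, i ≠ j → g (e i) (e j) = 0) (L : E →ₗ[ℝ] E) :
    LinearMap.trace ℝ E L = ∑ i, g (L (e i)) (e i) := by
  rw [LinearMap.trace_eq_matrix_trace ℝ e, Matrix.trace]
  refine Finset.sum_congr rfl fun i _ => ?_
  rw [Matrix.diag_apply, LinearMap.toMatrix_apply, repr_orthonormal h1 h0]

theorem curv_antisymm (Γ : E → E →L[ℝ] E →L[ℝ] E) (p x y z : E) :
    curv Γ p x y z = -curv Γ p y x z := by
  simp only [curv]; abel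

/-- The covariant derivative of the curvature. -/
def nablaCurv (Γ : E → E →L[ℝ] E →L[ℝ] E) (p a x y z : E) : E :=
  fderiv ℝ (fun q => curv Γ q x y z) p a + Γ p a (curv Γ p x y z) - curv Γ p x y (Γ p a z)
    - curv Γ p (Γ p a x) y z - curv Γ p x (Γ p a y) z

theorem nablaCurv_antisymm (Γ : E → E →L[ℝ] E →L[ℝ] E) (p a x y z : E) :
    nablaCurv Γ p a x y z = -nablaCurv Γ p a y x z := by
  have : (fun q => curv Γ q x y z) = fun q => -curv Γ q y x z := by
    ext q; exact curv_antisymm Γ q x y z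
  simp only [nablaCurv]
  rw [this, fderiv_fun_neg, curv_antisymm Γ p x y, curv_antisymm Γ p x y,
    curv_antisymm Γ p (Γ p a x), curv_antisymm Γ p x]
  simp only [neg_apply, map_neg]
  abel

variable [FiniteDimensional ℝ E]

theorem IsMetricOn.isCurvatureLike {G : E → E →L[ℝ] E →L[ℝ] ℝ} {U : Set E} {p : E}
    (h : IsMetricOn G U) (hp : p ∈ U) : IsCurvatureLike (riemannFun G p) where
  add x x' y z w := by
    simp only [riemannFun, map_add, christoffel_add_left, add_apply]; ring
  smul a x y z w := by
    simp only [riemannFun, map_smul, christoffel_smul_left, smul_apply, smul_eq_mul]; ring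
  skew x y z w := by simp only [riemannFun]; ring
  pair x y z w := by
    have hG : ContDiffAt ℝ ∞ G p := h.contDiffAt hp
    simp only [riemannFun]
    rw [fderiv_fderiv_symm hG w x, fderiv_fderiv_symm hG z y, fderiv_fderiv_symm hG z x,
      fderiv_fderiv_symm hG w y, h.fderiv_fderiv_swap hp x w z y, h.fderiv_fderiv_swap hp y z w x,
      h.fderiv_fderiv_swap hp x z w y, h.fderiv_fderiv_swap hp y w z x,
      h.christoffel_symm hp w x, h.christoffel_symm hp z y, h.christoffel_symm hp z x,
      h.christoffel_symm hp w y, h.symm p (christoffel G p x w)]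
    ring
  bianchi x y z w := by
    have hG : ContDiffAt ℝ ∞ G p := h.contDiffAt hp
    simp only [riemannFun]
    rw [fderiv_fderiv_symm hG z x, fderiv_fderiv_symm hG y x, fderiv_fderiv_symm hG z y,
      h.christoffel_symm hp z x, h.christoffel_symm hp y x, h.christoffel_symm hp z y,
      h.fderiv_fderiv_swap hp y w x z, h.fderiv_fderiv_swap hp x w z y,
      h.fderiv_fderiv_swap hp z w y x]
    ring

section Schur

/-- The endomorphism whose trace is the Ricci tensor. -/
def curvEnd (Γ : E → E →L[ℝ] E →L[ℝ] E) (p y z : E) : E →ₗ[ℝ] E where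
  toFun x := curv Γ p x y z
  map_add' x x' := by simp only [curv, map_add, add_apply]; abel
  map_smul' a x := by
    simp only [curv, map_smul, smul_apply, RingHom.id_apply, smul_sub, smul_add]

variable {G : E → E →L[ℝ] E →L[ℝ] ℝ} {U : Set E} {p : E}

theorem curv_skew (h : IsMetricOn G U) (hp : p ∈ U) (x y z w : E) :
    G p (curv (chr G) p x y z) w = -G p (curv (chr G) p x y w) z := by
  have := (h.isCurvatureLike hp).skew' x y z w
  rw [h.riemannFun_eq hp, h.riemannFun_eq hp] at this
  linarith

/-- The corrections in the two-form arguments cancel in the cyclic sum because `Γ` is symmetric,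
which reduces the claim to `second_bianchi`. -/
theorem nablaCurv_bianchi (h : IsMetricOn G U) (hp : p ∈ U) (a x y z : E) :
    nablaCurv (chr G) p a x y z + nablaCurv (chr G) p x y a z + nablaCurv (chr G) p y a x z = 0 := by
  have hΓ : ContDiffAt ℝ ∞ (chr G) p := h.contDiffOn_chr.contDiffAt (h.isOpen.mem_nhds hp)
  rw [← second_bianchi hΓ a x y z]
  simp only [nablaCurv]
  rw [h.chr_symm hp a x, h.chr_symm hp a y, h.chr_symm hp x y,
    curv_antisymm _ p x (chr G p y a), curv_antisymm _ p y (chr G p x a),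
    curv_antisymm _ p a (chr G p y x)]
  abel

theorem nablaCurv_skew (h : IsMetricOn G U) (hp : p ∈ U) (a x y z w : E) :
    G p (nablaCurv (chr G) p a x y z) w = -G p (nablaCurv (chr G) p a x y w) z := by
  have hΓ : ContDiffAt ℝ ∞ (chr G) p := h.contDiffOn_chr.contDiffAt (h.isOpen.mem_nhds hp)
  have hd : ∀ z w, HasFDerivAt (fun q => G q (curv (chr G) q x y z) w) _ p := fun z w => by
    obtain ⟨L, hL, -⟩ := hasFDerivAt_curv hΓ x y z
    have := ((h.differentiableAt hp).hasFDerivAt.clm_apply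
      hL.differentiableAt.hasFDerivAt).clm_apply (hasFDerivAt_const w p)
    exact this
  have e1 : (fun q => G q (curv (chr G) q x y z) w) =ᶠ[𝓝 p] fun q =>
      -G q (curv (chr G) q x y w) z := by
    filter_upwards [h.isOpen.mem_nhds hp] with q hq using curv_skew h hq x y z w
  have := congrArg (fun l : E →L[ℝ] ℝ => l a)
    (((hd z w).congr_of_eventuallyEq e1.symm).unique (hd w z).fun_neg)
  simp [h.compat hp] at this
  simp only [nablaCurv, map_add, map_sub, add_apply, sub_apply]
  have c1 := curv_skew h hp x y z (chr G p a w)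
  have c2 := curv_skew h hp x y (chr G p a z) w
  have c3 := curv_skew h hp (chr G p a x) y z w
  have c4 := curv_skew h hp x (chr G p a y) z w
  linarith

/-- Schur's lemma. -/
theorem schur (h : IsMetricOn G U) (hE : 3 ≤ finrank ℝ E) (κ : E → ℝ)
    (hκ : ∀ q ∈ U, ∀ v w, LinearMap.trace ℝ E (curvEnd (chr G) q v w) = κ q * G q v w)
    (hp : p ∈ U) : HasFDerivAt κ (0 : E →L[ℝ] ℝ) p := by
  have hΓ : ContDiffAt ℝ ∞ (chr G) p := h.contDiffOn_chr.contDiffAt (h.isOpen.mem_nhds hp)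
  obtain ⟨e, h1, h0⟩ := exists_orthonormal_basis (G p) (h.symm p) (h.pos p hp)
  -- A trace may be computed in any fixed basis, so the basis orthonormal at `p` serves at every
  -- `q`, and the trace is differentiated term by term.
  have htr : ∀ (q v w : E), LinearMap.trace ℝ E (curvEnd (chr G) q v w) =
      ∑ i, G p (curv (chr G) q (e i) v w) (e i) := fun q v w => trace_eq_sum h1 h0 _
  have hcd : ∀ x y z : E, DifferentiableAt ℝ (fun q => curv (chr G) q x y z) p := fun x y z => by
    obtain ⟨L, hL, -⟩ := hasFDerivAt_curv hΓ x y z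
    exact hL.differentiableAt
  have htrd : ∀ v w : E, HasFDerivAt (fun q => LinearMap.trace ℝ E (curvEnd (chr G) q v w))
      (∑ i, ((G p).flip (e i)).comp (fderiv ℝ (fun q => curv (chr G) q (e i) v w) p)) p := by
    intro v w
    simp only [htr]
    have hi : ∀ i, HasFDerivAt (fun q => G p (curv (chr G) q (e i) v w) (e i))
        (((G p).flip (e i)).comp (fderiv ℝ (fun q => curv (chr G) q (e i) v w) p)) p := fun i =>
      ((G p).flip (e i)).hasFDerivAt.comp p (hcd (e i) v w).hasFDerivAt
    exact HasFDerivAt.fun_sum fun i _ => hi i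
  have hGd : ∀ v w : E, HasFDerivAt (fun q => G q v w) (((fderiv ℝ G p).flip v).flip w) p := by
    intro v w
    refine (((h.differentiableAt hp).hasFDerivAt.clm_apply (hasFDerivAt_const v p)).clm_apply
      (hasFDerivAt_const w p)).congr_fderiv ?_
    ext s; simp
  -- Differentiability of `κ` is not assumed; it follows by dividing a Ricci entry by the positive
  -- function `G q (e i0) (e i0)`.
  have hκd : DifferentiableAt ℝ κ p := by
    let i0 : Fin (finrank ℝ E) := ⟨0, by omega⟩
    have hne : ∀ q ∈ U, G q (e i0) (e i0) ≠ 0 := fun q hq => (h.pos q hq _ (e.ne_zero i0)).ne'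
    have e1 : κ =ᶠ[𝓝 p] fun q => LinearMap.trace ℝ E (curvEnd (chr G) q (e i0) (e i0)) *
        (G q (e i0) (e i0))⁻¹ := by
      filter_upwards [h.isOpen.mem_nhds hp] with q hq
      rw [hκ q hq, mul_assoc, mul_inv_cancel₀ (hne q hq), mul_one]
    have e2 := (htrd (e i0) (e i0)).differentiableAt.fun_mul
      ((hGd (e i0) (e i0)).differentiableAt.fun_inv (hne p hp))
    exact e1.differentiableAt_iff.2 e2
  have hP : ∀ b v w : E, ∑ i, G p (nablaCurv (chr G) p b (e i) v w) (e i) =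
      fderiv ℝ κ p b * G p v w := by
    intro b v w
    have e1 : (fun q => LinearMap.trace ℝ E (curvEnd (chr G) q v w)) =ᶠ[𝓝 p]
        fun q => κ q * G q v w := by
      filter_upwards [h.isOpen.mem_nhds hp] with q hq using hκ q hq v w
    have e2 := congrArg (fun l : E →L[ℝ] ℝ => l b)
      (((htrd v w).congr_of_eventuallyEq e1.symm).unique (hκd.hasFDerivAt.mul (hGd v w)))
    simp [h.compat hp] at e2
    have e3 := (htr p v (chr G p b w)).symm.trans (hκ p hp _ _)
    have e4 := (htr p (chr G p b v) w).symm.trans (hκ p hp _ _)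
    -- The connection term on the value and the one in the contracted slot have equal traces, by `tr
    -- (AB) = tr (BA)`.
    have e5 : ∑ i, G p (chr G p b (curv (chr G) p (e i) v w)) (e i) =
        ∑ i, G p (curv (chr G) p (chr G p b (e i)) v w) (e i) := by
      have t1 := trace_eq_sum h1 h0 ((chr G p b).toLinearMap * curvEnd (chr G) p v w)
      have t2 := trace_eq_sum h1 h0 (curvEnd (chr G) p v w * (chr G p b).toLinearMap)
      rw [LinearMap.trace_mul_comm, t2] at t1
      exact t1.symm
    simp only [nablaCurv, map_add, map_sub, add_apply, sub_apply, Finset.sum_add_distrib,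
      Finset.sum_sub_distrib]
    rw [e5, e3, e4, e2]
    ring
  -- Tracing the second Bianchi identity twice gives `n dκ = dκ + dκ`, so `(n - 2) dκ = 0`.
  have hzero : ∀ a, fderiv ℝ κ p a = 0 := by
    intro a
    have hb : ∀ i j, G p (nablaCurv (chr G) p a (e i) (e j) (e j)) (e i) =
        G p (nablaCurv (chr G) p (e i) a (e j) (e j)) (e i) +
          G p (nablaCurv (chr G) p (e j) (e i) a (e j)) (e i) := by
      intro i j
      have := congrArg (fun u => G p u (e i)) (nablaCurv_bianchi h hp a (e i) (e j) (e j))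
      simp only [map_add, add_apply, map_zero, zero_apply] at this
      rw [nablaCurv_antisymm _ p (e i) (e j) a, nablaCurv_antisymm _ p (e j) a (e i), map_neg,
        map_neg, neg_apply, neg_apply] at this
      linarith
    have t1 : ∑ j, ∑ i, G p (nablaCurv (chr G) p a (e i) (e j) (e j)) (e i) =
        finrank ℝ E * fderiv ℝ κ p a := by
      simp_rw [hP, h1]
      simp
    have t2 : ∑ j, ∑ i, G p (nablaCurv (chr G) p (e j) (e i) a (e j)) (e i) = fderiv ℝ κ p a := by
      simp_rw [hP]
      conv_rhs => rw [← e.sum_repr a]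
      rw [map_sum]
      refine Finset.sum_congr rfl fun j _ => ?_
      rw [map_smul, smul_eq_mul, repr_orthonormal h1 h0, mul_comm]
    have t3 : ∑ j, ∑ i, G p (nablaCurv (chr G) p (e i) a (e j) (e j)) (e i) =
        fderiv ℝ κ p a := by
      rw [← t2, Finset.sum_comm]
      refine Finset.sum_congr rfl fun i _ => Finset.sum_congr rfl fun j _ => ?_
      rw [nablaCurv_antisymm, map_neg, neg_apply, nablaCurv_skew h hp, neg_neg]
    simp_rw [hb, Finset.sum_add_distrib] at t1
    rw [t2, t3] at t1
    have : (3 : ℝ) ≤ finrank ℝ E := by exact_mod_cast hE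
    have : ((finrank ℝ E : ℝ) - 2) * fderiv ℝ κ p a = 0 := by linarith
    exact (mul_eq_zero.1 this).resolve_left (by linarith)
  have : fderiv ℝ κ p = 0 := by ext a; exact hzero a
  rw [← this]
  exact hκd.hasFDerivAt

end Schur

end CoordMetric

/-! ### The Frobenius theorem for total differential equations -/

namespace TotalDifferential

set_option synthInstance.maxHeartbeats 200000

open Filter Topology Metric Set
open scoped NNReal

variable {E F : Type*} [NormedAddCommGroup E] [NormedSpace ℝ E] [NormedAddCommGroup F]

theorem mem_closedBall_of {x₀ : E} {u₀ : F} {ρ : ℝ} {t : ℝ} (ht : t ∈ Icc (0 : ℝ) 1) {a : E} (ha : ‖a‖ ≤ ρ) {v : F}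
    (hv : v ∈ closedBall u₀ ρ) : (x₀ + t • a, v) ∈ closedBall (x₀, u₀) ρ := by
  rw [← closedBall_prod_same]
  refine ⟨?_, hv⟩
  rw [mem_closedBall, dist_eq_norm, add_sub_cancel_left, norm_smul, Real.norm_eq_abs,
    abs_of_nonneg ht.1]
  nlinarith [ht.2, norm_nonneg a]

variable [NormedSpace ℝ F]

theorem gronwallBound_zero_eq (K ε x : ℝ) : gronwallBound 0 K ε x = ε * gronwallBound 0 K 1 x := by
  unfold gronwallBound
  split_ifs <;> ring

/-- Bounds for `Φ` near `z₀` that make the Picard-Lindelöf theorem work. -/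
structure IsGood (Φ : E × F → E →L[ℝ] F) (z₀ : E × F) (ρ : ℝ) (M K N L : ℝ≥0) : Prop where
  pos : 0 < ρ
  differentiableAt : ∀ z ∈ closedBall z₀ ρ, DifferentiableAt ℝ Φ z
  norm_le : ∀ z ∈ closedBall z₀ ρ, ‖Φ z‖ ≤ M
  lipschitz : LipschitzOnWith K Φ (closedBall z₀ ρ)
  norm_fderiv_le : ∀ z ∈ closedBall z₀ ρ, ‖fderiv ℝ Φ z‖ ≤ N
  lipschitz_fderiv : LipschitzOnWith L (fderiv ℝ Φ) (closedBall z₀ ρ)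
  integrable : ∀ z ∈ closedBall z₀ ρ, ∀ a b,
    fderiv ℝ Φ z (a, Φ z a) b = fderiv ℝ Φ z (b, Φ z b) a

theorem exists_isGood {Φ : E × F → E →L[ℝ] F} {D : Set (E × F)} (hD : IsOpen D)
    (hΦ : ContDiffOn ℝ ∞ Φ D)
    (hint : ∀ z ∈ D, ∀ a b, fderiv ℝ Φ z (a, Φ z a) b = fderiv ℝ Φ z (b, Φ z b) a)
    {z₀ : E × F} (hz : z₀ ∈ D) : ∃ ρ M K N L, IsGood Φ z₀ ρ M K N L ∧ closedBall z₀ ρ ⊆ D := by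
  have h0 : ContDiffAt ℝ ∞ Φ z₀ := hΦ.contDiffAt (hD.mem_nhds hz)
  obtain ⟨K, s, hs, hK⟩ := (h0.of_le (by simp) : ContDiffAt ℝ 1 Φ z₀).exists_lipschitzOnWith
  obtain ⟨L, t, ht, hL⟩ := ((CoordMetric.contDiffAt_fderiv h0).of_le (by simp) :
    ContDiffAt ℝ 1 (fderiv ℝ Φ) z₀).exists_lipschitzOnWith
  obtain ⟨ρ, hρ, hball⟩ := Metric.nhds_basis_closedBall.mem_iff.1
    (inter_mem (inter_mem hs ht) (hD.mem_nhds hz))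
  have hmem : z₀ ∈ closedBall z₀ ρ := mem_closedBall_self hρ.le
  have hKb := hK.mono (fun z hzb => (hball hzb).1.1 : closedBall z₀ ρ ⊆ s)
  have hLb := hL.mono (fun z hzb => (hball hzb).1.2 : closedBall z₀ ρ ⊆ t)
  refine ⟨ρ, ‖Φ z₀‖₊ + K * ρ.toNNReal, K, ‖fderiv ℝ Φ z₀‖₊ + L * ρ.toNNReal, L,
    ⟨hρ, fun z hzb => ?_, fun z hzb => ?_, hKb, fun z hzb => ?_, hLb,
      fun z hzb => hint z (hball hzb).2⟩, fun z hzb => (hball hzb).2⟩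
  · exact (hΦ.contDiffAt (hD.mem_nhds (hball hzb).2)).differentiableAt (by simp)
  · have h1 := hKb.dist_le_mul z hzb z₀ hmem
    rw [dist_eq_norm] at h1
    have h2 : (K : ℝ) * dist z z₀ ≤ K * ρ := by gcongr; exact hzb
    have h3 := norm_le_norm_add_norm_sub' (Φ z) (Φ z₀)
    push_cast
    rw [Real.coe_toNNReal _ hρ.le]
    linarith
  · have h1 := hLb.dist_le_mul z hzb z₀ hmem
    rw [dist_eq_norm] at h1
    have h2 : (L : ℝ) * dist z z₀ ≤ L * ρ := by gcongr; exact hzb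
    have h3 := norm_le_norm_add_norm_sub' (fderiv ℝ Φ z) (fderiv ℝ Φ z₀)
    push_cast
    rw [Real.coe_toNNReal _ hρ.le]
    linarith

namespace IsGood

variable {Φ : E × F → E →L[ℝ] F} {x₀ : E} {u₀ : F} {ρ : ℝ} {M K N L : ℝ≥0} {δ : ℝ}

theorem lipschitz_ray (h : IsGood Φ (x₀, u₀) ρ M K N L) {t : ℝ} (ht : t ∈ Icc (0 : ℝ) 1) {a : E}
    (ha : ‖a‖ ≤ ρ) : LipschitzOnWith (K * ρ.toNNReal) (fun v => Φ (x₀ + t • a, v) a)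
      (closedBall u₀ ρ) := by
  refine LipschitzOnWith.of_dist_le_mul fun v hv w hw => ?_
  have h1 := h.lipschitz.dist_le_mul _ (mem_closedBall_of ht ha hv) _ (mem_closedBall_of ht ha hw)
  rw [Prod.dist_eq, dist_self, max_eq_right dist_nonneg] at h1
  rw [dist_eq_norm, ← sub_apply]
  refine (ContinuousLinearMap.le_opNorm _ _).trans ?_
  rw [← dist_eq_norm]
  push_cast
  rw [Real.coe_toNNReal _ h.pos.le]
  calc dist (Φ (x₀ + t • a, v)) (Φ (x₀ + t • a, w)) * ‖a‖ ≤ (K * dist v w) * ρ := by gcongr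
    _ = K * ρ * dist v w := by ring

/-- The solution along the rays through `x₀`. -/
theorem exists_ray [CompleteSpace F] (h : IsGood Φ (x₀, u₀) ρ M K N L) {a : E} (ha : ‖a‖ ≤ ρ)
    (ha' : M * ‖a‖ ≤ ρ / 2) : ∃ v : ℝ → F, v 0 = u₀ ∧ (∀ t ∈ Icc (0 : ℝ) 1,
      HasDerivWithinAt v (Φ (x₀ + t • a, v t) a) (Icc 0 1) t) ∧
      ∀ t, v t ∈ closedBall u₀ (ρ / 2) := by
  have hρ := h.pos
  have hsub : closedBall u₀ (ρ / 2) ⊆ closedBall u₀ ρ := closedBall_subset_closedBall (by linarith)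
  have hc : ((ρ / 2).toNNReal : ℝ) = ρ / 2 := Real.coe_toNNReal _ (by linarith)
  have hf : IsPicardLindelof (fun t v => Φ (x₀ + t • a, v) a)
      (⟨0, by simp⟩ : Icc (0 : ℝ) 1) u₀ (ρ / 2).toNNReal 0 (M * ‖a‖₊) (K * ρ.toNNReal) := by
    refine ⟨fun t ht => ?_, fun v hv => ?_, fun t ht v hv => ?_, ?_⟩
    · rw [hc]; exact (h.lipschitz_ray ht ha).mono hsub
    · rw [hc] at hv
      intro t ht
      have h1 := (h.differentiableAt _ (mem_closedBall_of ht ha (hsub hv))).continuousAt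
      have h2 : ContinuousAt (fun t : ℝ => Φ (x₀ + t • a, v)) t :=
        h1.comp (f := fun t : ℝ => (x₀ + t • a, v)) (by fun_prop)
      exact (h2.clm_apply continuousAt_const).continuousWithinAt
    · rw [hc] at hv
      refine (ContinuousLinearMap.le_opNorm _ _).trans ?_
      push_cast
      gcongr
      exact h.norm_le _ (mem_closedBall_of ht ha (hsub hv))
    · simpa [hc] using ha'
  -- Working with the fixed point of the Picard map yields both the equation and the confinement to
  -- the half ball.
  obtain ⟨α, hα⟩ := ODE.FunSpace.exists_isFixedPt_next hf (mem_closedBall_self le_rfl)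
  refine ⟨α.compProj, ?_, fun t ht => ?_, fun t => ?_⟩
  · have := ODE.FunSpace.compProj_val (α := α) (t := (⟨0, by simp⟩ : Icc (0 : ℝ) 1))
    refine this.trans ?_
    rw [← hα, ODE.FunSpace.next_apply₀]
  · apply ODE.hasDerivWithinAt_picard_Icc (t₀ := 0) (by simp) hf.continuousOn_uncurry
      α.continuous_compProj.continuousOn (fun _ ht' => α.compProj_mem_closedBall hf.mul_max_le)
      u₀ ht |>.congr_of_mem _ ht
    intro t' ht'
    nth_rw 1 [← hα]
    rw [ODE.FunSpace.compProj_of_mem ht', ODE.FunSpace.next_apply]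
  · rw [← hc]; exact α.compProj_mem_closedBall hf.mul_max_le

theorem taylor (h : IsGood Φ (x₀, u₀) ρ M K N L) {z k : E × F} (hz : z ∈ closedBall (x₀, u₀) ρ)
    (hk : z + k ∈ closedBall (x₀, u₀) ρ) :
    ‖Φ (z + k) - Φ z - fderiv ℝ Φ z k‖ ≤ L * ‖k‖ * ‖k‖ := by
  have hseg : segment ℝ z (z + k) ⊆ closedBall (x₀, u₀) ρ :=
    (convex_closedBall _ _).segment_subset hz hk
  have := Convex.norm_image_sub_le_of_norm_hasFDerivWithin_le' (𝕜 := ℝ) (f := Φ)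
    (f' := fderiv ℝ Φ) (φ := fderiv ℝ Φ z) (C := L * ‖k‖) (s := segment ℝ z (z + k))
    (fun y hy => (h.differentiableAt y (hseg hy)).hasFDerivAt.hasFDerivWithinAt)
    (fun y hy => ?_) (convex_segment _ _) (left_mem_segment ℝ z (z + k))
    (right_mem_segment ℝ z (z + k))
  · simpa using this
  · have h1 := h.lipschitz_fderiv.dist_le_mul y (hseg hy) z hz
    rw [dist_eq_norm] at h1
    refine h1.trans ?_
    gcongr
    obtain ⟨θ, hθ, rfl⟩ := (segment_eq_image' ℝ z (z + k)).subset hy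
    rw [dist_eq_norm]
    simp only [add_sub_cancel_left, norm_smul, Real.norm_eq_abs, abs_of_nonneg hθ.1]
    nlinarith [hθ.2, norm_nonneg k]

end IsGood

end TotalDifferential

namespace TotalDifferential

set_option synthInstance.maxHeartbeats 200000

open Filter Topology Metric Set
open scoped NNReal

variable {E F : Type*} [NormedAddCommGroup E] [NormedSpace ℝ E] [NormedAddCommGroup F]
  [NormedSpace ℝ F]

namespace IsGood

variable {Φ : E × F → E →L[ℝ] F} {x₀ : E} {u₀ : F} {ρ : ℝ} {M K N L : ℝ≥0}

/-- The curve `v + t Φ k` is the expected first variation of the solution along the ray when `a`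
becomes `a + k`. Integrability interchanges `a` and `k` in its derivative; by this the curve solves
the equation of the new ray up to second order in `k`. -/
theorem hasDerivWithinAt_approx (h : IsGood Φ (x₀, u₀) ρ M K N L) {a k : E} (ha : ‖a‖ ≤ ρ)
    {v : ℝ → F}
    (hv : ∀ t ∈ Icc (0 : ℝ) 1, HasDerivWithinAt v (Φ (x₀ + t • a, v t) a) (Icc 0 1) t)
    (hvm : ∀ t, v t ∈ closedBall u₀ (ρ / 2)) {t : ℝ} (ht : t ∈ Icc (0 : ℝ) 1) :
    HasDerivWithinAt (fun t => v t + t • Φ (x₀ + t • a, v t) k)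
      (Φ (x₀ + t • a, v t) (a + k)
        + t • fderiv ℝ Φ (x₀ + t • a, v t) (k, Φ (x₀ + t • a, v t) k) a) (Icc 0 1) t := by
  have hρ := h.pos
  have hz : (x₀ + t • a, v t) ∈ closedBall (x₀, u₀) ρ :=
    mem_closedBall_of ht ha (closedBall_subset_closedBall (by linarith) (hvm t))
  have h1 : HasDerivWithinAt (fun t : ℝ => x₀ + t • a) a (Icc 0 1) t := by
    simpa using ((hasDerivAt_id t).smul_const a).const_add x₀ |>.hasDerivWithinAt
  have h2 : HasDerivWithinAt (fun t => Φ (x₀ + t • a, v t))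
      (fderiv ℝ Φ (x₀ + t • a, v t) (a, Φ (x₀ + t • a, v t) a)) (Icc 0 1) t :=
    (h.differentiableAt _ hz).hasFDerivAt.comp_hasDerivWithinAt t (h1.prodMk (hv t ht))
  have h3 : HasDerivWithinAt (fun t => Φ (x₀ + t • a, v t) k)
      (fderiv ℝ Φ (x₀ + t • a, v t) (a, Φ (x₀ + t • a, v t) a) k) (Icc 0 1) t := by
    simpa using h2.clm_apply (hasDerivWithinAt_const t (Icc (0 : ℝ) 1) k)
  have h4 := (hv t ht).add ((hasDerivAt_id t).hasDerivWithinAt.smul h3)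
  rw [h.integrable _ hz] at h4
  refine HasDerivWithinAt.congr_deriv h4 ?_
  simp only [id, map_add, one_smul]
  abel

/-- Grönwall's inequality compares the approximate solution with the true one on the ray to `a + k`.
At `t = 1` the bound says that the endpoint map has derivative `Φ`, with quadratic error. -/
theorem ray_dist (h : IsGood Φ (x₀, u₀) ρ M K N L) {a k : E} (ha : ‖a‖ ≤ ρ) (hak : ‖a + k‖ ≤ ρ)
    (hk : M * ‖k‖ ≤ ρ / 2) {v w : ℝ → F} (hv0 : v 0 = u₀) (hw0 : w 0 = u₀)
    (hv : ∀ t ∈ Icc (0 : ℝ) 1, HasDerivWithinAt v (Φ (x₀ + t • a, v t) a) (Icc 0 1) t)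
    (hvm : ∀ t, v t ∈ closedBall u₀ (ρ / 2))
    (hw : ∀ t ∈ Icc (0 : ℝ) 1, HasDerivWithinAt w (Φ (x₀ + t • (a + k), w t) (a + k)) (Icc 0 1) t)
    (hwm : ∀ t, w t ∈ closedBall u₀ (ρ / 2)) :
    ‖w 1 - v 1 - Φ (x₀ + a, v 1) k‖ ≤
      (L * (1 + M) ^ 2 * ρ + N * (1 + M)) * gronwallBound 0 (K * ρ) 1 1 * ‖k‖ ^ 2 := by
  have hρ := h.pos
  have hsub : closedBall u₀ (ρ / 2) ⊆ closedBall u₀ ρ := closedBall_subset_closedBall (by linarith)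
  set C : ℝ := L * (1 + M) ^ 2 * ρ + N * (1 + M) with hC
  have hz : ∀ t ∈ Icc (0 : ℝ) 1, (x₀ + t • a, v t) ∈ closedBall (x₀, u₀) ρ := fun t ht =>
    mem_closedBall_of ht ha (hsub (hvm t))
  have hAk : ∀ t ∈ Icc (0 : ℝ) 1, ‖Φ (x₀ + t • a, v t) k‖ ≤ M * ‖k‖ := fun t ht =>
    (ContinuousLinearMap.le_opNorm _ _).trans (by gcongr; exact h.norm_le _ (hz t ht))
  -- The solutions stay in the ball of radius `ρ / 2`; the other half of the radius accommodates the
  -- correction `t Φ k`.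
  have happ : ∀ t ∈ Icc (0 : ℝ) 1, v t + t • Φ (x₀ + t • a, v t) k ∈ closedBall u₀ ρ := by
    intro t ht
    have h1 : ‖v t - u₀‖ ≤ ρ / 2 := by simpa [dist_eq_norm] using hvm t
    have h2 : ‖t • Φ (x₀ + t • a, v t) k‖ ≤ ρ / 2 := by
      rw [norm_smul, Real.norm_eq_abs, abs_of_nonneg ht.1]
      have := hAk t ht
      nlinarith [ht.1, ht.2, norm_nonneg (Φ (x₀ + t • a, v t) k)]
    rw [mem_closedBall, dist_eq_norm, add_sub_right_comm]
    exact (norm_add_le _ _).trans (by linarith)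
  have hder := fun t (ht : t ∈ Icc (0 : ℝ) 1) => h.hasDerivWithinAt_approx ha hv hvm (k := k) ht
  have hbound : ∀ t ∈ Icc (0 : ℝ) 1, dist (Φ (x₀ + t • a, v t) (a + k)
        + t • fderiv ℝ Φ (x₀ + t • a, v t) (k, Φ (x₀ + t • a, v t) k) a)
      (Φ (x₀ + t • (a + k), v t + t • Φ (x₀ + t • a, v t) k) (a + k)) ≤ C * ‖k‖ ^ 2 := by
    intro t ht
    set z := (x₀ + t • a, v t) with hzdef
    set q : E × F := (k, Φ z k) with hq
    have hqn : ‖q‖ ≤ (1 + M) * ‖k‖ := by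
      rw [hq, Prod.norm_mk]
      refine max_le ?_ ((hAk t ht).trans ?_)
      · nlinarith [norm_nonneg k, M.coe_nonneg]
      · nlinarith [norm_nonneg k]
    have hzq : (x₀ + t • (a + k), v t + t • Φ z k) = z + t • q := by
      ext
      · simp [hzdef, hq, add_assoc]
      · simp [hzdef, hq]
    have hmem : z + t • q ∈ closedBall (x₀, u₀) ρ := by
      rw [← hzq]; exact mem_closedBall_of ht hak (happ t ht)
    have ht1 := h.taylor (hz t ht) hmem
    have htq : ‖t • q‖ ≤ (1 + M) * ‖k‖ := by
      rw [norm_smul, Real.norm_eq_abs, abs_of_nonneg ht.1]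
      nlinarith [ht.1, ht.2, norm_nonneg q]
    have e : Φ z (a + k) + t • fderiv ℝ Φ z q a - Φ (z + t • q) (a + k) =
        -((Φ (z + t • q) - Φ z - fderiv ℝ Φ z (t • q)) (a + k)) - fderiv ℝ Φ z (t • q) k := by
      simp only [map_smul, map_add, sub_apply, smul_apply]
      module
    rw [hzq, dist_eq_norm, e]
    refine (norm_sub_le _ _).trans ?_
    rw [norm_neg]
    have b1 : ‖(Φ (z + t • q) - Φ z - fderiv ℝ Φ z (t • q)) (a + k)‖ ≤
        (L * ((1 + M) * ‖k‖) * ((1 + M) * ‖k‖)) * ρ := by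
      refine (ContinuousLinearMap.le_opNorm _ _).trans ?_
      gcongr
      refine ht1.trans ?_
      gcongr
    have b2 : ‖fderiv ℝ Φ z (t • q) k‖ ≤ N * ((1 + M) * ‖k‖) * ‖k‖ := by
      refine (ContinuousLinearMap.le_opNorm _ _).trans ?_
      gcongr
      refine (ContinuousLinearMap.le_opNorm _ _).trans ?_
      gcongr
      exact h.norm_fderiv_le z (hz t ht)
    calc _ ≤ _ := add_le_add b1 b2
      _ = C * ‖k‖ ^ 2 := by rw [hC]; ring
  have hIci : ∀ {f : ℝ → F} {f' : F} {t : ℝ}, t ∈ Ico (0 : ℝ) 1 →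
      HasDerivWithinAt f f' (Icc 0 1) t → HasDerivWithinAt f f' (Ici t) t := fun ht hf =>
    hf.mono_of_mem_nhdsWithin (Icc_mem_nhdsGE_of_mem ht)
  have key := dist_le_of_approx_trajectories_ODE_of_mem (K := K * ρ.toNNReal) (δ := 0) (εf := 0)
    (εg := C * ‖k‖ ^ 2) (a := 0) (b := 1) (f := w)
    (g := fun t => v t + t • Φ (x₀ + t • a, v t) k)
    (v := fun t u => Φ (x₀ + t • (a + k), u) (a + k)) (s := fun _ => closedBall u₀ ρ)
    (fun t ht => h.lipschitz_ray (Ico_subset_Icc_self ht) hak)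
    (fun t ht => (hw t ht).continuousWithinAt)
    (fun t ht => hIci ht (hw t (Ico_subset_Icc_self ht)))
    (fun t ht => by simp) (fun t _ => hsub (hwm t))
    (fun t ht => (hder t ht).continuousWithinAt)
    (fun t ht => hIci ht (hder t (Ico_subset_Icc_self ht)))
    (fun t ht => hbound t (Ico_subset_Icc_self ht))
    (fun t ht => happ t (Ico_subset_Icc_self ht)) (by simp [hv0, hw0]) 1 (by simp)
  rw [gronwallBound_zero_eq, dist_eq_norm] at key
  simp only [one_smul, sub_zero, zero_add] at key
  rw [sub_sub]
  refine key.trans (le_of_eq ?_)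
  push_cast
  rw [Real.coe_toNNReal _ hρ.le]
  ring

end IsGood

/-- The Frobenius theorem for total differential equations `Du = Φ (x, u)`. -/
theorem exists_solution [CompleteSpace F] {Φ : E × F → E →L[ℝ] F} {D : Set (E × F)}
    (hD : IsOpen D) (hΦ : ContDiffOn ℝ ∞ Φ D)
    (hint : ∀ z ∈ D, ∀ a b, fderiv ℝ Φ z (a, Φ z a) b = fderiv ℝ Φ z (b, Φ z b) a)
    {x₀ : E} {u₀ : F} (hz : (x₀, u₀) ∈ D) :
    ∃ (u : E → F) (W : Set E), IsOpen W ∧ x₀ ∈ W ∧ ContDiffOn ℝ ∞ u W ∧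
      ∀ x ∈ W, (x, u x) ∈ D ∧ HasFDerivAt u (Φ (x, u x)) x := by
  obtain ⟨ρ, M, K, N, L, h, hsubD⟩ := exists_isGood hD hΦ hint hz
  have hρ := h.pos
  obtain ⟨δ, hδ, hδρ, hδM⟩ : ∃ δ : ℝ, 0 < δ ∧ δ ≤ ρ ∧ M * δ ≤ ρ / 2 := by
    refine ⟨min ρ (ρ / 2 / (M + 1)), by positivity, min_le_left _ _, ?_⟩
    have h1 : min ρ (ρ / 2 / (M + 1)) ≤ ρ / 2 / (M + 1) := min_le_right _ _
    rw [le_div_iff₀ (by positivity)] at h1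
    have h2 : 0 ≤ min ρ (ρ / 2 / (M + 1)) := by positivity
    linarith
  -- The solution is built along each ray from `x₀` and evaluated at time `1`. Outside the ball the
  -- choice is a dummy value.
  have hray : ∀ x : E, ∃ v : ℝ → F, x ∈ ball x₀ δ → v 0 = u₀ ∧ (∀ t ∈ Icc (0 : ℝ) 1,
      HasDerivWithinAt v (Φ (x₀ + t • (x - x₀), v t) (x - x₀)) (Icc 0 1) t) ∧
      ∀ t, v t ∈ closedBall u₀ (ρ / 2) := by
    intro x
    by_cases hx : x ∈ ball x₀ δ
    · rw [mem_ball, dist_eq_norm] at hx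
      obtain ⟨v, hv⟩ := h.exists_ray (a := x - x₀) (hx.le.trans hδρ) (le_trans (by gcongr) hδM)
      exact ⟨v, fun _ => hv⟩
    · exact ⟨0, fun hx' => absurd hx' hx⟩
  choose v hv using hray
  have hder : ∀ x ∈ ball x₀ δ, HasFDerivAt (fun x => v x 1) (Φ (x, v x 1)) x := by
    intro x hx
    rw [hasFDerivAt_iff_isLittleO_nhds_zero]
    have hO : (fun k => v (x + k) 1 - v x 1 - Φ (x, v x 1) k) =O[𝓝 0] fun k => ‖k‖ ^ 2 := by
      refine Asymptotics.IsBigO.of_bound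
        ((L * (1 + M) ^ 2 * ρ + N * (1 + M)) * gronwallBound 0 (K * ρ) 1 1) ?_
      have e1 : ∀ᶠ k in 𝓝 (0 : E), x + k ∈ ball x₀ δ := by
        have : ContinuousAt (fun k : E => x + k) 0 := by fun_prop
        exact this.eventually_mem (isOpen_ball.mem_nhds (by simpa using hx))
      have e2 : ∀ᶠ k in 𝓝 (0 : E), M * ‖k‖ < ρ / 2 := by
        have : ContinuousAt (fun k : E => M * ‖k‖) 0 := by fun_prop
        exact this.eventually_lt continuousAt_const (by simpa using hρ)
      filter_upwards [e1, e2] with k hk1 hk2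
      have hx1 := hx
      rw [mem_ball, dist_eq_norm] at hx1
      have hk3 := hk1
      rw [mem_ball, dist_eq_norm] at hk3
      have hk4 : x + k - x₀ = x - x₀ + k := by abel
      obtain ⟨a1, a2, a3⟩ := hv x hx
      obtain ⟨b1, b2, b3⟩ := hv (x + k) hk1
      rw [hk4] at b2 hk3
      have := h.ray_dist (hx1.le.trans hδρ) (hk3.le.trans hδρ) hk2.le a1 b1 a2 a3 b2 b3
      simpa using this
    exact hO.trans_isLittleO (Asymptotics.isLittleO_norm_pow_id one_lt_two)
  have hmem : ∀ x ∈ ball x₀ δ, (x, v x 1) ∈ D := by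
    intro x hx
    refine hsubD ?_
    rw [← closedBall_prod_same]
    exact ⟨closedBall_subset_closedBall hδρ (ball_subset_closedBall hx),
      closedBall_subset_closedBall (by linarith) ((hv x hx).2.2 1)⟩
  refine ⟨fun x => v x 1, ball x₀ δ, isOpen_ball, mem_ball_self hδ, ?_, fun x hx =>
    ⟨hmem x hx, hder x hx⟩⟩
  -- Bootstrapping: if `u` is of class `C^k`, then so is its derivative `Φ (x, u)`.
  have hk : ∀ k : ℕ, ContDiffOn ℝ k (fun x => v x 1) (ball x₀ δ) := by
    intro k
    induction k with
    | zero => exact contDiffOn_zero.2 fun x hx => (hder x hx).continuousAt.continuousWithinAt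
    | succ k ih =>
      rw [Nat.cast_add, Nat.cast_one, contDiffOn_succ_iff_fderiv_of_isOpen isOpen_ball]
      refine ⟨fun x hx => (hder x hx).differentiableAt.differentiableWithinAt, by simp, ?_⟩
      refine ContDiffOn.congr (f := fun x => Φ (x, v x 1)) ?_ fun x hx => (hder x hx).fderiv
      exact (hΦ.of_le (by exact_mod_cast le_top)).comp (contDiffOn_id.prodMk ih) hmem
  exact contDiffOn_infty.2 hk

end TotalDifferential

/-! ### Solving for the conformal factor -/

namespace CoordMetric

set_option maxSynthPendingDepth 3

open Filter Topology

variable {E : Type*} [NormedAddCommGroup E] [NormedSpace ℝ E]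

theorem IsMetricOn.mono {G : E → E →L[ℝ] E →L[ℝ] ℝ} {U W : Set E} (h : IsMetricOn G U)
    (hW : IsOpen W) (hsub : W ⊆ U) : IsMetricOn G W :=
  ⟨hW, h.contDiffOn.mono hsub, h.symm, fun q hq => h.pos q (hsub hq)⟩

theorem IsMetricOn.conformal {G : E → E →L[ℝ] E →L[ℝ] ℝ} {U : Set E} (h : IsMetricOn G U)
    {f : E → ℝ} (hf : ContDiffOn ℝ ∞ f U) : IsMetricOn (fun q => Real.exp (2 * f q) • G q) U where
  isOpen := h.isOpen
  contDiffOn := ((contDiffOn_const.mul hf).exp).smul h.contDiffOn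
  symm p u v := by simp [h.symm p u v]
  pos p hp v hv := by
    have := h.pos p hp v hv
    simp only [smul_apply, smul_eq_mul]
    positivity

variable [FiniteDimensional ℝ E] {G : E → E →L[ℝ] E →L[ℝ] ℝ} {U : Set E} {p : E}

/-- The right hand side of the equation for the gradient `X` of the conformal factor. -/
def gradEq (G : E → E →L[ℝ] E →L[ℝ] ℝ) (S : E → E →L[ℝ] E) (z : E × E) : E →L[ℝ] E :=
  -(chr G z.1).flip z.2 + S z.1 + (G z.1 z.2).smulRight z.2
    - ((2⁻¹ : ℝ) * G z.1 z.2 z.2) • ContinuousLinearMap.id ℝ E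

theorem gradEq_apply (S : E → E →L[ℝ] E) (q X u : E) : gradEq G S (q, X) u =
    -chr G q u X + S q u + G q X u • X - ((2⁻¹ : ℝ) * G q X X) • u := by
  simp [gradEq]

theorem contDiffOn_gradEq (h : IsMetricOn G U) {S : E → E →L[ℝ] E} (hS : ContDiffOn ℝ ∞ S U) :
    ContDiffOn ℝ ∞ (gradEq G S) (U ×ˢ Set.univ) := by
  refine contDiffOn_clm_apply.2 fun u => ?_
  have h1 : ∀ {F : Type _} [NormedAddCommGroup F] [NormedSpace ℝ F] {H : E → F},
      ContDiffOn ℝ ∞ H U → ContDiffOn ℝ ∞ (fun z : E × E => H z.1) (U ×ˢ Set.univ) := fun hH =>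
    hH.comp contDiffOn_fst fun z hz => hz.1
  have h2 : ContDiffOn ℝ ∞ (fun z : E × E => z.2) (U ×ˢ Set.univ) := contDiffOn_snd
  have hG := h1 h.contDiffOn
  have e : (fun z => gradEq G S z u) = fun z : E × E => -chr G z.1 u z.2 + S z.1 u
      + G z.1 z.2 u • z.2 - ((2⁻¹ : ℝ) * G z.1 z.2 z.2) • u := by
    ext z; exact gradEq_apply S z.1 z.2 u
  rw [e]
  exact (((((h1 h.contDiffOn_chr).clm_apply contDiffOn_const).clm_apply h2).neg.add
    ((h1 hS).clm_apply contDiffOn_const)).add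
    (((hG.clm_apply h2).clm_apply contDiffOn_const).smul h2)).sub
    ((contDiffOn_const.mul ((hG.clm_apply h2).clm_apply h2)).smul contDiffOn_const)

theorem fderiv_gradEq (h : IsMetricOn G U) {S : E → E →L[ℝ] E} (hS : ContDiffOn ℝ ∞ S U)
    (hp : p ∈ U) (X a b u : E) : fderiv ℝ (gradEq G S) (p, X) (a, b) u =
      (-fderiv ℝ (chr G) p a u X + fderiv ℝ S p a u + fderiv ℝ G p a X u • X
        - ((2⁻¹ : ℝ) * fderiv ℝ G p a X X) • u)
      + (-chr G p u b + G p b u • X + G p X u • b - G p X b • u) := by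
  have hd : DifferentiableAt ℝ (gradEq G S) (p, X) :=
    ((contDiffOn_gradEq h hS).contDiffAt ((h.isOpen.prod isOpen_univ).mem_nhds
      ⟨hp, trivial⟩)).differentiableAt (by simp)
  have hSd : DifferentiableAt ℝ S p :=
    (hS.contDiffAt (h.isOpen.mem_nhds hp)).differentiableAt (by simp)
  have h1 : ∀ {F : Type _} [NormedAddCommGroup F] [NormedSpace ℝ F] {H : E → F},
      DifferentiableAt ℝ H p → HasFDerivAt (fun z : E × E => H z.1)
        ((fderiv ℝ H p).comp (ContinuousLinearMap.fst ℝ E E)) (p, X) := fun hH =>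
    HasFDerivAt.comp (p, X) hH.hasFDerivAt hasFDerivAt_fst
  have h2 : HasFDerivAt (fun z : E × E => z.2) (ContinuousLinearMap.snd ℝ E E) (p, X) :=
    hasFDerivAt_snd
  have hG := h1 (h.differentiableAt hp)
  have e : (fun z => gradEq G S z u) = fun z : E × E => -chr G z.1 u z.2 + S z.1 u
      + G z.1 z.2 u • z.2 - ((2⁻¹ : ℝ) * G z.1 z.2 z.2) • u := by
    ext z; exact gradEq_apply S z.1 z.2 u
  have h3 := ((((((h1 (h.differentiableAt_chr hp)).clm_apply (hasFDerivAt_const u _)).clm_apply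
    h2).neg).add ((h1 hSd).clm_apply (hasFDerivAt_const u _))).add
    (((hG.clm_apply h2).clm_apply (hasFDerivAt_const u _)).smul h2)).sub
    ((((hG.clm_apply h2).clm_apply h2).const_mul (2⁻¹ : ℝ)).smul_const u)
  have h4 := hd.hasFDerivAt.clm_apply (hasFDerivAt_const u (p, X))
  rw [e] at h4
  have := congrArg (fun l : E × E →L[ℝ] E => l (a, b)) (h4.unique h3)
  simp at this
  rw [this, h.symm p b X]
  module

/-- The equation for the gradient of a conformal factor that makes the metric flat can be solved. -/
theorem exists_gradient (h : IsMetricOn G U) (hE : 4 ≤ finrank ℝ E) {S : E → E →L[ℝ] E}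
    (hS : ContDiffOn ℝ ∞ S U)
    (hcurv : ∀ q ∈ U, ∀ x y z, curv (chr G) q x y z = knOp (G q) (S q) x y z)
    (hSs : ∀ q ∈ U, ∀ x y, G q (S q x) y = G q (S q y) x) (hp : p ∈ U) :
    ∃ (X : E → E) (W : Set E), IsOpen W ∧ p ∈ W ∧ W ⊆ U ∧ ContDiffOn ℝ ∞ X W ∧
      ∀ q ∈ W, ∀ x, fderiv ℝ X q x + chr G q x (X q) =
        S q x + G q (X q) x • X q - ((2⁻¹ : ℝ) * G q (X q) (X q)) • x := by
  -- Integrability holds for every value of `X`, so any initial value would do; zero is taken.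
  obtain ⟨X, W, hW, hpW, hX, hsol⟩ := TotalDifferential.exists_solution
    (h.isOpen.prod isOpen_univ) (contDiffOn_gradEq h hS) (fun z hz a b => by
      obtain ⟨q, X⟩ := z
      rw [fderiv_gradEq h hS hz.1, fderiv_gradEq h hS hz.1]
      exact integrability h hcurv hz.1 (hSs q hz.1)
        (fun a x => cotton_eq_zero h hE hS hcurv hz.1 a x) X _ (gradEq_apply S q X) a b)
    (x₀ := p) (u₀ := 0) ⟨hp, trivial⟩
  refine ⟨X, W, hW, hpW, fun q hq => (hsol q hq).1.1, hX, fun q hq x => ?_⟩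
  rw [(hsol q hq).2.fderiv, gradEq_apply]
  abel

/-- A local Poincaré lemma, obtained from the Frobenius theorem with a right-hand side that ignores
the unknown. The symmetry hypothesis says that the one-form `G (X, ·)` is closed. -/
theorem exists_potential (h : IsMetricOn G U) {X : E → E} (hX : ContDiffOn ℝ ∞ X U)
    (hsymm : ∀ q ∈ U, ∀ x y, G q (fderiv ℝ X q x + chr G q x (X q)) y =
      G q (fderiv ℝ X q y + chr G q y (X q)) x) (hp : p ∈ U) :
    ∃ (f : E → ℝ) (W : Set E), IsOpen W ∧ p ∈ W ∧ W ⊆ U ∧ ContDiffOn ℝ ∞ f W ∧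
      ∀ q ∈ W, HasFDerivAt f (G q (X q)) q := by
  have hGX : ContDiffOn ℝ ∞ (fun q => G q (X q)) U := h.contDiffOn.clm_apply hX
  have hd : ∀ q ∈ U, ∀ t : ℝ, ∀ a b s, fderiv ℝ (fun z : E × ℝ => G z.1 (X z.1)) (q, t) (a, s) b =
      fderiv ℝ (fun q => G q (X q) b) q a := by
    intro q hq t a b s
    have hGXq : DifferentiableAt ℝ (fun q => G q (X q)) q :=
      (hGX.contDiffAt (h.isOpen.mem_nhds hq)).differentiableAt (by simp)
    have h1 : HasFDerivAt (fun z : E × ℝ => G z.1 (X z.1))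
        ((fderiv ℝ (fun q => G q (X q)) q).comp (ContinuousLinearMap.fst ℝ E ℝ)) (q, t) :=
      HasFDerivAt.comp (g := fun q => G q (X q)) (f := fun z : E × ℝ => z.1) (q, t)
        hGXq.hasFDerivAt hasFDerivAt_fst
    have h2 := hGXq.hasFDerivAt.clm_apply (hasFDerivAt_const b q)
    rw [h1.fderiv, h2.fderiv]
    simp
  obtain ⟨f, W, hW, hpW, hf, hsol⟩ := TotalDifferential.exists_solution (F := ℝ)
    (Φ := fun z => G z.1 (X z.1)) (h.isOpen.prod isOpen_univ)
    (hGX.comp contDiffOn_fst fun z hz => hz.1) (fun z hz a b => by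
      have hXq : DifferentiableAt ℝ X z.1 :=
        (hX.contDiffAt (h.isOpen.mem_nhds hz.1)).differentiableAt (by simp)
      rw [hd z.1 hz.1, hd z.1 hz.1, fderiv_gradient h hz.1 hXq, fderiv_gradient h hz.1 hXq,
        h.chr_symm hz.1, hsymm z.1 hz.1])
    (x₀ := p) (u₀ := 0) ⟨hp, trivial⟩
  exact ⟨f, W, hW, hpW, fun q hq => (hsol q hq).1.1, hf, fun q hq => (hsol q hq).2⟩

theorem curv_conformal_metric (h : IsMetricOn G U) {f : E → ℝ} (hf : ContDiffOn ℝ ∞ f U)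
    {X : E → E} (hX : DifferentiableAt ℝ X p) (hfX : ∀ q ∈ U, HasFDerivAt f (G q (X q)) q)
    (hp : p ∈ U) {S : E → E} (hS : ∀ x, fderiv ℝ X p x + chr G p x (X p) =
      S x + G p (X p) x • X p - ((2⁻¹ : ℝ) * G p (X p) (X p)) • x)
    (hsymm : ∀ x y, G p (S x) y = G p (S y) x) (x y z : E) :
    curv (chr fun q => Real.exp (2 * f q) • G q) p x y z =
      curv (chr G) p x y z - knOp (G p) S x y z := by
  have h' := h.conformal hf
  exact curv_conformal h hp
    (fun q hq u v => christoffel_conformal h h' (fun _ _ => rfl) hq (hfX q hq) u v)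
    (h'.differentiableAt_chr hp) hX S hS hsymm x y z

/-- A metric of dimension at least four whose Weyl tensor vanishes is conformally flat. -/
theorem exists_conformal_factor (h : IsMetricOn G U) (hE : 4 ≤ finrank ℝ E) {S : E → E →L[ℝ] E}
    (hS : ContDiffOn ℝ ∞ S U)
    (hcurv : ∀ q ∈ U, ∀ x y z, curv (chr G) q x y z = knOp (G q) (S q) x y z)
    (hSs : ∀ q ∈ U, ∀ x y, G q (S q x) y = G q (S q y) x) (hp : p ∈ U) :
    ∃ (f : E → ℝ) (W : Set E), IsOpen W ∧ p ∈ W ∧ W ⊆ U ∧ ContDiffOn ℝ ∞ f W ∧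
      ∀ q ∈ W, ∀ x y z w, riemannFun (fun q => Real.exp (2 * f q) • G q) q x y z w = 0 := by
  obtain ⟨X, W₁, hW₁, hp₁, hsub₁, hX, hX'⟩ := exists_gradient h hE hS hcurv hSs hp
  have h₁ := h.mono hW₁ hsub₁
  obtain ⟨f, W, hW, hpW, hsub, hf, hf'⟩ := exists_potential h₁ hX (fun q hq x y => by
    rw [hX' q hq, hX' q hq]
    have s1 := hSs q (hsub₁ hq) x y
    have s2 := h.symm q x y
    simp only [map_add, map_sub, map_smul, add_apply, sub_apply, smul_apply, smul_eq_mul]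
    rw [s1, s2]
    ring) hp₁
  refine ⟨f, W, hW, hpW, hsub.trans hsub₁, hf, fun q hq x y z w => ?_⟩
  have h₂ := h₁.mono hW hsub
  rw [(h₂.conformal hf).riemannFun_eq hq, curv_conformal_metric h₂ hf
    ((hX.contDiffAt (hW₁.mem_nhds (hsub hq))).differentiableAt (by simp)) hf' hq (hX' q (hsub hq))
    (hSs q (hsub₁ (hsub hq))), hcurv q (hsub₁ (hsub hq))]
  simp

/-- The curvature tensor of a conformally flat metric. -/
theorem eq_kulkarniNomizu_of_conformallyFlat (h : IsMetricOn G U) {f : E → ℝ}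
    (hf : ContDiffOn ℝ ∞ f U) (hp : p ∈ U)
    (hflat : ∀ x y z w, riemannFun (fun q => Real.exp (2 * f q) • G q) p x y z w = 0) :
    ∃ B : E → E → ℝ, ∀ x y z w, riemannFun G p x y z w =
      G p x z * B y w + G p y w * B x z - G p x w * B y z - G p y z * B x w := by
  set X : E → E := fun q => (G q).inverse (fderiv ℝ f q) with hXdef
  have hDf : ContDiffOn ℝ ∞ (fderiv ℝ f) U := hf.fderiv_of_isOpen h.isOpen (by simp)
  have hX : DifferentiableAt ℝ X p := ((h.contDiffOn_inverse.clm_apply hDf).contDiffAt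
    (h.isOpen.mem_nhds hp)).differentiableAt (by simp)
  have hGX : ∀ q ∈ U, G q (X q) = fderiv ℝ f q := fun q hq => h.apply_inverse hq _
  have hfX : ∀ q ∈ U, HasFDerivAt f (G q (X q)) q := fun q hq => by
    rw [hGX q hq]
    exact ((hf.contDiffAt (h.isOpen.mem_nhds hq)).differentiableAt (by simp)).hasFDerivAt
  -- `S` is read off from the gradient of `f`, so that the hypothesis of the conformal formula holds
  -- by definition; its symmetry is that of the Hessian of `f`.
  set S : E → E := fun x => fderiv ℝ X p x + chr G p x (X p) - G p (X p) x • X p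
    + ((2⁻¹ : ℝ) * G p (X p) (X p)) • x with hSdef
  have hess : ∀ x y, G p (fderiv ℝ X p x + chr G p x (X p)) y =
      fderiv ℝ (fderiv ℝ f) p x y - G p (X p) (chr G p x y) := by
    intro x y
    have e1 : (fun q => G q (X q) y) =ᶠ[𝓝 p] fun q => fderiv ℝ f q y := by
      filter_upwards [h.isOpen.mem_nhds hp] with q hq
      rw [hGX q hq]
    have hd : DifferentiableAt ℝ (fderiv ℝ f) p :=
      (hDf.contDiffAt (h.isOpen.mem_nhds hp)).differentiableAt (by simp)
    have e2 := (hd.hasFDerivAt.clm_apply (hasFDerivAt_const y p)).fderiv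
    have e3 := fderiv_gradient h hp hX y x
    rw [e1.fderiv_eq, e2] at e3
    simp at e3
    rw [e3]
    simp
  have hSs : ∀ x y, G p (S x) y = G p (S y) x := by
    intro x y
    have h1 := hess x y
    have h2 := hess y x
    rw [fderiv_fderiv_symm (hf.contDiffAt (h.isOpen.mem_nhds hp)) y x, h.chr_symm hp y x] at h2
    have h3 := h.symm p x y
    simp only [hSdef]
    simp only [map_add, map_sub, map_smul, add_apply, sub_apply, smul_apply, smul_eq_mul] at h1 h2 ⊢
    rw [h3]
    linarith
  have key := curv_conformal_metric h hf hX hfX hp (S := S) (fun x => by simp only [hSdef]; abel)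
    hSs
  refine ⟨fun x y => G p (S x) y, fun x y z w => ?_⟩
  have h' := h.conformal hf
  have e1 := hflat x y z w
  rw [h'.riemannFun_eq hp, key, neg_eq_zero] at e1
  have e2 : G p (curv (chr G) p x y z) w = G p (knOp (G p) S x y z) w := by
    simp only [smul_apply, smul_eq_mul, map_sub, sub_apply] at e1
    rw [← mul_sub] at e1
    have := (mul_eq_zero.1 e1).resolve_left (Real.exp_ne_zero _)
    exact sub_eq_zero.1 this
  rw [h.riemannFun_eq hp, e2, knOp]
  simp only [map_add, map_sub, map_smul, add_apply, sub_apply, smul_apply, smul_eq_mul]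
  ring

end CoordMetric

/-! ### The Schouten operator as a smooth field -/

namespace CoordMetric

set_option maxSynthPendingDepth 3

open Filter Topology

variable {E : Type*} [NormedAddCommGroup E] [NormedSpace ℝ E] [FiniteDimensional ℝ E]

theorem contDiffOn_trace {F : Type*} [NormedAddCommGroup F] [NormedSpace ℝ F] {U : Set F}
    {A : F → E →ₗ[ℝ] E} (hA : ∀ x, ContDiffOn ℝ ∞ (fun q => A q x) U) :
    ContDiffOn ℝ ∞ (fun q => LinearMap.trace ℝ E (A q)) U := by
  have e : (fun q => LinearMap.trace ℝ E (A q)) = fun q =>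
      ∑ i, LinearMap.toContinuousLinearMap ((finBasis ℝ E).coord i) (A q (finBasis ℝ E i)) := by
    ext q
    rw [LinearMap.trace_eq_matrix_trace ℝ (finBasis ℝ E), Matrix.trace]
    refine Finset.sum_congr rfl fun i _ => ?_
    rw [Matrix.diag_apply, LinearMap.toMatrix_apply]
    rfl
  rw [e]
  exact ContDiffOn.sum fun i _ =>
    (LinearMap.toContinuousLinearMap ((finBasis ℝ E).coord i)).contDiff.comp_contDiffOn (hA _)

/-- The Ricci tensor of a connection. -/
def ricMap (Γ : E → E →L[ℝ] E →L[ℝ] E) (q : E) : E →L[ℝ] E →L[ℝ] ℝ :=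
  LinearMap.toContinuousBilinearMap (LinearMap.mk₂ ℝ
    (fun v w => LinearMap.trace ℝ E (curvEnd Γ q v w))
    (fun v v' w => by
      rw [← map_add]; congr 1; ext x
      simp only [curvEnd, LinearMap.coe_mk, AddHom.coe_mk, curv, map_add, add_apply,
        LinearMap.add_apply]
      abel)
    (fun a v w => by
      rw [← map_smul]; congr 1; ext x
      simp only [curvEnd, LinearMap.coe_mk, AddHom.coe_mk, curv, map_smul, smul_apply,
        LinearMap.smul_apply]
      module)
    (fun v w w' => by
      rw [← map_add]; congr 1; ext x
      simp only [curvEnd, LinearMap.coe_mk, AddHom.coe_mk, curv, map_add,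
        LinearMap.add_apply]
      abel)
    (fun a v w => by
      rw [← map_smul]; congr 1; ext x
      simp only [curvEnd, LinearMap.coe_mk, AddHom.coe_mk, curv, map_smul,
        LinearMap.smul_apply]
      module))

theorem ricMap_apply (Γ : E → E →L[ℝ] E →L[ℝ] E) (q v w : E) :
    ricMap Γ q v w = LinearMap.trace ℝ E (curvEnd Γ q v w) := rfl

variable {G : E → E →L[ℝ] E →L[ℝ] ℝ} {U : Set E} {p : E}

theorem ricMap_eq_sum (h : IsMetricOn G U) (hp : p ∈ U) {n : ℕ} {e : Basis (Fin n) ℝ E}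
    (h1 : ∀ i, G p (e i) (e i) = 1) (h0 : ∀ i j, i ≠ j → G p (e i) (e j) = 0) (v w : E) :
    ricMap (chr G) p v w = ∑ i, riemannFun G p (e i) v (e i) w := by
  rw [ricMap_apply, trace_eq_sum h1 h0]
  refine Finset.sum_congr rfl fun i _ => ?_
  rw [(h.isCurvatureLike hp).skew', h.riemannFun_eq hp, neg_neg]
  rfl

theorem contDiffOn_ricMap (h : IsMetricOn G U) : ContDiffOn ℝ ∞ (ricMap (chr G)) U := by
  refine contDiffOn_clm_apply.2 fun v => contDiffOn_clm_apply.2 fun w => ?_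
  simp only [ricMap_apply]
  refine contDiffOn_trace fun x => ?_
  have hΓ := h.contDiffOn_chr
  have hD : ContDiffOn ℝ ∞ (fderiv ℝ (chr G)) U := hΓ.fderiv_of_isOpen h.isOpen (by simp)
  have h1 : ∀ x y : E, ContDiffOn ℝ ∞ (fun q => fderiv ℝ (chr G) q x y w) U := fun x y =>
    ((hD.clm_apply contDiffOn_const).clm_apply contDiffOn_const).clm_apply contDiffOn_const
  have h2 : ∀ x y : E, ContDiffOn ℝ ∞ (fun q => chr G q x (chr G q y w)) U := fun x y =>
    (hΓ.clm_apply contDiffOn_const).clm_apply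
      ((hΓ.clm_apply contDiffOn_const).clm_apply contDiffOn_const)
  exact (((h1 x v).sub (h1 v x)).add (h2 x v)).sub (h2 v x)

/-- The Ricci operator. -/
def ricOp (G : E → E →L[ℝ] E →L[ℝ] ℝ) (q : E) : E →L[ℝ] E :=
  (G q).inverse.comp (ricMap (chr G) q)

/-- The Schouten operator. -/
def schoutenOp (G : E → E →L[ℝ] E →L[ℝ] ℝ) (q : E) : E →L[ℝ] E :=
  ((finrank ℝ E : ℝ) - 2)⁻¹ • (ricOp G q -
    (LinearMap.trace ℝ E (ricOp G q) / (2 * ((finrank ℝ E : ℝ) - 1))) • ContinuousLinearMap.id ℝ E)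

theorem contDiffOn_schoutenOp (h : IsMetricOn G U) : ContDiffOn ℝ ∞ (schoutenOp G) U := by
  have hQ : ContDiffOn ℝ ∞ (ricOp G) U := h.contDiffOn_inverse.clm_comp (contDiffOn_ricMap h)
  have ht : ContDiffOn ℝ ∞ (fun q => LinearMap.trace ℝ E (ricOp G q)) U :=
    contDiffOn_trace fun x => hQ.clm_apply contDiffOn_const
  have h1 : ContDiffOn ℝ ∞ (fun q => (LinearMap.trace ℝ E (ricOp G q) /
      (2 * ((finrank ℝ E : ℝ) - 1))) • ContinuousLinearMap.id ℝ E) U :=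
    (ht.div_const _).smul contDiffOn_const
  exact ContDiffOn.const_smul _ (hQ.sub h1)

/-- Contracting gives `Ric = (n - 2) B + (tr B) g` and scalar curvature `2 (n - 1) tr B`, which can
be solved for `B`. A form `B` known to exist only point by point is thus given by an operator that
varies smoothly. -/
theorem schoutenOp_spec (h : IsMetricOn G U) (hE : 3 ≤ finrank ℝ E) (hp : p ∈ U)
    (B : E →ₗ[ℝ] E →ₗ[ℝ] ℝ) (hBs : ∀ x y, B x y = B y x)
    (hB : ∀ x y z w, riemannFun G p x y z w =
      G p x z * B y w + G p y w * B x z - G p x w * B y z - G p y z * B x w) (v w : E) :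
    G p (schoutenOp G p v) w = B v w := by
  obtain ⟨e, h1, h0⟩ := exists_orthonormal_basis (G p) (h.symm p) (h.pos p hp)
  have hsum : ∀ (l : E →ₗ[ℝ] ℝ) (w : E), ∑ i, G p (e i) w * l (e i) = l w := by
    intro l w
    conv_rhs => rw [← e.sum_repr w]
    rw [map_sum]
    refine Finset.sum_congr rfl fun j _ => ?_
    rw [map_smul, smul_eq_mul, ← repr_orthonormal h1 h0, h.symm]
  have hric : ∀ v w, ricMap (chr G) p v w =
      ((finrank ℝ E : ℝ) - 2) * B v w + (∑ i, B (e i) (e i)) * G p v w := by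
    intro v w
    rw [ricMap_eq_sum h hp h1 h0]
    simp only [hB, h1, one_mul, Finset.sum_sub_distrib, Finset.sum_add_distrib]
    have s1 := hsum (B v) w
    have s2 := hsum (B w) v
    have e1 : ∑ i, G p v (e i) * B (e i) w = B v w := by
      rw [hBs v, ← s2]
      exact Finset.sum_congr rfl fun i _ => by rw [h.symm, hBs]
    rw [s1, e1, ← Finset.mul_sum, Finset.sum_const, Finset.card_univ, Fintype.card_fin,
      nsmul_eq_mul]
    ring
  have hQ : ∀ v w, G p (ricOp G p v) w = ricMap (chr G) p v w := fun v w => by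
    rw [ricOp, ContinuousLinearMap.comp_apply, h.apply_inverse hp]
  have hE3 : (3 : ℝ) ≤ finrank ℝ E := by exact_mod_cast hE
  have htr : LinearMap.trace ℝ E (ricOp G p) =
      2 * ((finrank ℝ E : ℝ) - 1) * ∑ i, B (e i) (e i) := by
    rw [trace_eq_sum h1 h0]
    simp only [ContinuousLinearMap.coe_coe, hQ, hric, h1, Finset.sum_add_distrib, ← Finset.mul_sum]
    simp
    ring
  have hn2 : (finrank ℝ E : ℝ) - 2 ≠ 0 := by linarith
  have hn1 : (finrank ℝ E : ℝ) - 1 ≠ 0 := by linarith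
  rw [schoutenOp, htr]
  simp only [smul_apply, sub_apply, map_smul, map_sub, smul_eq_mul, hQ, hric,
    ContinuousLinearMap.id_apply]
  field_simp
  ring

theorem curv_eq_knOp_schoutenOp (h : IsMetricOn G U) (hE : 3 ≤ finrank ℝ E) (hp : p ∈ U)
    (B : E →ₗ[ℝ] E →ₗ[ℝ] ℝ) (hBs : ∀ x y, B x y = B y x)
    (hB : ∀ x y z w, riemannFun G p x y z w =
      G p x z * B y w + G p y w * B x z - G p x w * B y z - G p y z * B x w) :
    (∀ x y z, curv (chr G) p x y z = knOp (G p) (schoutenOp G p) x y z) ∧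
      ∀ x y, G p (schoutenOp G p x) y = G p (schoutenOp G p y) x := by
  have hS := schoutenOp_spec h hE hp B hBs hB
  refine ⟨fun x y z => h.ext_left hp fun w => ?_, fun x y => by rw [hS, hS, hBs]⟩
  have e := hB x y z w
  rw [h.riemannFun_eq hp] at e
  simp only [knOp, map_add, map_sub, map_smul, add_apply, sub_apply, smul_apply, smul_eq_mul, hS]
  linarith

/-- A metric of dimension at least four whose curvature tensor is a Kulkarni-Nomizu product with
the metric is conformally flat. -/
theorem exists_conformal_factor_of_kulkarniNomizu (h : IsMetricOn G U) (hE : 4 ≤ finrank ℝ E)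
    (hB : ∀ q ∈ U, ∃ B : E →ₗ[ℝ] E →ₗ[ℝ] ℝ, (∀ x y, B x y = B y x) ∧
      ∀ x y z w, riemannFun G q x y z w =
        G q x z * B y w + G q y w * B x z - G q x w * B y z - G q y z * B x w) (hp : p ∈ U) :
    ∃ (f : E → ℝ) (W : Set E), IsOpen W ∧ p ∈ W ∧ W ⊆ U ∧ ContDiffOn ℝ ∞ f W ∧
      ∀ q ∈ W, ∀ x y z w, riemannFun (fun q => Real.exp (2 * f q) • G q) q x y z w = 0 := by
  have key : ∀ q ∈ U, (∀ x y z, curv (chr G) q x y z = knOp (G q) (schoutenOp G q) x y z) ∧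
      ∀ x y, G q (schoutenOp G q x) y = G q (schoutenOp G q y) x := fun q hq => by
    obtain ⟨B, hBs, hB'⟩ := hB q hq
    exact curv_eq_knOp_schoutenOp h (by omega) hq B hBs hB'
  exact exists_conformal_factor h hE (contDiffOn_schoutenOp h) (fun q hq => (key q hq).1)
    (fun q hq => (key q hq).2) hp

end CoordMetric

open Bundle

/-! ### Preferred charts and transition maps -/

namespace Riem

set_option maxSynthPendingDepth 3

open Filter Topology Set

variable {n : ℕ} {M : Type*} [TopologicalSpace M] [ChartedSpace (EuclideanSpace ℝ (Fin n)) M]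

/-- The derivative of the inverse of the preferred chart at `m`, with the tangent spaces identified
with the model space. -/
def symmDeriv (n : ℕ) {M : Type*} [TopologicalSpace M] [ChartedSpace (EuclideanSpace ℝ (Fin n)) M]
    (m : M) (y : EuclideanSpace ℝ (Fin n)) :
    EuclideanSpace ℝ (Fin n) →L[ℝ] EuclideanSpace ℝ (Fin n) :=
  mfderiv 𝓘(ℝ, EuclideanSpace ℝ (Fin n)) (𝓡 n) (extChartAt (𝓡 n) m).symm y

/-- A field of bilinear forms on the tangent spaces, as a map on the model space. -/
def onModel (h : (x : M) → LinearMap.BilinForm ℝ (TangentSpace (𝓡 n) x)) (x : M)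
    (u v : EuclideanSpace ℝ (Fin n)) : ℝ :=
  h x u v

theorem inChart_apply (h : (x : M) → LinearMap.BilinForm ℝ (TangentSpace (𝓡 n) x)) (m : M)
    (y u v : EuclideanSpace ℝ (Fin n)) : inChart n h m y u v =
      onModel h ((extChartAt (𝓡 n) m).symm y) (symmDeriv n m y u) (symmDeriv n m y v) := rfl

theorem isOpen_target (m : M) : IsOpen (extChartAt (𝓡 n) m).target := isOpen_extChartAt_target m

theorem isOpen_inter_preimage_symm (x : M) {U : Set M} (hU : IsOpen U) :
    IsOpen ((extChartAt (𝓡 n) x).target ∩ (extChartAt (𝓡 n) x).symm ⁻¹' U) :=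
  (continuousOn_extChartAt_symm x).isOpen_inter_preimage (isOpen_target x) hU

variable [IsManifold (𝓡 n) ∞ M]

theorem mdifferentiableAt_symm {m : M} {y : EuclideanSpace ℝ (Fin n)}
    (hy : y ∈ (extChartAt (𝓡 n) m).target) :
    MDifferentiableAt 𝓘(ℝ, EuclideanSpace ℝ (Fin n)) (𝓡 n) (extChartAt (𝓡 n) m).symm y :=
  ((contMDiffOn_extChartAt_symm (n := ∞) m).contMDiffAt
    ((isOpen_target m).mem_nhds hy)).mdifferentiableAt (by simp)

theorem symmDeriv_injective {m : M} {y : EuclideanSpace ℝ (Fin n)}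
    (hy : y ∈ (extChartAt (𝓡 n) m).target) : Function.Injective (symmDeriv n m y) := by
  have : IsManifold (𝓡 n) 1 M := IsManifold.of_le (n := ∞) (by simp)
  have h := mfderiv_extChartAt_comp_mfderivWithin_extChartAt_symm (I := 𝓡 n) hy
  rw [ModelWithCorners.range_eq_univ, mfderivWithin_univ] at h
  intro a b hab
  have ha := congrArg (fun l => l a) h
  have hb := congrArg (fun l => l b) h
  exact ha.symm.trans ((congrArg _ hab).trans hb)

theorem symmDeriv_self (m : M) : symmDeriv n m (extChartAt (𝓡 n) m m) =
    ContinuousLinearMap.id ℝ (EuclideanSpace ℝ (Fin n)) := by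
  have : IsManifold (𝓡 n) 1 M := IsManifold.of_le (n := ∞) (by simp)
  have h := mfderivWithin_range_extChartAt_symm (I := 𝓡 n) (x := m)
  rw [ModelWithCorners.range_eq_univ, mfderivWithin_univ] at h
  exact h

/-- The preferred chart at `m` has the identity as its derivative at `m`, so the coordinate metric
there is the inner product of the tangent space itself. -/
theorem inChart_self (h : (x : M) → LinearMap.BilinForm ℝ (TangentSpace (𝓡 n) x)) (m : M)
    (u v : EuclideanSpace ℝ (Fin n)) :
    inChart n h m (extChartAt (𝓡 n) m m) u v = onModel h m u v := by
  rw [inChart_apply, symmDeriv_self, extChartAt_to_inv]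
  rfl

section Transition

/-- The change of coordinates from the preferred chart at `x` to the preferred chart at `m`. -/
def transition (n : ℕ) {M : Type*} [TopologicalSpace M] [ChartedSpace (EuclideanSpace ℝ (Fin n)) M]
    (x m : M) (q : EuclideanSpace ℝ (Fin n)) : EuclideanSpace ℝ (Fin n) :=
  extChartAt (𝓡 n) m ((extChartAt (𝓡 n) x).symm q)

variable {x m : M} {q : EuclideanSpace ℝ (Fin n)}

theorem contDiffOn_transition (x m : M) : ContDiffOn ℝ ∞ (transition n x m)
    ((extChartAt (𝓡 n) x).target ∩ (extChartAt (𝓡 n) x).symm ⁻¹' (extChartAt (𝓡 n) m).source) := by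
  rw [← contMDiffOn_iff_contDiffOn]
  have h1 := contMDiffOn_extChartAt (I := 𝓡 n) (n := ∞) (x := m)
  rw [← extChartAt_source (𝓡 n)] at h1
  exact h1.comp ((contMDiffOn_extChartAt_symm (n := ∞) x).mono inter_subset_left)
    inter_subset_right

theorem symmDeriv_transition (hq : q ∈ (extChartAt (𝓡 n) x).target ∩
      (extChartAt (𝓡 n) x).symm ⁻¹' (extChartAt (𝓡 n) m).source) (u : EuclideanSpace ℝ (Fin n)) :
    symmDeriv n x q u = symmDeriv n m (transition n x m q) (fderiv ℝ (transition n x m) q u) := by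
  have hopen := isOpen_inter_preimage_symm (n := n) x (isOpen_extChartAt_source (I := 𝓡 n) m)
  have htr : DifferentiableAt ℝ (transition n x m) q :=
    ((contDiffOn_transition x m).contDiffAt (hopen.mem_nhds hq)).differentiableAt (by simp)
  have htm : transition n x m q ∈ (extChartAt (𝓡 n) m).target :=
    (extChartAt (𝓡 n) m).map_source hq.2
  have e1 : (extChartAt (𝓡 n) x).symm =ᶠ[𝓝 q] (extChartAt (𝓡 n) m).symm ∘ transition n x m := by
    filter_upwards [hopen.mem_nhds hq] with y hy
    exact ((extChartAt (𝓡 n) m).left_inv hy.2).symm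
  have e2 := e1.mfderiv_eq (I := 𝓘(ℝ, EuclideanSpace ℝ (Fin n))) (I' := 𝓡 n)
  have e3 := mfderiv_comp (I := 𝓘(ℝ, EuclideanSpace ℝ (Fin n)))
    (I' := 𝓘(ℝ, EuclideanSpace ℝ (Fin n))) (I'' := 𝓡 n) q (mdifferentiableAt_symm htm)
    htr.mdifferentiableAt
  have e4 : symmDeriv n x q = (symmDeriv n m (transition n x m q)).comp
      (mfderiv 𝓘(ℝ, EuclideanSpace ℝ (Fin n)) 𝓘(ℝ, EuclideanSpace ℝ (Fin n))
        (transition n x m) q) := e2.trans e3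
  rw [e4, mfderiv_eq_fderiv]
  rfl

/-- The coordinate expressions in two charts are pullbacks of each other, which is the hypothesis of
`riemannFun_change`. -/
theorem inChart_transition (h : (x : M) → LinearMap.BilinForm ℝ (TangentSpace (𝓡 n) x))
    (hq : q ∈ (extChartAt (𝓡 n) x).target ∩
      (extChartAt (𝓡 n) x).symm ⁻¹' (extChartAt (𝓡 n) m).source) (u v : EuclideanSpace ℝ (Fin n)) :
    inChart n h x q u v = inChart n h m (transition n x m q) (fderiv ℝ (transition n x m) q u)
      (fderiv ℝ (transition n x m) q v) := by
  rw [inChart_apply, inChart_apply, ← symmDeriv_transition hq, ← symmDeriv_transition hq,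
    transition, (extChartAt (𝓡 n) m).left_inv hq.2]

end Transition

end Riem

open Bundle

/-! ### The metric and its curvature in charts -/

namespace Riem

set_option maxSynthPendingDepth 3

open Filter Topology Set CoordMetric

variable {n : ℕ} {M : Type*} [TopologicalSpace M] [ChartedSpace (EuclideanSpace ℝ (Fin n)) M]

section Metric

variable [RiemannianBundle (fun x : M => TangentSpace (𝓡 n) x)]

/-- The Riemannian metric as a field of bilinear forms. -/
def metricField (n : ℕ) (M : Type*) [TopologicalSpace M]
    [ChartedSpace (EuclideanSpace ℝ (Fin n)) M]
    [RiemannianBundle (fun x : M => TangentSpace (𝓡 n) x)] (x : M) :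
    LinearMap.BilinForm ℝ (TangentSpace (𝓡 n) x) :=
  innerₗ (TangentSpace (𝓡 n) x)

/-- The Riemannian metric, conformally changed, as a field of bilinear forms. -/
def confField (f : M → ℝ) (x : M) : LinearMap.BilinForm ℝ (TangentSpace (𝓡 n) x) :=
  Real.exp (2 * f x) • innerₗ (TangentSpace (𝓡 n) x)

theorem onModel_metricField_symm (x : M) (u v : EuclideanSpace ℝ (Fin n)) :
    onModel (metricField n M) x u v = onModel (metricField n M) x v u :=
  real_inner_comm (F := TangentSpace (𝓡 n) x) _ _

theorem onModel_metricField_pos (x : M) {u : EuclideanSpace ℝ (Fin n)} (hu : u ≠ 0) :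
    0 < onModel (metricField n M) x u u :=
  (real_inner_self_pos (F := TangentSpace (𝓡 n) x)).2 hu

theorem inChart_confField (f : M → ℝ) (m : M) : inChart n (confField f) m = fun q =>
    Real.exp (2 * f ((extChartAt (𝓡 n) m).symm q)) • inChart n (metricField n M) m q := by
  ext q u v
  rfl

end Metric

variable [IsManifold (𝓡 n) ∞ M]

/-- Coordinate vector fields are smooth sections of the tangent bundle; pairing them turns
smoothness of the bundle metric into smoothness of its coefficients. -/
theorem contMDiffOn_symmDeriv (m : M) (u : EuclideanSpace ℝ (Fin n)) :
    ContMDiffOn 𝓘(ℝ, EuclideanSpace ℝ (Fin n)) (𝓡 n).tangent ∞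
      (fun y => (⟨(extChartAt (𝓡 n) m).symm y, symmDeriv n m y u⟩ : TangentBundle (𝓡 n) M))
      (extChartAt (𝓡 n) m).target := by
  have : IsManifold (𝓡 n) 1 M := IsManifold.of_le (n := ∞) (by simp)
  have hu : UniqueMDiffOn 𝓘(ℝ, EuclideanSpace ℝ (Fin n)) (extChartAt (𝓡 n) m).target :=
    (isOpen_target m).uniqueMDiffOn
  have h1 := (contMDiffOn_extChartAt_symm (I := 𝓡 n) (n := ∞) m).contMDiffOn_tangentMapWithin
    (m := ∞) (by simp) hu
  have h2 : ContMDiffOn 𝓘(ℝ, EuclideanSpace ℝ (Fin n)) 𝓘(ℝ, EuclideanSpace ℝ (Fin n)).tangent ∞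
      (fun y => (⟨y, u⟩ : TangentBundle 𝓘(ℝ, EuclideanSpace ℝ (Fin n)) (EuclideanSpace ℝ (Fin n))))
      (extChartAt (𝓡 n) m).target :=
    contMDiffOn_vectorSpace_iff_contDiffOn.2 contDiffOn_const
  refine (h1.comp h2 fun y hy => hy).congr fun y hy => ?_
  simp only [Function.comp_apply, tangentMapWithin]
  rw [mfderivWithin_eq_mfderiv (hu y hy) (mdifferentiableAt_symm hy)]
  rfl

/-- The curvature tensor in the preferred chart at `m`, in terms of the chart at another point. -/
theorem riemannFun_transition {h : (x : M) → LinearMap.BilinForm ℝ (TangentSpace (𝓡 n) x)}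
    {U : Set M} (hU : IsOpen U) (hh : ∀ m : M, IsMetricOn (inChart n h m)
      ((extChartAt (𝓡 n) m).target ∩ (extChartAt (𝓡 n) m).symm ⁻¹' U)) {m x : M}
    (hx : x ∈ (extChartAt (𝓡 n) m).source) (hxU : x ∈ U) (a b c d : EuclideanSpace ℝ (Fin n)) :
    riemannFun (inChart n h x) (extChartAt (𝓡 n) x x) a b c d =
      riemannFun (inChart n h m) (extChartAt (𝓡 n) m x)
        (fderiv ℝ (transition n x m) (extChartAt (𝓡 n) x x) a)
        (fderiv ℝ (transition n x m) (extChartAt (𝓡 n) x x) b)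
        (fderiv ℝ (transition n x m) (extChartAt (𝓡 n) x x) c)
        (fderiv ℝ (transition n x m) (extChartAt (𝓡 n) x x) d) := by
  set W : Set (EuclideanSpace ℝ (Fin n)) := (extChartAt (𝓡 n) x).target ∩
    (extChartAt (𝓡 n) x).symm ⁻¹' ((extChartAt (𝓡 n) m).source ∩ U) with hW
  have hWo : IsOpen W :=
    isOpen_inter_preimage_symm x ((isOpen_extChartAt_source (I := 𝓡 n) m).inter hU)
  have hpW : extChartAt (𝓡 n) x x ∈ W := by
    refine ⟨mem_extChartAt_target x, ?_⟩
    rw [mem_preimage, extChartAt_to_inv]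
    exact ⟨hx, hxU⟩
  have e : transition n x m (extChartAt (𝓡 n) x x) = extChartAt (𝓡 n) m x := by
    rw [transition, extChartAt_to_inv]
  have key := riemannFun_change (hh m) ((hh x).mono hWo fun q hq => ⟨hq.1, hq.2.2⟩)
    ((contDiffOn_transition x m).mono fun q hq => ⟨hq.1, hq.2.1⟩)
    (fun q hq => ⟨(extChartAt (𝓡 n) m).map_source hq.2.1, by
      rw [mem_preimage, transition, (extChartAt (𝓡 n) m).left_inv hq.2.1]; exact hq.2.2⟩)
    (fun q hq u v => inChart_transition h ⟨hq.1, hq.2.1⟩ u v) hpW a b c d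
  rw [key, e]

variable [RiemannianBundle (fun x : M => TangentSpace (𝓡 n) x)]

/-- The curvature tensor and the metric in the preferred chart at `m`, at another point. -/
theorem exists_transfer {m x : M} (hx : x ∈ (extChartAt (𝓡 n) m).source) :
    ∃ D : EuclideanSpace ℝ (Fin n) ≃ₗ[ℝ] EuclideanSpace ℝ (Fin n),
      (∀ u v, inChart n (metricField n M) m (extChartAt (𝓡 n) m x) (D u) (D v) =
        onModel (metricField n M) x u v) ∧
      ∀ {h : (x : M) → LinearMap.BilinForm ℝ (TangentSpace (𝓡 n) x)} {U : Set M}, IsOpen U →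
        (∀ m : M, IsMetricOn (inChart n h m)
          ((extChartAt (𝓡 n) m).target ∩ (extChartAt (𝓡 n) m).symm ⁻¹' U)) → x ∈ U →
        ∀ a b c d, riemannFun (inChart n h m) (extChartAt (𝓡 n) m x) (D a) (D b) (D c) (D d) =
          riemannFun (inChart n h x) (extChartAt (𝓡 n) x x) a b c d := by
  have hq : extChartAt (𝓡 n) x x ∈ (extChartAt (𝓡 n) x).target ∩
      (extChartAt (𝓡 n) x).symm ⁻¹' (extChartAt (𝓡 n) m).source := by
    refine ⟨mem_extChartAt_target x, ?_⟩
    rw [mem_preimage, extChartAt_to_inv]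
    exact hx
  have hinj : Function.Injective
      (fderiv ℝ (transition n x m) (extChartAt (𝓡 n) x x)).toLinearMap := by
    intro a b hab
    have h1 := symmDeriv_transition hq a
    rw [show fderiv ℝ (transition n x m) (extChartAt (𝓡 n) x x) a =
      fderiv ℝ (transition n x m) (extChartAt (𝓡 n) x x) b from hab, ← symmDeriv_transition hq] at h1
    exact symmDeriv_injective hq.1 h1
  -- `D` is the derivative of the transition map and does not depend on `h`, so the same `D` serves
  -- the metric and its conformal changes.
  refine ⟨LinearEquiv.ofInjectiveEndo _ hinj, fun u v => ?_, fun hU hh hxU a b c d =>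
    (riemannFun_transition hU hh hx hxU a b c d).symm⟩
  have h1 := inChart_transition (metricField n M) hq u v
  rw [inChart_self, transition, extChartAt_to_inv] at h1
  exact h1.symm

variable [IsContMDiffRiemannianBundle (𝓡 n) ∞ (EuclideanSpace ℝ (Fin n))
  (fun x : M => TangentSpace (𝓡 n) x)]

theorem isMetricOn_inChart (m : M) :
    IsMetricOn (inChart n (metricField n M) m) (extChartAt (𝓡 n) m).target where
  isOpen := isOpen_target m
  contDiffOn := by
    refine contDiffOn_clm_apply.2 fun u => contDiffOn_clm_apply.2 fun v => ?_
    rw [← contMDiffOn_iff_contDiffOn]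
    exact (contMDiffOn_symmDeriv m u).inner_bundle (contMDiffOn_symmDeriv m v)
  symm p u v := onModel_metricField_symm _ _ _
  pos p hp v hv := by
    have hne : symmDeriv n m p v ≠ 0 := fun h0 =>
      hv (symmDeriv_injective hp (h0.trans (map_zero _).symm))
    exact onModel_metricField_pos _ hne

theorem isMetricOn_inChart_conf {U : Set M} (hU : IsOpen U) {f : M → ℝ}
    (hf : ContMDiffOn (𝓡 n) 𝓘(ℝ, ℝ) ∞ f U) (m : M) :
    ContDiffOn ℝ ∞ (fun q => f ((extChartAt (𝓡 n) m).symm q))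
      ((extChartAt (𝓡 n) m).target ∩ (extChartAt (𝓡 n) m).symm ⁻¹' U) ∧
    IsMetricOn (inChart n (confField f) m)
      ((extChartAt (𝓡 n) m).target ∩ (extChartAt (𝓡 n) m).symm ⁻¹' U) := by
  have h1 : ContDiffOn ℝ ∞ (fun q => f ((extChartAt (𝓡 n) m).symm q))
      ((extChartAt (𝓡 n) m).target ∩ (extChartAt (𝓡 n) m).symm ⁻¹' U) := by
    rw [← contMDiffOn_iff_contDiffOn]
    exact hf.comp ((contMDiffOn_extChartAt_symm (n := ∞) m).mono inter_subset_left)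
      inter_subset_right
  refine ⟨h1, ?_⟩
  rw [inChart_confField]
  exact ((isMetricOn_inChart m).mono (isOpen_inter_preimage_symm m hU) inter_subset_left).conformal
    h1

end Riem

open Bundle

/-! ### Conformal flatness and Schur's lemma on the manifold -/

namespace CoordMetric

set_option maxSynthPendingDepth 3

open Filter Topology

/-- Curvature depends only on the germ of the metric. A conformal factor given on part of a chart
can thus be replaced by its pullback to the manifold. -/
theorem riemannFun_congr {E : Type*} [NormedAddCommGroup E] [NormedSpace ℝ E]
    {G G' : E → E →L[ℝ] E →L[ℝ] ℝ} {p : E} (h : G =ᶠ[𝓝 p] G') (x y z w : E) :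
    riemannFun G p x y z w = riemannFun G' p x y z w := by
  simp only [riemannFun, christoffel, christoffelFirst, h.fderiv_eq, h.eq_of_nhds,
    h.fderiv.fderiv_eq]

end CoordMetric

namespace Riem

set_option maxSynthPendingDepth 3

open Filter Topology Set CoordMetric DoubleForm

variable {n : ℕ} {M : Type*} [TopologicalSpace M] [ChartedSpace (EuclideanSpace ℝ (Fin n)) M]

theorem finrank_tangentSpace (m : M) : finrank ℝ (TangentSpace (𝓡 n) m) = n :=
  finrank_euclideanSpace_fin

variable [RiemannianBundle (fun x : M => TangentSpace (𝓡 n) x)]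

theorem ricci_eq_smul_iff (m : M) (κ : ℝ) : ricci n m = κ • metric (TangentSpace (𝓡 n) m) ↔
    ∀ x y : TangentSpace (𝓡 n) m, ricForm (riemann n m) x y = κ * inner ℝ x y := by
  constructor
  · intro h x y
    rw [ricForm, ← ricci, h]
    rfl
  · intro h
    ext v w
    have hv : v = ![v 0] := by ext i; fin_cases i; rfl
    have hw : w = ![w 0] := by ext i; fin_cases i; rfl
    rw [hv, hw]
    exact h (v 0) (w 0)

variable [IsManifold (𝓡 n) ∞ M] [IsContMDiffRiemannianBundle (𝓡 n) ∞ (EuclideanSpace ℝ (Fin n))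
  (fun x : M => TangentSpace (𝓡 n) x)]

theorem isCurvatureLike_riemann (m : M) :
    IsCurvatureLike fun x y z w : TangentSpace (𝓡 n) m => riemann n m ![x, y] ![z, w] :=
  (isMetricOn_inChart m).isCurvatureLike (mem_extChartAt_target m)

/-- The curvature tensor of a conformally flat manifold is a Kulkarni-Nomizu product. -/
theorem IsConformallyFlat.eq_kulkarniNomizu (h : IsConformallyFlat n M) (m : M) :
    ∃ B : TangentSpace (𝓡 n) m → TangentSpace (𝓡 n) m → ℝ, ∀ x y z w : TangentSpace (𝓡 n) m,
      riemann n m ![x, y] ![z, w] =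
        inner ℝ x z * B y w + inner ℝ y w * B x z - inner ℝ x w * B y z - inner ℝ y z * B x w := by
  obtain ⟨U, hU, hmU, f, hf, hflat⟩ := h m
  have hm : extChartAt (𝓡 n) m m ∈ (extChartAt (𝓡 n) m).target ∩ (extChartAt (𝓡 n) m).symm ⁻¹' U := by
    refine ⟨mem_extChartAt_target m, ?_⟩
    rw [mem_preimage, extChartAt_to_inv]
    exact hmU
  obtain ⟨B, hB⟩ := eq_kulkarniNomizu_of_conformallyFlat
    ((isMetricOn_inChart m).mono (isOpen_inter_preimage_symm m hU) inter_subset_left)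
    (isMetricOn_inChart_conf hU hf m).1 hm (fun x y z w => by
      rw [← inChart_confField]
      exact congrArg (fun R : DoubleForm (TangentSpace (𝓡 n) m) 2 2 => R ![x, y] ![z, w])
        (hflat m hmU))
  simp only [inChart_self] at hB
  exact ⟨B, hB⟩

/-- A manifold of dimension at least four, whose curvature tensor is a Kulkarni-Nomizu product with
the metric, is conformally flat. -/
theorem isConformallyFlat_of_kulkarniNomizu (hn : 4 ≤ n)
    (hB : ∀ m : M, ∃ B : TangentSpace (𝓡 n) m →ₗ[ℝ] TangentSpace (𝓡 n) m →ₗ[ℝ] ℝ,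
      (∀ x y, B x y = B y x) ∧ ∀ x y z w : TangentSpace (𝓡 n) m, riemann n m ![x, y] ![z, w] =
        inner ℝ x z * B y w + inner ℝ y w * B x z - inner ℝ x w * B y z - inner ℝ y z * B x w) :
    IsConformallyFlat n M := by
  intro m
  have hmetric : ∀ m : M, IsMetricOn (inChart n (metricField n M) m)
      ((extChartAt (𝓡 n) m).target ∩ (extChartAt (𝓡 n) m).symm ⁻¹' univ) := fun m => by
    rw [preimage_univ, inter_univ]; exact isMetricOn_inChart m
  have hn' : 4 ≤ finrank ℝ (EuclideanSpace ℝ (Fin n)) := by rwa [finrank_euclideanSpace_fin]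
  obtain ⟨f, W, hW, hmW, hsub, hf, hflat⟩ := exists_conformal_factor_of_kulkarniNomizu
    (isMetricOn_inChart m) hn' (fun q hq => by
      have hx := (extChartAt (𝓡 n) m).map_target hq
      obtain ⟨D, hD, hR⟩ := exists_transfer hx
      rw [(extChartAt (𝓡 n) m).right_inv hq] at hD
      have hR' := hR isOpen_univ hmetric (mem_univ _)
      rw [(extChartAt (𝓡 n) m).right_inv hq] at hR'
      obtain ⟨B, hBs, hB'⟩ := hB ((extChartAt (𝓡 n) m).symm q)
      let B₁ : EuclideanSpace ℝ (Fin n) →ₗ[ℝ] EuclideanSpace ℝ (Fin n) →ₗ[ℝ] ℝ := B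
      refine ⟨B₁.compl₁₂ D.symm.toLinearMap D.symm.toLinearMap, fun x y => hBs _ _,
        fun x y z w => ?_⟩
      have e1 := hR' (D.symm x) (D.symm y) (D.symm z) (D.symm w)
      have e2 := hB' (D.symm x) (D.symm y) (D.symm z) (D.symm w)
      have e3 : ∀ u v, inChart n (metricField n M) m q u v =
          onModel (metricField n M) ((extChartAt (𝓡 n) m).symm q) (D.symm u) (D.symm v) := by
        intro u v
        rw [← hD, D.apply_symm_apply, D.apply_symm_apply]
      simp only [D.apply_symm_apply] at e1
      rw [e1]
      simp only [e3]
      exact e2) (mem_extChartAt_target m)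
  set U : Set M := (extChartAt (𝓡 n) m).source ∩ extChartAt (𝓡 n) m ⁻¹' W with hUdef
  have hU : IsOpen U := (continuousOn_extChartAt m).isOpen_inter_preimage
    (isOpen_extChartAt_source m) hW
  set F : M → ℝ := fun x => f (extChartAt (𝓡 n) m x) with hF
  have hFs : ContMDiffOn (𝓡 n) 𝓘(ℝ, ℝ) ∞ F U := by
    have h1 := contMDiffOn_extChartAt (I := 𝓡 n) (n := ∞) (x := m)
    rw [← extChartAt_source (𝓡 n)] at h1
    exact (contMDiffOn_iff_contDiffOn.2 hf).comp (h1.mono inter_subset_left) fun x hx => hx.2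
  refine ⟨U, hU, ⟨mem_extChartAt_source m, hmW⟩, F, hFs, fun x hx => ?_⟩
  obtain ⟨D, -, hR⟩ := exists_transfer hx.1
  have hR' := hR (h := confField F) hU (fun z => (isMetricOn_inChart_conf hU hFs z).2) hx
  have hcongr : inChart n (confField F) m =ᶠ[𝓝 (extChartAt (𝓡 n) m x)]
      fun q => Real.exp (2 * f q) • inChart n (metricField n M) m q := by
    filter_upwards [hW.mem_nhds hx.2] with q hq
    rw [inChart_confField, hF]
    simp only [(extChartAt (𝓡 n) m).right_inv (hsub hq)]
  have hzero : ∀ a b c d, riemannFun (inChart n (confField F) x) (extChartAt (𝓡 n) x x) a b c d =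
      0 := fun a b c d => by
    rw [← hR', riemannFun_congr hcongr]
    exact hflat _ hx.2 _ _ _ _
  ext v w
  exact hzero (v 0) (v 1) (w 0) (w 1)

/-- The scalar curvature of a manifold of dimension at least three is locally constant, if the Ricci
tensor is a multiple of the metric at every point. -/
theorem isLocallyConstant_scal (hn : 3 ≤ n) (hric : ∀ (m : M) (x y : TangentSpace (𝓡 n) m),
    ricForm (riemann n m) x y = scal n m / n * inner ℝ x y) :
    IsLocallyConstant fun m : M => scal n m := by
  rw [IsLocallyConstant.iff_eventually_eq]
  intro m
  have hmetric : ∀ m : M, IsMetricOn (inChart n (metricField n M) m)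
      ((extChartAt (𝓡 n) m).target ∩ (extChartAt (𝓡 n) m).symm ⁻¹' univ) := fun m => by
    rw [preimage_univ, inter_univ]; exact isMetricOn_inChart m
  have hder : ∀ q ∈ (extChartAt (𝓡 n) m).target, HasFDerivAt
      (fun q => scal n ((extChartAt (𝓡 n) m).symm q) / n)
      (0 : EuclideanSpace ℝ (Fin n) →L[ℝ] ℝ) q := by
    intro q hq
    -- Schur's lemma is applied in one chart with `κ` the scalar curvature over `n`; the Ricci
    -- hypothesis, stated in each point's own chart, is carried over by `D`.
    refine schur (isMetricOn_inChart m) (by rwa [finrank_euclideanSpace_fin])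
      (fun q => scal n ((extChartAt (𝓡 n) m).symm q) / n) (fun q hq v w => ?_) hq
    have hx := (extChartAt (𝓡 n) m).map_target hq
    obtain ⟨D, hD, hR⟩ := exists_transfer hx
    rw [(extChartAt (𝓡 n) m).right_inv hq] at hD
    have hR' := hR isOpen_univ hmetric (mem_univ _)
    rw [(extChartAt (𝓡 n) m).right_inv hq] at hR'
    set x := (extChartAt (𝓡 n) m).symm q with hxdef
    let b := (stdOrthonormalBasis ℝ (TangentSpace (𝓡 n) x))
    let b₁ : Basis (Fin (finrank ℝ (TangentSpace (𝓡 n) x))) ℝ (EuclideanSpace ℝ (Fin n)) := b.toBasis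
    let e := b₁.map D
    let b₂ : Fin (finrank ℝ (TangentSpace (𝓡 n) x)) → EuclideanSpace ℝ (Fin n) := fun i => b i
    have he : ∀ i, e i = D (b₂ i) := fun i => by
      rw [Basis.map_apply]; exact congrArg D (congrFun b.coe_toBasis i)
    have hbb : ∀ i j, inChart n (metricField n M) m q (e i) (e j) = if i = j then 1 else 0 := by
      intro i j
      rw [he, he, hD]
      exact orthonormal_iff_ite.1 b.orthonormal i j
    rw [← ricMap_apply, ricMap_eq_sum (isMetricOn_inChart m) hq (e := e)
      (fun i => by rw [hbb, if_pos rfl]) (fun i j hij => by rw [hbb, if_neg hij])]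
    obtain ⟨v, rfl⟩ := D.surjective v
    obtain ⟨w, rfl⟩ := D.surjective w
    rw [hD]
    simp only [he, hR']
    exact (ricForm_eq_sum_of_add b (isCurvatureLike_riemann x) v w).symm.trans (hric x v w)
  obtain ⟨r, hr, hball⟩ := Metric.isOpen_iff.1 (isOpen_target (n := n) m) _
    (mem_extChartAt_target m)
  have hn0 : (n : ℝ) ≠ 0 := by positivity
  -- A ball in the chart is convex, so a zero derivative makes the function constant on it.
  have hconst : ∀ q ∈ Metric.ball (extChartAt (𝓡 n) m m) r,
      scal n ((extChartAt (𝓡 n) m).symm q) / n = scal n m / n := by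
    intro q hq
    have := (convex_ball (extChartAt (𝓡 n) m m) r).is_const_of_fderivWithin_eq_zero (𝕜 := ℝ)
      (f := fun q => scal n ((extChartAt (𝓡 n) m).symm q) / n)
      (fun q hq => (hder q (hball hq)).differentiableAt.differentiableWithinAt)
      (fun q hq => by
        rw [fderivWithin_of_isOpen Metric.isOpen_ball hq, (hder q (hball hq)).fderiv])
      hq (Metric.mem_ball_self hr)
    simpa only [extChartAt_to_inv] using this
  have hcont : ContinuousAt (extChartAt (𝓡 n) m) m := continuousAt_extChartAt m
  filter_upwards [hcont.preimage_mem_nhds (Metric.ball_mem_nhds _ hr),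
    extChartAt_source_mem_nhds (I := 𝓡 n) m] with x hx hxs
  have := hconst _ hx
  rw [(extChartAt (𝓡 n) m).left_inv hxs] at this
  exact (div_left_inj' hn0).1 this

end Riem

open Bundle

namespace DoubleForm

variable {V : Type*} [NormedAddCommGroup V] [InnerProductSpace ℝ V] [FiniteDimensional ℝ V] {n : ℕ}
  {R : DoubleForm V 2 2}

/-- The Schouten form as a bilinear map. -/
def schoutenBilin (hR : IsCurvatureLike fun x y z w => R ![x, y] ![z, w]) : V →ₗ[ℝ] V →ₗ[ℝ] ℝ :=
  have hs : ∀ x y, schoutenForm R x y = schoutenForm R y x := fun x y => by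
    simp only [schoutenForm, ricForm_symm hR x, real_inner_comm]
  have ha : ∀ x x' y, schoutenForm R (x + x') y = schoutenForm R x y + schoutenForm R x' y :=
    fun x x' y => by simp only [schoutenForm, ricForm_add hR, inner_add_left]; ring
  have hm : ∀ (t : ℝ) x y, schoutenForm R (t • x) y = t * schoutenForm R x y :=
    fun t x y => by simp only [schoutenForm, ricForm_smul hR, real_inner_smul_left]; ring
  LinearMap.mk₂ ℝ (schoutenForm R) ha hm (fun x y y' => by rw [hs, ha, hs y, hs y'])
    (fun t x y => by rw [hs, hm, hs y]; rfl)

theorem schoutenForm_symm (hR : IsCurvatureLike fun x y z w => R ![x, y] ![z, w]) (x y : V) :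
    schoutenForm R x y = schoutenForm R y x := by
  simp only [schoutenForm, ricForm_symm hR x, real_inner_comm]

theorem exists_submodule_finrank (hV : finrank ℝ V = n) {p : ℕ} (hp : p ≤ n) :
    ∃ P : Submodule ℝ V, finrank ℝ P = p := by
  obtain ⟨T, -, hT⟩ := Finset.exists_subset_card_eq
    (s := (Finset.univ : Finset (Fin (finrank ℝ V)))) (n := p) (by simpa [hV] using hp)
  exact ⟨coordPlane (stdOrthonormalBasis ℝ V) T, by rw [finrank_coordPlane, hT]⟩

theorem eq_scalForm_of_combination
    (hR : IsCurvatureLike fun x y z w => R ![x, y] ![z, w]) (hV : finrank ℝ V = n) {p : ℕ}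
    (hp : 2 ≤ p) (hn : n = 2 * p) (c : ℝ) (H : ∀ P : Submodule ℝ V, finrank ℝ P = p →
      R.pCurvature p P + R.pCurvature p Pᗮ = c) :
    c = ((n : ℝ) - 2) / (4 * (n - 1)) * scalForm R := by
  obtain ⟨P, hP⟩ := exists_submodule_finrank hV (p := p) (by omega)
  rw [← H P hP]
  exact combination_of_conformallyFlat hR hV hp hn (schoutenForm R)
    (eq_kulkarniNomizu_of_combination hR hV hp hn c H) P hP

end DoubleForm

/-! ### From pointwise statements to the manifold -/

namespace Riem

open DoubleForm

variable {n : ℕ} {M : Type*} [TopologicalSpace M] [ChartedSpace (EuclideanSpace ℝ (Fin n)) M]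
  [RiemannianBundle (fun x : M => TangentSpace (𝓡 n) x)]

/-- Combinations of the `p`-curvature and of the `(n - p)`-curvature of the complement that
determine the sectional curvature. -/
theorem exists_const_combination_iff {p : ℕ} (hp : 2 ≤ p) (hp' : p + 2 ≤ n) (x y : ℝ)
    (hxy : x + y ≠ 0) (hne : x * (p - 1) ≠ y * (n - p - 1))
    (hpos : x * (p * (p - 1) / 2) + y * ((n - p) * (n - p - 1) / 2) ≠ (0 : ℝ)) :
    (∃ c : ℝ, IsConstOnPlanes n M p
      (fun m P => x * pCurv n (n - p) m Pᗮ + y * pCurv n p m P) c) ↔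
      HasConstantSectionalCurvature n M := by
  constructor
  · rintro ⟨c, hc⟩
    refine ⟨c / (x * (p * (p - 1) / 2) + y * ((n - p) * (n - p - 1) / 2)), fun m P hP => ?_⟩
    rw [eq_div_iff hpos]
    exact sectional_const_of_combination_const (V := TangentSpace (𝓡 n) m) (finrank_tangentSpace m) hp hp' x y c hxy hne (hc m)
      P hP
  · rintro ⟨κ, hκ⟩
    exact ⟨_, fun m P hP => combination_const_of_sectional_const (V := TangentSpace (𝓡 n) m) (finrank_tangentSpace m) x y κ
      (hκ m) P hP⟩

variable [IsManifold (𝓡 n) ∞ M] [IsContMDiffRiemannianBundle (𝓡 n) ∞ (EuclideanSpace ℝ (Fin n))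
  (fun x : M => TangentSpace (𝓡 n) x)]

theorem eq_scal_of_const_sum {p : ℕ} (hp : 2 ≤ p) (hp' : p + 2 ≤ n) (hn : n ≠ 2 * p) {c : ℝ}
    (hc : IsConstOnPlanes n M p (fun m P => pCurv n p m P + pCurv n (n - p) m Pᗮ) c) (m : M) :
    c = (2 * (p : ℝ) * (p - 1) + ((n : ℝ) - 2 * p) * (n - 1)) / (2 * n * (n - 1)) * scal n m := by
  have hp2 : (2 : ℝ) ≤ p := by exact_mod_cast hp
  have hn2 : (p : ℝ) + 2 ≤ n := by exact_mod_cast hp'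
  -- The exceptional case of the row argument with equal weights is exactly `n = 2p`.
  have hne : (1 : ℝ) * (p - 1) ≠ 1 * (n - p - 1) := fun h => hn (by
    have : (n : ℝ) = 2 * p := by linarith
    exact_mod_cast this)
  have hpos : (0 : ℝ) < 1 * (p * (p - 1) / 2) + 1 * ((n - p) * (n - p - 1) / 2) := by
    have h1 : (0 : ℝ) < p * (p - 1) := mul_pos (by linarith) (by linarith)
    have h2 : (0 : ℝ) < (n - p) * (n - p - 1) := mul_pos (by linarith) (by linarith)
    linarith
  have hsec : ∀ P : Submodule ℝ (TangentSpace (𝓡 n) m), finrank ℝ P = 2 →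
      (riemann n m).sectional P =
        c / (1 * (p * (p - 1) / 2) + 1 * ((n - p) * (n - p - 1) / 2)) := fun P hP => by
    rw [eq_div_iff hpos.ne']
    refine sectional_const_of_combination_const (V := TangentSpace (𝓡 n) m) (finrank_tangentSpace m) hp hp' 1 1 c (by norm_num)
      hne (fun P hP => ?_) P hP
    rw [one_mul, one_mul, add_comm]
    exact hc m P hP
  have hs : scal n m = _ := scalForm_of_sectional_const (V := TangentSpace (𝓡 n) m) (isCurvatureLike_riemann m)
    (finrank_tangentSpace m) _ hsec
  have hn0 : (n : ℝ) ≠ 0 := by linarith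
  have hn1 : (n : ℝ) - 1 ≠ 0 := by linarith
  rw [hs]
  have h0 := hpos.ne'
  have e : c = c / (1 * (p * (p - 1) / 2) + 1 * ((n - p) * (n - p - 1) / 2)) *
      (1 * (p * (p - 1) / 2) + 1 * ((n - p) * (n - p - 1) / 2)) := (div_mul_cancel₀ _ h0).symm
  set κ := c / (1 * (p * (p - 1) / 2) + 1 * ((n - p) * (n - p - 1) / 2))
  rw [e]
  field_simp
  ring

theorem eq_scal_of_const_difference {p : ℕ} (hp : 1 ≤ p) (hp' : p + 1 ≤ n) {c : ℝ}
    (hc : IsConstOnPlanes n M p (fun m P => pCurv n p m P - pCurv n (n - p) m Pᗮ) c) (m : M) :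
    c = ((n : ℝ) - 2 * p) / (2 * n) * scal n m :=
  (einstein_of_difference (V := TangentSpace (𝓡 n) m) (isCurvatureLike_riemann m) (finrank_tangentSpace m) hp hp' c (hc m)).2

/-- Ricci is a multiple of the metric at each point in either case. For `n ≠ 2p` the constant
determines the scalar curvature; for `n = 2p` it is always zero, and Schur's lemma on a connected
manifold replaces it. -/
theorem isEinstein_iff {p : ℕ} (hn : 3 ≤ n) (hp : 1 ≤ p) (hp' : p + 1 ≤ n)
    (hM : n = 2 * p → PreconnectedSpace M) : IsEinstein n M ↔ ∃ c : ℝ, IsConstOnPlanes n M p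
      (fun m P => pCurv n p m P - pCurv n (n - p) m Pᗮ) c := by
  constructor
  · rintro ⟨κ, hκ⟩
    exact ⟨_, fun m P hP => difference_of_einstein (V := TangentSpace (𝓡 n) m) (isCurvatureLike_riemann m)
      (finrank_tangentSpace m) κ ((ricci_eq_smul_iff m κ).1 (hκ m)) P hP⟩
  · rintro ⟨c, hc⟩
    have hric : ∀ (m : M) (x y : TangentSpace (𝓡 n) m),
        ricForm (riemann n m) x y = scal n m / n * inner ℝ x y := fun m =>
      (einstein_of_difference (V := TangentSpace (𝓡 n) m) (isCurvatureLike_riemann m) (finrank_tangentSpace m) hp hp' c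
        (hc m)).1
    have hscal : ∃ s, ∀ m : M, scal n m = s := by
      by_cases h2 : n = 2 * p
      · have := hM h2
        rcases isEmpty_or_nonempty M with hempty | ⟨⟨m₀⟩⟩
        · exact ⟨0, fun m => hempty.elim m⟩
        · exact ⟨scal n m₀, fun m =>
            (isLocallyConstant_scal hn hric).apply_eq_of_preconnectedSpace m m₀⟩
      · have hne : (n : ℝ) - 2 * p ≠ 0 := fun h => h2 (by
          have : (n : ℝ) = 2 * p := by linarith
          exact_mod_cast this)
        have hn0 : (n : ℝ) ≠ 0 := by positivity
        refine ⟨c * (2 * n) / (n - 2 * p), fun m => ?_⟩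
        rw [eq_div_iff hne, eq_scal_of_const_difference hp hp' hc m]
        field_simp
    obtain ⟨s, hs⟩ := hscal
    exact ⟨s / n, fun m => (ricci_eq_smul_iff m _).2 fun x y => by rw [hric, hs]⟩

theorem eq_scal_of_const_sum_half {p : ℕ} (hp : 2 ≤ p) (hn : n = 2 * p) {c : ℝ}
    (hc : IsConstOnPlanes n M p (fun m P => pCurv n p m P + pCurv n p m Pᗮ) c) (m : M) :
    c = ((n : ℝ) - 2) / (4 * (n - 1)) * scal n m :=
  eq_scalForm_of_combination (V := TangentSpace (𝓡 n) m) (isCurvatureLike_riemann m) (finrank_tangentSpace m) hp hn c (hc m)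

/-- The Kulkarni-Nomizu form of the curvature links both sides. The constant is a nonzero multiple
of the scalar curvature, because `n ≥ 4`. -/
theorem isConformallyFlat_iff {p : ℕ} (hp : 2 ≤ p) (hn : n = 2 * p) :
    (IsConformallyFlat n M ∧ HasConstantScalarCurvature n M) ↔
      ∃ c : ℝ, IsConstOnPlanes n M p (fun m P => pCurv n p m P + pCurv n p m Pᗮ) c := by
  have hn4 : (4 : ℝ) ≤ n := by exact_mod_cast (by omega : 4 ≤ n)
  constructor
  · rintro ⟨hflat, s, hs⟩
    refine ⟨((n : ℝ) - 2) / (4 * (n - 1)) * s, fun m P hP => ?_⟩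
    obtain ⟨B, hB⟩ := hflat.eq_kulkarniNomizu m
    have := combination_of_conformallyFlat (V := TangentSpace (𝓡 n) m) (isCurvatureLike_riemann m) (finrank_tangentSpace m) hp
      hn B hB P hP
    rw [← hs m]
    exact this
  · rintro ⟨c, hc⟩
    refine ⟨isConformallyFlat_of_kulkarniNomizu (by omega) fun m =>
      ⟨schoutenBilin (isCurvatureLike_riemann m), schoutenForm_symm (isCurvatureLike_riemann m),
        eq_kulkarniNomizu_of_combination (V := TangentSpace (𝓡 n) m) (isCurvatureLike_riemann m) (finrank_tangentSpace m) hp hn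
          c (hc m)⟩, c * (4 * (n - 1)) / (n - 2), fun m => ?_⟩
    have h2 : (n : ℝ) - 2 ≠ 0 := by linarith
    have h1 : (n : ℝ) - 1 ≠ 0 := by linarith
    rw [eq_div_iff h2, eq_scal_of_const_sum_half hp hn hc m]
    field_simp

end Riem

end

theorem mainTheorem8 (n : ℕ) (M : Type*) [TopologicalSpace M]
    [ChartedSpace (EuclideanSpace ℝ (Fin n)) M] [IsManifold (𝓡 n) ∞ M]
    [RiemannianBundle (fun x : M => TangentSpace (𝓡 n) x)]
    [IsContMDiffRiemannianBundle (𝓡 n) ∞ (EuclideanSpace ℝ (Fin n))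
      (fun x : M => TangentSpace (𝓡 n) x)] :
    -- constant `p`-curvature
    (∀ p : ℕ, 2 ≤ p → p + 2 ≤ n →
      ((∃ c : ℝ, Riem.IsConstOnPlanes n M p (fun m P => Riem.pCurv n p m P) c) ↔
        Riem.HasConstantSectionalCurvature n M)) ∧
    -- Einstein metrics
    (∀ p : ℕ, 3 ≤ n → 1 ≤ p → p + 1 ≤ n → (n = 2 * p → PreconnectedSpace M) →
      (Riem.IsEinstein n M ↔ ∃ c : ℝ, Riem.IsConstOnPlanes n M p
        (fun m P => Riem.pCurv n p m P - Riem.pCurv n (n - p) m Pᗮ) c) ∧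
      ∀ c : ℝ, Riem.IsConstOnPlanes n M p
        (fun m P => Riem.pCurv n p m P - Riem.pCurv n (n - p) m Pᗮ) c →
        ∀ m : M, c = ((n : ℝ) - 2 * p) / (2 * n) * Riem.scal n m) ∧
    -- the sum in the case `n ≠ 2 p`
    (∀ p : ℕ, 2 ≤ p → p + 2 ≤ n → n ≠ 2 * p →
      ((∃ c : ℝ, Riem.IsConstOnPlanes n M p
        (fun m P => Riem.pCurv n p m P + Riem.pCurv n (n - p) m Pᗮ) c) ↔
        Riem.HasConstantSectionalCurvature n M) ∧
      ∀ c : ℝ, Riem.IsConstOnPlanes n M p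
        (fun m P => Riem.pCurv n p m P + Riem.pCurv n (n - p) m Pᗮ) c →
        ∀ m : M, c = (2 * (p : ℝ) * (p - 1) + ((n : ℝ) - 2 * p) * (n - 1)) / (2 * n * (n - 1)) *
          Riem.scal n m) ∧
    -- the sum in the case `n = 2 p`
    (∀ p : ℕ, 2 ≤ p → n = 2 * p →
      ((Riem.IsConformallyFlat n M ∧ Riem.HasConstantScalarCurvature n M) ↔
        ∃ c : ℝ, Riem.IsConstOnPlanes n M p
          (fun m P => Riem.pCurv n p m P + Riem.pCurv n p m Pᗮ) c) ∧
      ∀ c : ℝ, Riem.IsConstOnPlanes n M p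
        (fun m P => Riem.pCurv n p m P + Riem.pCurv n p m Pᗮ) c →
        ∀ m : M, c = ((n : ℝ) - 2) / (4 * (n - 1)) * Riem.scal n m) := by
  refine ⟨fun p hp hp' => ?_, fun p hn hp hp' hM => ⟨Riem.isEinstein_iff hn hp hp' hM,
    fun c hc m => Riem.eq_scal_of_const_difference hp hp' hc m⟩, fun p hp hp' hne =>
    ⟨?_, fun c hc m => Riem.eq_scal_of_const_sum hp hp' hne hc m⟩, fun p hp hn =>
    ⟨Riem.isConformallyFlat_iff hp hn, fun c hc m => Riem.eq_scal_of_const_sum_half hp hn hc m⟩⟩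
  · have hp2 : (2 : ℝ) ≤ p := by exact_mod_cast hp
    have hn2 : (p : ℝ) + 2 ≤ n := by exact_mod_cast hp'
    have h1 : (0 : ℝ) < n - p - 1 := by linarith
    have h2 : (0 : ℝ) < (n - p) * (n - p - 1) := mul_pos (by linarith) h1
    -- Weights `(0, 1)` leave `s_p` alone; the row condition becomes `0 ≠ n - p - 1`, which is where
    -- `p ≤ n - 2` enters.
    have key := Riem.exists_const_combination_iff (M := M) hp hp' 0 1 (by norm_num)
      (by rw [zero_mul, one_mul]; exact h1.ne) (by rw [zero_mul, one_mul]; linarith)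
    simpa only [zero_mul, zero_add, one_mul] using key
  · have hp2 : (2 : ℝ) ≤ p := by exact_mod_cast hp
    have hn2 : (p : ℝ) + 2 ≤ n := by exact_mod_cast hp'
    have h1 : (0 : ℝ) < p * (p - 1) := mul_pos (by linarith) (by linarith)
    have h2 : (0 : ℝ) < (n - p) * (n - p - 1) := mul_pos (by linarith) (by linarith)
    -- Weights `(1, 1)` give the sum; the row condition fails only for `n = 2p`.
    have key := Riem.exists_const_combination_iff (M := M) hp hp' 1 1 (by norm_num)
      (fun h => hne (by
        have : (n : ℝ) = 2 * p := by linarith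
        exact_mod_cast this)) (by rw [one_mul, one_mul]; linarith)
    simpa only [one_mul, add_comm] using key
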